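/- Let $K$ be an algebraically closed field and let $X$ be a normal projective variety over $K$. "General $x\in X$" means: all $x\in X(K)$ in some dense open subset of $X$. A family of curves $U\xleftarrow{\pi}C\xrightarrow{\phi}X$ consists of $K$-schemes and $K$-morphisms. For $x\in X(K)$ set $U_x:=\phi^{-1}(x)\subset C$, which parametrizes pairs $(u,c)$ with $c$ a point of the curve $C_u$ such that $\phi(c)=x$, and let $$\phi_x\colon C\times_U U_x\to X,\qquad (c,c')\mapsto\phi(c).$$ The family satisfies the *Lefschetz condition* if for general $x\in X$ the morphism $\phi_x$ is dominant with geometrically irreducible generic fibre. **Lemma.** Let $U$ be a smooth separated scheme of finite type over $K$, and let $U\xleftarrow{\pi}C_U\xrightarrow{\phi}X$ be a family of curves with $\pi$ flat and proper, all of whose geometric fibres are non-empty, reduced and of pure dimension one. Assume that the geometric fibres of $\pi$ over some dense open subset of $U$ are irreducible, and that $U_x=\phi^{-1}(x)$ is irreducible for general $x\in X$. Let $W\subset U$ be a locally closed smooth subscheme, put $C_W:=C_U\times_U W$, and let $W\times\mathbb P^1\cong D_W\subset C_W$ be a closed subscheme, the isomorphism being over $W$. Let $U^0\subset U$ be a dense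 open subset and put $C_{U^0}:=\pi^{-1}(U^0)$. If $$W\xleftarrow{\pi}D_W\xrightarrow{\phi}X$$ satisfies the Lefschetz condition, then so does $$U^0\xleftarrow{\pi}C_{U^0}\xrightarrow{\phi}X.$$ -/

import Mathlib

open CategoryTheory CategoryTheory.Limits AlgebraicGeometry

universe u

namespace CurveFamilies

noncomputable section

attribute [local instance] MvPolynomial.gradedAlgebra

/-- Projective `n`-space `ℙⁿ` over a field `K`, as `Proj K[x₀, …, xₙ]`. -/
def projSpace (n : ℕ) (K : Type u) [Field K] : Scheme.{u} :=
  Proj (MvPolynomial.homogeneousSubmodule (Fin (n + 1)) K)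

/-- The structure morphism `ℙⁿ ⟶ Spec K`. -/
def projSpaceStr (n : ℕ) (K : Type u) [Field K] : projSpace n K ⟶ Spec (.of K) :=
  Proj.toSpecZero (MvPolynomial.homogeneousSubmodule (Fin (n + 1)) K) ≫
    Spec.map (CommRingCat.ofHom
      (algebraMap K (MvPolynomial.homogeneousSubmodule (Fin (n + 1)) K 0)))

/-- A `K`-scheme is projective if it is a closed `K`-subscheme of some `ℙⁿ`. -/
def IsProjective {K : Type u} [Field K] {X : Scheme.{u}} (fX : X ⟶ Spec (.of K)) : Prop :=
  ∃ (n : ℕ) (i : X ⟶ projSpace n K), IsClosedImmersion i ∧ i ≫ projSpaceStr n K = fX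

/-- A scheme is normal if all its local rings are integrally closed domains. -/
def IsNormal (X : Scheme.{u}) : Prop :=
  ∀ x : X, IsDomain (X.presheaf.stalk x) ∧ IsIntegrallyClosed (X.presheaf.stalk x)

/-- `P` holds for general `x ∈ X(K)`: for all `K`-points of some dense open subset of `X`.
Used for `K` algebraically closed and `X` of finite type over `K`. -/
def ForGeneral {K : Type u} [Field K] {X : Scheme.{u}} (fX : X ⟶ Spec (.of K))
    (P : (Spec (.of K) ⟶ X) → Prop) : Prop :=
  ∃ V : X.Opens, Dense (V : Set X) ∧
    ∀ x : Spec (.of K) ⟶ X, x ≫ fX = 𝟙 _ → Set.range x ⊆ (V : Set X) → P x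

/-- A (flat, proper) family of reduced curves: the geometric fibres are reduced, and
the fibres are non-empty of pure dimension one. The fibres may be singular and reducible. -/
structure IsFamilyOfReducedCurves {C U : Scheme.{u}} (π : C ⟶ U) : Prop where
  proper : IsProper π
  flat : Flat π
  surjective : Surjective π
  reduced : GeometricallyReduced π
  pure_dim_one : ∀ (u : U), ∀ Z ∈ irreducibleComponents (π.fiber u), topologicalKrullDim Z = 1

/-- The general members of the family `π : C ⟶ U` are irreducible: over some dense open
subset of `U` all geometric fibres are irreducible. -/
def IsGenericallyIrreducible {C U : Scheme.{u}} (π : C ⟶ U) : Prop :=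
  ∃ U' : U.Opens, Dense (U' : Set U) ∧ GeometricallyIrreducible (π ∣_ U')

/-- For a family `U ←π C →φ X` with a section `s : U ⟶ C` and a point `x ∈ X(K)`, the scheme
`U_{s→x} = s⁻¹φ⁻¹(x)` of those members that send the marked point to `x`. -/
def paramThrough {K : Type u} [Field K] {X C U : Scheme.{u}} (φ : C ⟶ X) (s : U ⟶ C)
    (x : Spec (.of K) ⟶ X) : Scheme.{u} :=
  pullback (s ≫ φ) x

/-- The morphism `φ_x : C_{U_{s→x}} = C ×_U U_{s→x} ⟶ X` induced by `φ`. -/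
def evalThrough {K : Type u} [Field K] {X C U : Scheme.{u}} (π : C ⟶ U) (φ : C ⟶ X) (s : U ⟶ C)
    (x : Spec (.of K) ⟶ X) :
    pullback π (pullback.fst (s ≫ φ) x : paramThrough φ s x ⟶ U) ⟶ X :=
  pullback.fst π (pullback.fst (s ≫ φ) x : paramThrough φ s x ⟶ U) ≫ φ

/-- The Lefschetz condition for a family `U ←π C →φ X` with a section `s` of `π`, over an
algebraically closed field `K`: for general `x ∈ X(K)`, the morphism `φ_x` is dominant with
geometrically irreducible generic fibre. -/
def LefschetzConditionWithSection {K : Type u} [Field K] {X C U : Scheme.{u}} [IrreducibleSpace X]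
    (fX : X ⟶ Spec (.of K)) (π : C ⟶ U) (φ : C ⟶ X) (s : U ⟶ C) : Prop :=
  ForGeneral fX fun x ↦ IsDominant (evalThrough π φ s x) ∧
    GeometricallyIrreducible
      ((evalThrough π φ s x).fiberToSpecResidueField (genericPoint X))

/-- The Lefschetz condition for a family `U ←π C →φ X` without a specified section: the
Lefschetz condition for the family with the universal section, that is, for the second projection
`C ×_U C ⟶ C`, the morphism `(c, c') ↦ φ c` and the diagonal section. -/
def LefschetzCondition {K : Type u} [Field K] {X C U : Scheme.{u}} [IrreducibleSpace X]
    (fX : X ⟶ Spec (.of K)) (π : C ⟶ U) (φ : C ⟶ X) : Prop :=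
  LefschetzConditionWithSection fX (pullback.snd π π) (pullback.fst π π ≫ φ) (pullback.diagonal π)

end

end CurveFamilies

/-!
For a family `U ←π C →φ X` put `P = X × X`, `T = C ×_U C` and let `τ : T ⟶ P` be the morphism `(c,
c') ↦ (φ c, φ c')`. For a rational point `x` of `X`, the morphism `φ_x` is the base change of `τ`
to the slice `X × {x}` (`isPullback_evalThrough`). So the Lefschetz condition says that for general
`x` the fibre `T_p` of `τ` over the generic point `p = p_x` of the slice is geometrically
irreducible (`isPullback_fiber_evalThrough`). Let `E = D ×_W D ⟶ T` be the morphism of schemes over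
`P` given by the subfamily `D = W × ℙ¹`. By assumption the fibres `E_p` are geometrically
irreducible for general `x`, and this has to be transferred to `T_p`.

*Normality.* Since the fibres `E_p` are nonempty, `E` has a generic point `e` over the generic
point of `P`. Both coordinates of `e` are generic points of curves `D_w ≅ ℙ¹`. They are also
generic points of the fibres of `π`, because these are of pure dimension one
(`forall_specializes_eq_of_projSpace_one`). A flat family with geometrically reduced fibres is
smooth at the generic points of the fibres (`mem_smoothLocus_of_forall_specializes`), so `T` is
smooth over `K` at the image of `e`, hence normal there (`isIntegrallyClosed_stalk_pullback`).

*Transfer.* Let `L` be the separable algebraic closure of the function field of `P` in that of `T`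
at the image of `e`. It is a finite extension of the function field of `P`, and by normality it is
generated by a function `a` that is regular near the image of `e`. Over a dense open part of `P`,
the parts of the fibres of `T` on which `a` takes a fixed value are geometrically irreducible, up
to shrinking `T`. This follows from the Bertini–Noether theorem
(`exists_ne_zero_forall_irreducible_map`) by writing the function field of `T` as a purely
inseparable extension of one that is generated over `L` by a root of an absolutely irreducible
equation (`exists_absolutelyIrreducible_presentation`, `exists_monic_forall_isIrreducibleAway`).
For general `x` the fibre `E_p` is geometrically irreducible and meets the domain of `a`, and so
`a` is a constant in `κ(p)` on `E_p`. If moreover `T_p` is irreducible, then `a` has this rational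
value on all of `T_p`, where it is defined, and `T_p` is geometrically irreducible
(`exists_forall_isIrreducibleAway_of_geometricallyIrreducible`,
`exists_forall_geometricallyIrreducible`).

*Irreducibility of `T_p`.* For general `x` the source `C ×_U U_x` of `φ_x` is a flat family of
curves over the irreducible scheme `U_x`, and its general members are geometrically irreducible
because `U_x` meets the locus of irreducible members (`exists_opens_subset_image_preimage`). So it
is irreducible (`irreducibleSpace_domain_evalThrough`), and so is its nonempty generic fibre `T_p`
over `X`.

Finally, the restriction of the family to the dense open `U₀` replaces `T_p` by a nonempty open
subscheme (`isDominant_and_geometricallyIrreducible_restrict`).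
-/

/-! ### The Bertini–Noether theorem -/

section BertiniNoether
open MvPolynomial
open scoped TensorProduct

/-- Weak Nullstellensatz: a nonzero finite type algebra over a field has a point over any
algebraically closed extension. -/
lemma nonempty_algHom_of_finiteType {k A Ω : Type*} [Field k] [CommRing A] [Nontrivial A]
    [Algebra k A] [Algebra.FiniteType k A] [Field Ω] [IsAlgClosed Ω] [Algebra k Ω] :
    Nonempty (A →ₐ[k] Ω) := by
  obtain ⟨m, hm⟩ := Ideal.exists_maximal A
  let := Ideal.Quotient.field m
  have : Algebra.FiniteType k (A ⧸ m) :=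
    .of_surjective (Ideal.Quotient.mkₐ k m) Ideal.Quotient.mk_surjective
  have : Module.Finite k (A ⧸ m) := finite_of_finite_type_of_isJacobsonRing _ _
  exact ⟨(IsAlgClosed.lift : (A ⧸ m) →ₐ[k] Ω).comp (Ideal.Quotient.mkₐ k m)⟩

/-- A finite type algebra over a domain `R` that has no point over an algebraically closed
extension of `R` is killed by a nonzero element of `R`. -/
lemma exists_ne_zero_algebraMap_eq_zero_of_isEmpty_algHom {R A Ω : Type*} [CommRing R] [IsDomain R]
    [CommRing A] [Algebra R A] [Algebra.FiniteType R A] [Field Ω] [IsAlgClosed Ω] [Algebra R Ω]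
    (hinj : Function.Injective (algebraMap R Ω)) (h : IsEmpty (A →ₐ[R] Ω)) :
    ∃ r : R, r ≠ 0 ∧ algebraMap R A r = 0 := by
  let k := FractionRing R
  have : FaithfulSMul R Ω := (faithfulSMul_iff_algebraMap_injective R Ω).mpr hinj
  let := FractionRing.liftAlgebra R Ω
  have : IsScalarTower R k Ω := FractionRing.isScalarTower_liftAlgebra R Ω
  by_cases hk : Subsingleton (k ⊗[R] A)
  · have h0 : TensorProduct.mk R k A 1 1 = 0 := Subsingleton.elim _ _
    obtain ⟨s, hs⟩ := (IsLocalizedModule.eq_zero_iff (nonZeroDivisors R) _).mp h0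
    refine ⟨s.1, nonZeroDivisors.ne_zero s.2, ?_⟩
    rw [Algebra.algebraMap_eq_smul_one]
    exact hs
  · rw [not_subsingleton_iff_nontrivial] at hk
    obtain ⟨f⟩ := nonempty_algHom_of_finiteType (k := k) (A := k ⊗[R] A) (Ω := Ω)
    exact h.elim' <| (f.restrictScalars R).comp
      (Algebra.TensorProduct.includeRight : A →ₐ[R] k ⊗[R] A)

variable {τ : Type*} {R : Type*} [CommRing R]

open Classical in
lemma coeff_sum_monomial_of_mem {I : Finset (τ →₀ ℕ)} (c : (τ →₀ ℕ) → R) (m : τ →₀ ℕ) :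
    coeff m (∑ i ∈ I, monomial i (c i)) = if m ∈ I then c m else 0 := by
  simp [coeff_sum, coeff_monomial]

/-- If `G` has no factorization over an algebraically closed extension of `R` in which the
monomials `α` and `β`, respectively, occur in the two factors, then the same holds over all points
of a dense open subset of `Spec R`. -/
lemma exists_ne_zero_forall_map_ne_mul [Finite τ] [IsDomain R] {Ω : Type*} [Field Ω]
    [IsAlgClosed Ω] [Algebra R Ω] (hinj : Function.Injective (algebraMap R Ω))
    (G : MvPolynomial τ R) (I : Finset (τ →₀ ℕ)) (α β : τ →₀ ℕ)
    (h : ∀ a b : MvPolynomial τ Ω, map (algebraMap R Ω) G = a * b →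
      coeff α a * coeff β b = 0) :
    ∃ r : R, r ≠ 0 ∧ ∀ (k : Type u) [Field k] (ψ : R →+* k), ψ r ≠ 0 →
      ∀ a b : MvPolynomial τ k, a.support ⊆ I → b.support ⊆ I → map ψ G = a * b →
        coeff α a * coeff β b = 0 := by
  classical
  -- The universal factorization: variables for the coefficients of both factors, and one for
  -- the inverse of the product of the coefficients of `α` and `β`.
  let V := Option (Bool × I)
  let c : Bool → (τ →₀ ℕ) → MvPolynomial V R := fun b m ↦
    if hm : m ∈ I then X (some (b, ⟨m, hm⟩)) else 0
  let p : Bool → MvPolynomial τ (MvPolynomial V R) := fun b ↦ ∑ m ∈ I, monomial m (c b m)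
  let J : Ideal (MvPolynomial V R) := Ideal.span
    (insert (X none * coeff α (p false) * coeff β (p true) - 1)
      (Set.range fun m ↦ coeff m (map C G - p false * p true)))
  have key (k : Type u) [Field k] [Algebra R k] (a : Bool → MvPolynomial τ k)
      (ha : ∀ i, (a i).support ⊆ I) (hG : map (algebraMap R k) G = a false * a true)
      (h0 : coeff α (a false) * coeff β (a true) ≠ 0) :
      Nonempty ((MvPolynomial V R ⧸ J) →ₐ[R] k) := by
    let f : MvPolynomial V R →ₐ[R] k := aeval fun v ↦ v.elim
      (coeff α (a false) * coeff β (a true))⁻¹ fun i ↦ coeff i.2.1 (a i.1)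
    have hp (i) : map (f : MvPolynomial V R →+* k) (p i) = a i := by
      ext m
      rw [coeff_map, coeff_sum_monomial_of_mem]
      by_cases hm : m ∈ I
      · simp [hm, c, f]
      · rw [if_neg hm, map_zero, eq_comm, ← notMem_support_iff]
        exact fun h ↦ hm (ha i h)
    have hp' (i m) : f (coeff m (p i)) = coeff m (a i) := by
      rw [← hp i, coeff_map]; rfl
    refine ⟨Ideal.Quotient.liftₐ J f fun x hx ↦ ?_⟩
    have : J ≤ RingHom.ker (f : MvPolynomial V R →+* k) := by
      refine Ideal.span_le.mpr (Set.insert_subset ?_ ?_)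
      · rw [SetLike.mem_coe, RingHom.mem_ker]
        simp only [map_sub, map_mul, map_one, RingHom.coe_coe, hp']
        rw [mul_assoc, sub_eq_zero]
        simpa [f] using inv_mul_cancel₀ h0
      · rintro _ ⟨m, rfl⟩
        rw [SetLike.mem_coe, RingHom.mem_ker, ← coeff_map, map_sub, map_mul, hp, hp, map_map,
          ← hG, show (f : MvPolynomial V R →+* k).comp C = algebraMap R k from
            RingHom.ext fun r ↦ f.commutes r, sub_self, coeff_zero]
    exact this hx
  have hA : Algebra.FiniteType R (MvPolynomial V R ⧸ J) :=
    .of_surjective (Ideal.Quotient.mkₐ R J) Ideal.Quotient.mk_surjective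
  obtain ⟨r, hr, hr'⟩ := exists_ne_zero_algebraMap_eq_zero_of_isEmpty_algHom (R := R)
    (A := MvPolynomial V R ⧸ J) hinj (by
      refine ⟨fun g ↦ ?_⟩
      let g' : MvPolynomial V R →ₐ[R] Ω := g.comp (Ideal.Quotient.mkₐ R J)
      have hJ (x) (hx : x ∈ J) : g' x = 0 := by
        simp [g', Ideal.Quotient.eq_zero_iff_mem.mpr hx]
      have h1 : map (algebraMap R Ω) G = map (g' : MvPolynomial V R →+* Ω) (p false) *
          map (g' : MvPolynomial V R →+* Ω) (p true) := by
        rw [← map_mul, ← sub_eq_zero]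
        have : (algebraMap R Ω) = (g' : MvPolynomial V R →+* Ω).comp C := by
          ext r
          exact (g'.commutes r).symm
        rw [this, ← map_map, ← map_sub]
        ext m
        rw [coeff_map]
        exact hJ _ (Ideal.subset_span (Set.mem_insert_of_mem _ ⟨m, rfl⟩))
      have h2 := h _ _ h1
      have h3 := hJ _ (Ideal.subset_span (Set.mem_insert _ _))
      rw [map_sub, map_mul, map_mul, map_one, sub_eq_zero] at h3
      rw [coeff_map, coeff_map] at h2
      simp only [RingHom.coe_coe] at h2
      rw [mul_assoc, h2, mul_zero] at h3
      exact zero_ne_one h3)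
  refine ⟨r, hr, fun k _ ψ hψ a b ha hb hG ↦ ?_⟩
  by_contra h0
  let := ψ.toAlgebra
  obtain ⟨f⟩ := key k (fun i ↦ if i then b else a) (by simp [ha, hb]) (by simpa
      [RingHom.algebraMap_toAlgebra] using hG)
    (by simpa using h0)
  apply hψ
  have := congr(f $hr')
  rwa [f.commutes, map_zero] at this

lemma exists_coeff_ne_zero_of_not_isUnit {k : Type*} [Field k] {a : MvPolynomial τ k}
    (ha : ¬ IsUnit a) (h0 : a ≠ 0) : ∃ α ≠ 0, coeff α a ≠ 0 := by
  by_contra! H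
  have hC : a = C (coeff 0 a) := by
    classical
    ext m
    rw [coeff_C]
    split_ifs with h
    · rw [h]
    · exact H m (Ne.symm h)
  refine ha (hC ▸ (IsUnit.mk0 _ fun h ↦ h0 ?_).map C)
  rw [hC, h, map_zero]

/-- **Bertini–Noether**: an absolutely irreducible polynomial remains absolutely irreducible
under specialization to the points of a dense open subset. -/
theorem exists_ne_zero_forall_irreducible_map [Finite τ] [IsDomain R] {Ω : Type*} [Field Ω]
    [IsAlgClosed Ω] [Algebra R Ω] (hinj : Function.Injective (algebraMap R Ω))
    (G : MvPolynomial τ R) (h : Irreducible (map (algebraMap R Ω) G)) :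
    ∃ r : R, r ≠ 0 ∧ ∀ (k : Type u) [Field k] (ψ : R →+* k), ψ r ≠ 0 →
      Irreducible (map ψ G) := by
  classical
  obtain ⟨m, hm, hm0⟩ := exists_coeff_ne_zero_of_not_isUnit h.not_isUnit h.ne_zero
  rw [coeff_map] at hm0
  have hm1 : coeff m G ≠ 0 := fun h ↦ hm0 (by rw [h, map_zero])
  let I : Finset (τ →₀ ℕ) := (Finsupp.finite_of_degree_le G.totalDegree).toFinset
  let I' : Finset (τ →₀ ℕ) := I.erase 0
  have H (x : I' × I') := exists_ne_zero_forall_map_ne_mul.{u} hinj G I x.1 x.2 (fun a b hab ↦ by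
    obtain ⟨⟨α, hα⟩, ⟨β, hβ⟩⟩ := x
    rcases h.isUnit_or_isUnit hab with h | h <;>
    · rw [isUnit_iff_totalDegree_of_isReduced] at h
      have := totalDegree_eq_zero_iff_eq_C.mp h.2
      rw [this]
      simp only [coeff_C]
      first
        | rw [if_neg (Finset.ne_of_mem_erase hα).symm, zero_mul]
        | rw [if_neg (Finset.ne_of_mem_erase hβ).symm, mul_zero])
  choose r hr hr' using H
  refine ⟨coeff m G * ∏ x, r x, mul_ne_zero hm1 (Finset.prod_ne_zero_iff.mpr fun x _ ↦ hr x),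
    fun k _ ψ hψ ↦ ?_⟩
  rw [map_mul, map_prod] at hψ
  have hψ1 := left_ne_zero_of_mul hψ
  have hψ2 := Finset.prod_ne_zero_iff.mp (right_ne_zero_of_mul hψ)
  have hG0 : map ψ G ≠ 0 := fun h ↦ hψ1 (by rw [← coeff_map, h, coeff_zero])
  refine ⟨fun hu ↦ ?_, fun a b hab ↦ ?_⟩
  · rw [isUnit_iff_totalDegree_of_isReduced] at hu
    have := totalDegree_eq_zero_iff_eq_C.mp hu.2
    refine hψ1 ?_
    rw [← coeff_map, this, coeff_C, if_neg hm.symm]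
  · by_contra! hn
    have ha0 : a ≠ 0 := by rintro rfl; exact hG0 (by simpa using hab)
    have hb0 : b ≠ 0 := by rintro rfl; exact hG0 (by simpa using hab)
    obtain ⟨α, hα, hαa⟩ := exists_coeff_ne_zero_of_not_isUnit hn.1 ha0
    obtain ⟨β, hβ, hβb⟩ := exists_coeff_ne_zero_of_not_isUnit hn.2 hb0
    have hdeg : a.totalDegree + b.totalDegree ≤ G.totalDegree := by
      rw [← totalDegree_mul_of_isDomain ha0 hb0, ← hab]
      exact Finset.sup_mono (support_map_subset _ _)
    have hsupp (f : MvPolynomial τ k) (hf : f.totalDegree ≤ G.totalDegree) : f.support ⊆ I := by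
      intro m hm
      simp only [I, Set.Finite.mem_toFinset, Set.mem_ofPred_eq]
      exact (le_totalDegree hm).trans hf
    have hasupp := hsupp a (by omega)
    have hbsupp := hsupp b (by omega)
    have := hr' (⟨α, Finset.mem_erase.mpr ⟨hα, hasupp (mem_support_iff.mpr hαa)⟩⟩,
      ⟨β, Finset.mem_erase.mpr ⟨hβ, hbsupp (mem_support_iff.mpr hβb)⟩⟩) k ψ
      (hψ2 _ (Finset.mem_univ _)) a b hasupp hbsupp hab
    exact mul_ne_zero hαa hβb this

end BertiniNoether

/-! ### Absolutely irreducible equations of separable elements -/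

section AbsolutelyIrreducible
open Polynomial

/-- Polynomials over a purely inseparable extension `k'` of `k` have a `p`-power with coefficients
in `k`. -/
lemma MvPolynomial.exists_pow_mem_range_map {σ k k' : Type*} [Field k] [Field k'] [Algebra k k']
    [IsPurelyInseparable k k'] (p : ℕ) [ExpChar k p] (b : MvPolynomial σ k') :
    ∃ n : ℕ, b ^ p ^ n ∈ (MvPolynomial.map (σ := σ) (algebraMap k k')).range := by
  have : ExpChar k' p := expChar_of_injective_algebraMap (algebraMap k k').injective p
  have : ExpChar (MvPolynomial σ k') p :=
    expChar_of_injective_algebraMap (MvPolynomial.C_injective σ k') p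
  induction b using MvPolynomial.induction_on with
  | C a =>
    obtain ⟨n, y, hy⟩ := IsPurelyInseparable.pow_mem k p a
    exact ⟨n, ⟨MvPolynomial.C y, by rw [MvPolynomial.map_C, hy, map_pow]⟩⟩
  | add f g hf hg =>
    obtain ⟨n, hn⟩ := hf
    obtain ⟨m, hm⟩ := hg
    refine ⟨n + m, ?_⟩
    rw [add_pow_expChar_pow]
    refine add_mem ?_ ?_
    · rw [pow_add, pow_mul]
      exact pow_mem hn _
    · rw [add_comm, pow_add, pow_mul]
      exact pow_mem hm _
  | mul_X f i hf =>
    obtain ⟨n, hn⟩ := hf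
    refine ⟨n, ?_⟩
    rw [mul_pow]
    exact mul_mem hn (pow_mem (RingHom.mem_range.mpr ⟨MvPolynomial.X i, MvPolynomial.map_X _ _⟩) _)

/-- A monic irreducible polynomial over `k[t]` that is separable over `k(t)` remains irreducible
over `k'[t]` if `k'` is purely inseparable over `k`. -/
lemma irreducible_map_of_isPurelyInseparable {σ k k' : Type*} [Field k] [Field k'] [Algebra k k']
    [IsPurelyInseparable k k'] {g : (MvPolynomial σ k)[X]} (hg : g.Monic) (hirr : Irreducible g)
    (hsep : (g.map (algebraMap _ (FractionRing (MvPolynomial σ k)))).Separable) :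
    Irreducible (g.map (MvPolynomial.map (algebraMap k k'))) := by
  let A := MvPolynomial σ k
  let B := MvPolynomial σ k'
  let KA := FractionRing A
  let KB := FractionRing B
  let f : A →+* B := MvPolynomial.map (algebraMap k k')
  have hf : Function.Injective f := MvPolynomial.map_injective _ (algebraMap k k').injective
  let F : KA →+* KB := IsFractionRing.map hf
  have hF (a : A) : F (algebraMap A KA a) = algebraMap B KB (f a) :=
    IsLocalization.map_eq _ _
  let := F.toAlgebra
  have : IsPurelyInseparable KA KB := by
    obtain ⟨p, hp⟩ := ExpChar.exists k
    have : ExpChar A p := expChar_of_injective_algebraMap (MvPolynomial.C_injective σ k) p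
    have : ExpChar KA p :=
      expChar_of_injective_algebraMap (IsFractionRing.injective A KA) p
    rw [isPurelyInseparable_iff_pow_mem KA p]
    have H (b : B) : ∃ n : ℕ, (algebraMap B KB b) ^ p ^ n ∈ F.range := by
      obtain ⟨n, a, ha⟩ := MvPolynomial.exists_pow_mem_range_map (k := k) p b
      exact ⟨n, algebraMap A KA a, by rw [hF, ← map_pow, ← ha]⟩
    intro x
    obtain ⟨b, c, hc, rfl⟩ := IsFractionRing.div_surjective (A := B) x
    obtain ⟨n, hn⟩ := H b
    obtain ⟨m, hm⟩ := H c
    refine ⟨n + m, ?_⟩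
    change _ ∈ F.range
    rw [div_pow]
    change _ ∈ F.fieldRange
    refine div_mem ?_ ?_
    · rw [pow_add, pow_mul]
      exact pow_mem hn _
    · rw [add_comm, pow_add, pow_mul]
      exact pow_mem hm _
  have h1 : Irreducible (g.map (algebraMap A KA)) :=
    hg.irreducible_iff_irreducible_map_fraction_map.mp hirr
  have h2 := hsep.map_irreducible_of_isPurelyInseparable KB h1
  rw [(hg.map f).irreducible_iff_irreducible_map_fraction_map (K := KB), Polynomial.map_map]
  rw [Polynomial.map_map] at h2
  rwa [show (algebraMap B KB).comp f = (algebraMap KA KB).comp (algebraMap A KA) from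
    RingHom.ext fun a ↦ (hF a).symm]

/-- The minimal polynomial of `θ` is fixed by every automorphism that fixes `θ`. -/
lemma minpoly_map_eq_of_comp_eq {A Ω : Type*} [CommRing A] [IsDomain A] [IsIntegrallyClosed A]
    [Field Ω] [Algebra A Ω] [FaithfulSMul A Ω] {θ : Ω} (hθ : IsIntegral A θ) {s : Ω →+* Ω}
    {s' : A →+* A} (hs : (algebraMap A Ω).comp s' = s.comp (algebraMap A Ω)) (hsθ : s θ = θ) :
    (minpoly A θ).map s' = minpoly A θ := by
  have hg : (minpoly A θ).Monic := minpoly.monic hθ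
  have h0 : aeval θ ((minpoly A θ).map s') = 0 := by
    rw [aeval_def, eval₂_map, hs, ← hsθ, ← Polynomial.hom_eval₂, hsθ, ← aeval_def, minpoly.aeval,
      map_zero]
  exact eq_of_monic_of_dvd_of_natDegree_le hg (hg.map _)
    (minpoly.isIntegrallyClosed_dvd hθ h0) (hg.natDegree_map _).le

lemma separable_map_minpoly_fractionRing {A Ω : Type*} [CommRing A] [IsDomain A]
    [IsIntegrallyClosed A] [Field Ω] [Algebra A Ω] [FaithfulSMul A Ω] {θ : Ω} {f : A[X]}
    (hf : f.Monic) (hfθ : aeval θ f = 0) (hsep : (f.map (algebraMap A Ω)).Separable) :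
    ((minpoly A θ).map (algebraMap A (FractionRing A))).Separable := by
  let := FractionRing.liftAlgebra A Ω
  have : IsScalarTower A (FractionRing A) Ω := FractionRing.isScalarTower_liftAlgebra A Ω
  rw [← Polynomial.separable_map (algebraMap (FractionRing A) Ω), Polynomial.map_map,
    ← IsScalarTower.algebraMap_eq]
  exact hsep.of_dvd (Polynomial.map_dvd _ (minpoly.isIntegrallyClosed_dvd ⟨f, hf, hfθ⟩ hfθ))

/-- A polynomial over `κ` all of whose coefficients lie in `F` (inside a common overfield `Ω`)
descends to a finite extension of `k` contained in both `κ` and `F`. -/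
lemma exists_finite_descent {k κ F Ω σ : Type*} [Field k] [Field κ] [Field F] [Field Ω]
    [Algebra k κ] [Algebra k F] [Algebra k Ω] [Algebra κ Ω] [Algebra F Ω] [IsScalarTower k κ Ω]
    [IsScalarTower k F Ω] [Algebra.IsAlgebraic k κ] {g : (MvPolynomial σ κ)[X]} (hg : g.Monic)
    (h : ∀ i m, ∃ x : F, algebraMap F Ω x = algebraMap κ Ω ((g.coeff i).coeff m)) :
    ∃ (L : IntermediateField k κ) (ι : L →ₐ[k] F), Module.Finite k L ∧
      (∀ x : L, algebraMap F Ω (ι x) = algebraMap κ Ω x) ∧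
      ∃ gL : (MvPolynomial σ L)[X], gL.Monic ∧ gL.map (MvPolynomial.map (algebraMap L κ)) = g := by
  let S : Set κ := ⋃ i ∈ g.support, ⋃ m ∈ (g.coeff i).support, {(g.coeff i).coeff m}
  have hS : S.Finite :=
    g.support.finite_toSet.biUnion fun i _ ↦ (g.coeff i).support.finite_toSet.biUnion
      fun _ _ ↦ Set.finite_singleton _
  let L := IntermediateField.adjoin k S
  have hLfin : Module.Finite k L := by
    have := hS.to_subtype
    exact IntermediateField.finiteDimensional_adjoin fun x _ ↦ Algebra.IsIntegral.isIntegral x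
  let f : F →ₐ[k] Ω := IsScalarTower.toAlgHom k F Ω
  have hL (x : L) : IsScalarTower.toAlgHom k κ Ω x ∈ f.fieldRange := by
    have : L ≤ f.fieldRange.comap (IsScalarTower.toAlgHom k κ Ω) := by
      refine IntermediateField.adjoin_le_iff.mpr fun y hy ↦ ?_
      simp only [S, Set.mem_iUnion] at hy
      obtain ⟨i, -, m, -, rfl⟩ := hy
      exact h i m
    exact this x.2
  let e : F ≃ₐ[k] f.fieldRange := AlgEquiv.ofInjectiveField f
  let ι : L →ₐ[k] F := (e.symm : f.fieldRange →ₐ[k] F).comp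
    (((IsScalarTower.toAlgHom k κ Ω).comp L.val).codRestrict f.fieldRange.toSubalgebra hL)
  refine ⟨L, ι, hLfin, fun x ↦ ?_, ?_⟩
  · exact congrArg Subtype.val (e.apply_symm_apply ⟨_, hL x⟩)
  · have hlift : g ∈ Polynomial.lifts (MvPolynomial.map (σ := σ) (algebraMap L κ)) := by
      rw [Polynomial.lifts_iff_coeff_lifts]
      intro i
      rw [← RingHom.coe_range, SetLike.mem_coe,
        ← MvPolynomial.support_sum_monomial_coeff (g.coeff i)]
      refine sum_mem fun m hm ↦ ?_
      have hcL : (g.coeff i).coeff m ∈ L := by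
        refine IntermediateField.subset_adjoin _ _ ?_
        simp only [S, Set.mem_iUnion]
        refine ⟨i, ?_, m, hm, rfl⟩
        rw [Polynomial.mem_support_iff]
        rintro h
        simp [h] at hm
      exact ⟨MvPolynomial.monomial m ⟨_, hcL⟩, by rw [MvPolynomial.map_monomial]; rfl⟩
    obtain ⟨gL, hgL, -, hgLm⟩ := lifts_and_natDegree_eq_and_monic hlift hg
    exact ⟨gL, hgLm, hgL⟩

/-- The form of `exists_absolutelyIrreducible_monic` in which the Galois extension `Ω` of `F` and
the separably closed subfield `κ`, stable under the Galois group of `F`, are given. -/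
lemma exists_absolutelyIrreducible_monic_aux {k F κ Ω : Type u} {σ : Type*} [Field k] [Field F]
    [Field κ] [Field Ω] [Algebra k F] [Algebra k κ] [Algebra k Ω] [Algebra κ Ω] [Algebra F Ω]
    [IsScalarTower k κ Ω] [IsScalarTower k F Ω] [Algebra.IsSeparable k κ] [IsSepClosed κ]
    [IsGalois F Ω]
    (hstab : ∀ s : Ω ≃ₐ[F] Ω, ∃ s' : κ →+* κ, ∀ x, algebraMap κ Ω (s' x) = s (algebraMap κ Ω x))
    {t : σ → F} (ht : AlgebraicIndependent k t) {θ : F}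
    {f : (MvPolynomial σ k)[X]} (hf : f.Monic)
    (hfθ : f.eval₂ (MvPolynomial.aeval t : MvPolynomial σ k →ₐ[k] F).toRingHom θ = 0)
    (hsep : (f.map (MvPolynomial.aeval t : MvPolynomial σ k →ₐ[k] F).toRingHom).Separable) :
    ∃ (L : Type u) (_ : Field L) (_ : Algebra k L) (_ : Algebra L F) (_ : IsScalarTower k L F),
      Module.Finite k L ∧ Algebra.IsSeparable k L ∧ ∃ g : (MvPolynomial σ L)[X], g.Monic ∧
      g.eval₂ (MvPolynomial.aeval t : MvPolynomial σ L →ₐ[L] F).toRingHom θ = 0 ∧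
      ∃ (Ω : Type u) (_ : Field Ω) (_ : IsAlgClosed Ω) (_ : Algebra L Ω),
        Irreducible (g.map (MvPolynomial.map (algebraMap L Ω))) := by
  let t' : σ → Ω := fun i ↦ algebraMap F Ω (t i)
  have ht' : AlgebraicIndependent κ t' :=
    (ht.map' (f := IsScalarTower.toAlgHom k F Ω) (algebraMap F Ω).injective).extendScalars κ
  let := (MvPolynomial.aeval t' : MvPolynomial σ κ →ₐ[κ] Ω).toRingHom.toAlgebra
  have hφC (a : κ) : algebraMap (MvPolynomial σ κ) Ω (MvPolynomial.C a) = algebraMap κ Ω a :=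
    MvPolynomial.aeval_C _ _
  have hφX (i : σ) : algebraMap (MvPolynomial σ κ) Ω (MvPolynomial.X i) = t' i :=
    MvPolynomial.aeval_X _ _
  have : FaithfulSMul (MvPolynomial σ κ) Ω := (faithfulSMul_iff_algebraMap_injective _ Ω).mpr ht'
  have : IsIntegrallyClosed (MvPolynomial σ κ) :=
    UniqueFactorizationMonoid.instIsIntegrallyClosed
  let f' : (MvPolynomial σ κ)[X] := f.map (MvPolynomial.map (algebraMap k κ))
  have hcomp : (algebraMap (MvPolynomial σ κ) Ω).comp (MvPolynomial.map (algebraMap k κ)) =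
      (algebraMap F Ω).comp (MvPolynomial.aeval t : MvPolynomial σ k →ₐ[k] F).toRingHom := by
    refine MvPolynomial.ringHom_ext (fun x ↦ ?_) (fun i ↦ ?_)
    · rw [RingHom.comp_apply, MvPolynomial.map_C, hφC, RingHom.comp_apply]
      rw [← IsScalarTower.algebraMap_apply, IsScalarTower.algebraMap_apply k F Ω]
      exact (congrArg (algebraMap F Ω) (MvPolynomial.aeval_C t x)).symm
    · rw [RingHom.comp_apply, MvPolynomial.map_X, hφX, RingHom.comp_apply]
      exact (congrArg (algebraMap F Ω) (MvPolynomial.aeval_X t i)).symm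
  have hf' : f'.Monic := hf.map _
  let θ' := algebraMap F Ω θ
  have hf'0 : aeval θ' f' = 0 := by
    rw [aeval_def, eval₂_map, hcomp, ← Polynomial.hom_eval₂, hfθ, map_zero]
  have hint : IsIntegral (MvPolynomial σ κ) θ' := ⟨f', hf', hf'0⟩
  let g := minpoly (MvPolynomial σ κ) θ'
  have hg : g.Monic := minpoly.monic hint
  have hgsep := separable_map_minpoly_fractionRing hf' hf'0 (by
    rw [Polynomial.map_map, hcomp, ← Polynomial.map_map]
    exact hsep.map)
  have hirr : Irreducible (g.map (MvPolynomial.map (algebraMap κ (AlgebraicClosure κ)))) := by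
    exact irreducible_map_of_isPurelyInseparable hg (minpoly.irreducible hint) hgsep
  -- The coefficients of `g` are fixed by the Galois group of `F`, so they lie in `F`.
  have hfix (i : ℕ) (m : σ →₀ ℕ) : ∃ x : F, algebraMap F Ω x = algebraMap κ Ω ((g.coeff i).coeff
      m) := by
    rw [← Set.mem_range, ← IntermediateField.mem_bot, InfiniteGalois.mem_bot_iff_fixed]
    intro s
    obtain ⟨sκ, hsκ⟩ := hstab s
    have h1 : g.map (MvPolynomial.map sκ) = g := by
      refine minpoly_map_eq_of_comp_eq hint (s := (s : Ω →+* Ω)) ?_ (s.commutes θ)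
      refine MvPolynomial.ringHom_ext (fun x ↦ ?_) (fun i ↦ ?_)
      · rw [RingHom.comp_apply, MvPolynomial.map_C, hφC, RingHom.comp_apply, hφC]
        exact hsκ x
      · rw [RingHom.comp_apply, MvPolynomial.map_X, hφX, RingHom.comp_apply, hφX]
        exact (s.commutes (t i)).symm
    have h2 : sκ ((g.coeff i).coeff m) = (g.coeff i).coeff m := by
      conv_rhs => rw [← h1]
      rw [Polynomial.coeff_map, MvPolynomial.coeff_map]
    rw [← hsκ, h2]
  obtain ⟨L, ι, hfin, hι, gL, hgLm, hgL⟩ := exists_finite_descent (k := k) (F := F) (Ω := Ω) hg hfix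
  let := ι.toRingHom.toAlgebra
  have : IsScalarTower k L F := .of_algebraMap_eq fun x ↦ (ι.commutes x).symm
  refine ⟨L, inferInstance, inferInstance, inferInstance, inferInstance, hfin, inferInstance,
    gL, hgLm, ?_, AlgebraicClosure κ, inferInstance, inferInstance, inferInstance, ?_⟩
  · apply (algebraMap F Ω).injective
    rw [Polynomial.hom_eval₂, map_zero]
    have h1 : (algebraMap F Ω).comp (MvPolynomial.aeval t : MvPolynomial σ L →ₐ[L] F).toRingHom =
        (algebraMap (MvPolynomial σ κ) Ω).comp (MvPolynomial.map (algebraMap L κ)) := by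
      refine MvPolynomial.ringHom_ext (fun x ↦ ?_) (fun i ↦ ?_)
      · rw [RingHom.comp_apply, RingHom.comp_apply, MvPolynomial.map_C, hφC]
        exact (congrArg (algebraMap F Ω) (MvPolynomial.aeval_C t x)).trans (hι x)
      · rw [RingHom.comp_apply, RingHom.comp_apply, MvPolynomial.map_X, hφX]
        exact congrArg (algebraMap F Ω) (MvPolynomial.aeval_X t i)
    rw [h1, ← eval₂_map, hgL]
    exact minpoly.aeval (MvPolynomial σ κ) θ'
  · have h2 : MvPolynomial.map (σ := σ) (algebraMap L (AlgebraicClosure κ)) =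
        (MvPolynomial.map (algebraMap κ (AlgebraicClosure κ))).comp
          (MvPolynomial.map (algebraMap L κ)) :=
      RingHom.ext fun x ↦ by rw [RingHom.comp_apply, MvPolynomial.map_map]; rfl
    rw [h2, ← Polynomial.map_map, hgL]
    exact hirr

/-- An element `θ` that is separable over `k(t)`, with `t` algebraically independent over `k`,
satisfies an absolutely irreducible equation over `L[t]` for a finite separable subextension `L`:
the minimal equation over the separable closure of `k` in a separable closure of `F` is fixed by
the Galois group of `F`, so its coefficients lie in `F`. -/
theorem exists_absolutelyIrreducible_monic {k F : Type u} {σ : Type*} [Field k] [Field F]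
    [Algebra k F] {t : σ → F} (ht : AlgebraicIndependent k t) {θ : F}
    {f : (MvPolynomial σ k)[X]} (hf : f.Monic)
    (hfθ : f.eval₂ (MvPolynomial.aeval t : MvPolynomial σ k →ₐ[k] F).toRingHom θ = 0)
    (hsep : (f.map (MvPolynomial.aeval t : MvPolynomial σ k →ₐ[k] F).toRingHom).Separable) :
    ∃ (L : Type u) (_ : Field L) (_ : Algebra k L) (_ : Algebra L F) (_ : IsScalarTower k L F),
      Module.Finite k L ∧ Algebra.IsSeparable k L ∧ ∃ g : (MvPolynomial σ L)[X], g.Monic ∧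
      g.eval₂ (MvPolynomial.aeval t : MvPolynomial σ L →ₐ[L] F).toRingHom θ = 0 ∧
      ∃ (Ω : Type u) (_ : Field Ω) (_ : IsAlgClosed Ω) (_ : Algebra L Ω),
        Irreducible (g.map (MvPolynomial.map (algebraMap L Ω))) := by
  let Ω := SeparableClosure F
  let κ := separableClosure k Ω
  have : IsSepClosed κ := (separableClosure.isSepClosure k Ω).sep_closed
  refine exists_absolutelyIrreducible_monic_aux (κ := κ) (Ω := Ω) (fun s ↦ ?_) ht hf hfθ hsep
  have hs (x : Ω) (hx : x ∈ κ) : s x ∈ κ := by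
    rw [mem_separableClosure_iff] at hx ⊢
    have := minpoly.algEquiv_eq (s.restrictScalars k) x
    rw [AlgEquiv.restrictScalars_apply] at this
    rw [IsSeparable, this]
    exact hx
  exact ⟨((s : Ω →+* Ω).comp κ.val.toRingHom).codRestrict κ fun x ↦ hs x x.2, fun x ↦ rfl⟩

end AbsolutelyIrreducible

/-! ### The structure of finitely generated field extensions -/

section FunctionField
open Polynomial

/-- A finite extension `F` of the fraction field of an integrally closed domain `A` contains an
integral separable element `θ` such that `F` is purely inseparable over `Frac A (θ)`. -/
lemma exists_integral_separable_generator {A E F : Type*} [CommRing A] [IsDomain A]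
    [IsIntegrallyClosed A] [Field E] [Field F] [Algebra A E] [IsFractionRing A E] [Algebra A F]
    [Algebra E F] [IsScalarTower A E F] [Module.Finite E F] (p : ℕ) [ExpChar E p] :
    ∃ (θ : F) (f : A[X]), f.Monic ∧ aeval θ f = 0 ∧ (f.map (algebraMap A F)).Separable ∧
      ∀ x : F, ∃ n : ℕ, ∃ d : A, d ≠ 0 ∧ ∃ Q : A[X], algebraMap A F d * x ^ p ^ n = aeval θ Q := by
  let S := separableClosure E F
  have : Module.Finite E S := inferInstance
  have : IsScalarTower A S F := .of_algebraMap_eq fun _ ↦ rfl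
  obtain ⟨θ₀, hθ₀⟩ := Field.exists_primitive_element E S
  have : FaithfulSMul A E := by
    rw [faithfulSMul_iff_algebraMap_injective]; exact IsFractionRing.injective A E
  have halg : IsAlgebraic A θ₀ :=
    (IsFractionRing.isAlgebraic_iff A E S).mpr (Algebra.IsAlgebraic.isAlgebraic θ₀)
  obtain ⟨a, ha, hint⟩ := halg.exists_integral_multiple
  have haE : algebraMap A E a ≠ 0 := by
    rwa [Ne, FaithfulSMul.algebraMap_eq_zero_iff]
  let θ := a • θ₀
  have hθ : IntermediateField.adjoin E {θ} = ⊤ := by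
    rw [eq_top_iff, ← hθ₀, IntermediateField.adjoin_simple_le_iff]
    have h1 : θ₀ = (algebraMap A E a)⁻¹ • θ := by
      rw [show θ = algebraMap A E a • θ₀ from (algebraMap_smul E a θ₀).symm, smul_smul,
        inv_mul_cancel₀ haE, one_smul]
    rw [h1]
    exact IntermediateField.smul_mem _ (IntermediateField.mem_adjoin_simple_self E θ)
  have hmin : minpoly E θ = (minpoly A θ).map (algebraMap A E) :=
    minpoly.isIntegrallyClosed_eq_field_fractions E S hint
  have hAS (x : A) : algebraMap S F (algebraMap A S x) = algebraMap A F x :=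
    (IsScalarTower.algebraMap_apply A S F x).symm
  refine ⟨algebraMap S F θ, minpoly A θ, minpoly.monic hint, ?_, ?_, fun x ↦ ?_⟩
  · rw [aeval_algebraMap_apply, minpoly.aeval, map_zero]
  · rw [IsScalarTower.algebraMap_eq A E F, ← Polynomial.map_map, ← hmin]
    exact Polynomial.Separable.map (Algebra.IsSeparable.isSeparable E θ)
  · have : ExpChar S p := expChar_of_injective_algebraMap (algebraMap E S).injective p
    obtain ⟨n, y, hy⟩ := IsPurelyInseparable.pow_mem S p x
    have hmem : y ∈ Algebra.adjoin E {θ} := by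
      rw [← IntermediateField.adjoin_simple_toSubalgebra_of_isAlgebraic
        (Algebra.IsAlgebraic.isAlgebraic θ), hθ]
      trivial
    rw [Algebra.adjoin_singleton_eq_range_aeval] at hmem
    obtain ⟨Q₀, hQ₀⟩ := hmem
    obtain ⟨d, hdA, hd⟩ := IsLocalization.integerNormalization_spec (nonZeroDivisors A) Q₀
    refine ⟨n, d, nonZeroDivisors.ne_zero hdA,
      IsLocalization.integerNormalization (nonZeroDivisors A) Q₀, ?_⟩
    rw [← hy, aeval_algebraMap_apply, ← aeval_map_algebraMap E, hd, ← hAS, ← map_mul]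
    congr 1
    rw [← algebraMap_smul E d, map_smul, algebraMap_smul, ← Algebra.smul_def]
    exact congrArg (d • ·) hQ₀.symm

lemma isAlgebraic_of_isTranscendenceBasis {k F σ : Type*} [Field k] [Field F] [Algebra k F]
    {t : σ → F} (ht : IsTranscendenceBasis k t) (x : F) :
    ∃ P : (MvPolynomial σ k)[X], P ≠ 0 ∧
      P.eval₂ (MvPolynomial.aeval t : MvPolynomial σ k →ₐ[k] F).toRingHom x = 0 := by
  have := ht.isAlgebraic
  obtain ⟨P, hP, hx⟩ := Algebra.IsAlgebraic.isAlgebraic (R := Algebra.adjoin k (Set.range t)) x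
  let e := ht.1.aevalEquiv
  refine ⟨P.map (e.symm : Algebra.adjoin k (Set.range t) →+* MvPolynomial σ k), ?_, ?_⟩
  · rwa [Ne, Polynomial.map_eq_zero_iff e.symm.injective]
  · rw [eval₂_map, ← hx, aeval_def]
    congr 1
    ext y
    change MvPolynomial.aeval t (e.symm y) = _
    rw [← ht.1.algebraMap_aevalEquiv]
    exact congrArg _ (e.apply_symm_apply y)

/-- The structure of a finitely generated field extension `F` of `k`: there is a finite separable
subextension `L` such that `F` is purely inseparable over `L(t, θ)`, where `t` is algebraically
independent and `θ` satisfies a monic equation over `L[t]` that is absolutely irreducible. -/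
theorem exists_absolutelyIrreducible_presentation (k F : Type u) [Field k] [Field F] [Algebra k F]
    [Algebra.EssFiniteType k F] (p : ℕ) [ExpChar k p] :
    ∃ (L : Type u) (_ : Field L) (_ : Algebra k L) (_ : Algebra L F) (_ : IsScalarTower k L F),
      Module.Finite k L ∧ Algebra.IsSeparable k L ∧
      ∃ (σ : Type u) (_ : Finite σ) (t : σ → F) (θ : F) (g : (MvPolynomial σ L)[X]),
      AlgebraicIndependent L t ∧ g.Monic ∧
      g.eval₂ (MvPolynomial.aeval t : MvPolynomial σ L →ₐ[L] F).toRingHom θ = 0 ∧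
      (∃ (Ω : Type u) (_ : Field Ω) (_ : IsAlgClosed Ω) (_ : Algebra L Ω),
        Irreducible (g.map (MvPolynomial.map (algebraMap L Ω)))) ∧
      ∀ x : F, ∃ n : ℕ, ∃ d : MvPolynomial σ L, d ≠ 0 ∧ ∃ Q : (MvPolynomial σ L)[X],
        MvPolynomial.aeval t d * x ^ p ^ n =
          Q.eval₂ (MvPolynomial.aeval t : MvPolynomial σ L →ₐ[L] F).toRingHom θ := by
  obtain ⟨s, ht⟩ := exists_isTranscendenceBasis k F
  have hfin : Finite s := by
    rw [← Cardinal.lt_aleph0_iff_finite, ht.cardinalMk_eq_trdeg]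
    exact trdeg_lt_aleph0 k F
  let t : s → F := (↑)
  let A := MvPolynomial s k
  let f : A →+* F := (MvPolynomial.aeval t : A →ₐ[k] F).toRingHom
  let := f.toAlgebra
  have : FaithfulSMul A F := (faithfulSMul_iff_algebraMap_injective _ F).mpr ht.1
  have : IsScalarTower k A F := .of_algebraMap_eq fun x ↦ (MvPolynomial.aeval_C t x).symm
  have : IsIntegrallyClosed A := UniqueFactorizationMonoid.instIsIntegrallyClosed
  let E := FractionRing A
  let := FractionRing.liftAlgebra A F
  have : IsScalarTower A E F := FractionRing.isScalarTower_liftAlgebra A F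
  have : IsScalarTower k E F := .of_algebraMap_eq fun x ↦ by
    rw [IsScalarTower.algebraMap_apply k A F, IsScalarTower.algebraMap_apply k A E,
      ← IsScalarTower.algebraMap_apply A E F]
  have : Algebra.EssFiniteType E F := .of_comp k E F
  have : Algebra.IsAlgebraic A F := ⟨fun x ↦ isAlgebraic_of_isTranscendenceBasis ht x⟩
  have : Algebra.IsAlgebraic E F := (IsFractionRing.comap_isAlgebraic_iff (A := A)).mp inferInstance
  have : Module.Finite E F := Algebra.finite_of_essFiniteType_of_isAlgebraic
  have : ExpChar E p := expChar_of_injective_algebraMap (algebraMap k E).injective p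
  obtain ⟨θ, f₀, hf, hfθ, hsep, hgen⟩ := exists_integral_separable_generator (A := A) (E := E) (F
      := F) p
  obtain ⟨L, _, _, _, _, hLfin, hLsep, g, hg, hgθ, hΩ⟩ :=
    exists_absolutelyIrreducible_monic ht.1 hf hfθ hsep
  refine ⟨L, inferInstance, inferInstance, inferInstance, inferInstance, hLfin, hLsep, s, hfin,
    t, θ, g, ht.1.extendScalars L, hg, hgθ, hΩ, fun x ↦ ?_⟩
  obtain ⟨n, d, hd, Q, hQ⟩ := hgen x
  let m : A →+* MvPolynomial s L := MvPolynomial.map (algebraMap k L)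
  have hm (a : A) : MvPolynomial.aeval t (m a) = f a := MvPolynomial.aeval_map_algebraMap L t a
  refine ⟨n, m d, ?_, Q.map m, ?_⟩
  · rwa [Ne, map_eq_zero_iff _ (MvPolynomial.map_injective _ (algebraMap k L).injective)]
  · rw [hm, eval₂_map]
    refine hQ.trans ?_
    rw [aeval_def]
    congr 1
    exact (RingHom.ext hm).symm

end FunctionField

/-! ### Irreducible basic open sets -/

section IrreducibleOpen

/-- The basic open subset `D(s)` of `Spec C` is irreducible: the nilradical of `C_s` is prime. -/
def IsIrreducibleAway {C : Type*} [CommRing C] (s : C) : Prop :=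
  ¬ IsNilpotent s ∧ ∀ a b : C, IsNilpotent (s * (a * b)) → IsNilpotent (s * a) ∨ IsNilpotent (s * b)

lemma isIrreducibleAway_iff {C : Type*} [CommRing C] {s : C} :
    IsIrreducibleAway s ↔
      IsIrreducible (PrimeSpectrum.basicOpen s : Set (PrimeSpectrum C)) := by
  have key (x : C) : IsNilpotent x ↔ (PrimeSpectrum.basicOpen x : Set (PrimeSpectrum C)) = ∅ := by
    rw [← PrimeSpectrum.basicOpen_eq_bot_iff, ← TopologicalSpace.Opens.coe_eq_empty]
  have hmul (a b : C) : (PrimeSpectrum.basicOpen (a * b) : Set (PrimeSpectrum C)) =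
      (PrimeSpectrum.basicOpen a : Set (PrimeSpectrum C)) ∩ PrimeSpectrum.basicOpen b := by
    rw [PrimeSpectrum.basicOpen_mul]; rfl
  refine and_congr ?_ ⟨fun H U V hU hV ⟨x, hxs, hxU⟩ ⟨y, hys, hyV⟩ ↦ ?_, fun H a b hab ↦ ?_⟩
  · rw [key, Set.nonempty_iff_ne_empty]
  · obtain ⟨_, ⟨a, rfl⟩, hxa, haU⟩ :=
      PrimeSpectrum.isTopologicalBasis_basic_opens.exists_subset_of_mem_open hxU hU
    obtain ⟨_, ⟨b, rfl⟩, hyb, hbV⟩ :=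
      PrimeSpectrum.isTopologicalBasis_basic_opens.exists_subset_of_mem_open hyV hV
    by_contra hne
    rw [Set.not_nonempty_iff_eq_empty] at hne
    have h0 : IsNilpotent (s * (a * b)) := by
      rw [key, hmul, hmul, ← Set.subset_empty_iff, ← hne]
      exact Set.inter_subset_inter_right _ (Set.inter_subset_inter haU hbV)
    rcases H a b h0 with h | h <;> rw [key, hmul] at h
    · exact (h ▸ ⟨hxs, hxa⟩ : x ∈ (∅ : Set _))
    · exact (h ▸ ⟨hys, hyb⟩ : y ∈ (∅ : Set _))
  · by_contra! hne
    rw [key, key, hmul, hmul] at hne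
    obtain ⟨x, hx⟩ := Set.nonempty_iff_ne_empty.mpr hne.1
    obtain ⟨y, hy⟩ := Set.nonempty_iff_ne_empty.mpr hne.2
    obtain ⟨z, hz⟩ := H _ _ (PrimeSpectrum.basicOpen a).2 (PrimeSpectrum.basicOpen b).2 ⟨x, hx⟩
        ⟨y, hy⟩
    rw [key, hmul, hmul] at hab
    exact (hab ▸ hz : z ∈ (∅ : Set _))

lemma isNilpotent_algebraMap_iff_of_away {C C' : Type*} [CommRing C] [CommRing C'] [Algebra C C']
    (g : C) [IsLocalization.Away g C'] (x : C) :
    IsNilpotent (algebraMap C C' x) ↔ IsNilpotent (g * x) := by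
  refine ⟨fun ⟨n, hn⟩ ↦ ?_, fun h ↦ ?_⟩
  · rw [← map_pow, IsLocalization.map_eq_zero_iff (.powers g)] at hn
    obtain ⟨⟨_, m, rfl⟩, hm⟩ := hn
    refine ⟨m + n + 1, ?_⟩
    calc (g * x) ^ (m + n + 1) = (g ^ m * x ^ n) * (g ^ (n + 1) * x ^ (m + 1)) := by ring
      _ = 0 := by rw [hm, zero_mul]
  · have := h.map (algebraMap C C')
    rw [map_mul] at this
    exact ((IsLocalization.Away.algebraMap_isUnit g).isNilpotent_unit_mul_of_commute_iff
      (Commute.all _ _)).mp this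

/-- If `D(s)` is irreducible in `Spec C_g`, then `D(sg)` is irreducible in `Spec C`. -/
lemma IsIrreducibleAway.of_localization {C C' : Type*} [CommRing C] [CommRing C'] [Algebra C C']
    (g : C) [IsLocalization.Away g C'] {s : C} (hs : IsIrreducibleAway (algebraMap C C' s)) :
    IsIrreducibleAway (s * g) := by
  have key := isNilpotent_algebraMap_iff_of_away (C' := C') g
  refine ⟨fun h ↦ hs.1 ((key s).mpr (mul_comm s g ▸ h)), fun a b hab ↦ ?_⟩
  have := hs.2 (algebraMap C C' a) (algebraMap C C' b)
  simp only [← map_mul, key] at this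
  rw [mul_comm s g, mul_assoc, mul_assoc]
  exact this (by rwa [← mul_assoc, mul_comm g s])

/-- Descent of irreducibility along a map `f : A → C` that is radicial after inverting `h`. -/
lemma isIrreducibleAway_of_forall_exists_pow {A C : Type*} [CommRing A] [CommRing C] (f : A →+* C)
    (h : A) (P : Ideal A) [P.IsPrime] (hP : ∀ x ∈ P, f x = 0) (hker : RingHom.ker f ≤ P)
    (hh : h ∉ P) (H : ∀ x : C, ∃ m n : ℕ, 0 < n ∧ ∃ a, f h ^ m * x ^ n = f a) :
    IsIrreducibleAway (f h) := by
  have hnil (x : A) (hx : IsNilpotent (f x)) : x ∈ P := by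
    obtain ⟨n, hn⟩ := hx
    rw [← map_pow] at hn
    exact Ideal.IsPrime.mem_of_pow_mem ‹_› n (hker hn)
  refine ⟨fun h0 ↦ hh (hnil _ h0), fun x y hxy ↦ ?_⟩
  obtain ⟨m, n, hn, a, ha⟩ := H x
  obtain ⟨m', n', hn', b, hb⟩ := H y
  have key {z : C} {m n : ℕ} {c : A} (hn : 0 < n) (hz : f h ^ m * z ^ n = f c) (hc : c ∈ P) :
      IsNilpotent (f h * z) := by
    rw [hP c hc] at hz
    obtain ⟨k, rfl⟩ := Nat.exists_eq_succ_of_ne_zero hn.ne'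
    refine ⟨m + (k + 1), ?_⟩
    calc (f h * z) ^ (m + (k + 1)) = (f h ^ m * z ^ (k + 1)) * (f h ^ (k + 1) * z ^ m) := by ring
      _ = 0 := by rw [hz, zero_mul]
  have hab : h * (a ^ n' * b ^ n) ∈ P := by
    apply hnil
    obtain ⟨k, rfl⟩ := Nat.exists_eq_succ_of_ne_zero hn.ne'
    obtain ⟨k', rfl⟩ := Nat.exists_eq_succ_of_ne_zero hn'.ne'
    have : f (h * (a ^ (k' + 1) * b ^ (k + 1))) = (f h * (x * y)) * (f h ^ (m * (k' + 1) + m' * (k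
        + 1)) *
        x ^ (k + k' + k * k') * y ^ (k + k' + k * k')) := by
      rw [map_mul, map_mul, map_pow, map_pow, ← ha, ← hb, Nat.succ_eq_add_one,
        Nat.succ_eq_add_one]
      ring
    rw [this]
    exact (Commute.all _ _).isNilpotent_mul_right hxy
  rcases (Ideal.IsPrime.mem_or_mem ‹_› hab).resolve_left hh |> Ideal.IsPrime.mem_or_mem ‹_› with
      h1 | h1
  · exact .inl (key hn ha (Ideal.IsPrime.mem_of_pow_mem ‹_› _ h1))
  · exact .inr (key hn' hb (Ideal.IsPrime.mem_of_pow_mem ‹_› _ h1))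

/-- Lying over for a map `f : A → S` that is radicial after inverting `h`. -/
lemma exists_isPrime_comap_eq_of_forall_exists_pow {A S : Type*} [CommRing A] [CommRing S]
    (f : A →+* S) (h : A) (P : Ideal A) [hP : P.IsPrime] (hker : RingHom.ker f ≤ P) (hh : h ∉ P)
    (H : ∀ x : S, ∃ m n : ℕ, 0 < n ∧ ∃ a, f h ^ m * x ^ n = f a) :
    ∃ Q : Ideal S, Q.IsPrime ∧ Q.comap f = P := by
  let A' := Localization.Away h
  let S' := Localization.Away (f h)
  let f' : A' →+* S' := IsLocalization.Away.map A' S' f h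
  have hf' (a : A) : f' (algebraMap A A' a) = algebraMap S S' (f a) :=
    IsLocalization.map_eq _ _
  let := f'.toAlgebra
  have hdisj : Disjoint (Submonoid.powers h : Set A) P := by
    rw [Ideal.disjoint_powers_iff_notMem _ hP.isRadical]
    exact hh
  have : (P.map (algebraMap A A')).IsPrime := IsLocalization.isPrime_of_isPrime_disjoint (.powers
      h) A' P hP hdisj
  have hint : Algebra.IsIntegral A' S' := by
    refine ⟨fun y ↦ ?_⟩
    obtain ⟨x, ⟨_, k, rfl⟩, rfl⟩ := IsLocalization.exists_mk'_eq (.powers (f h)) y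
    obtain ⟨m, n, hn, a, ha⟩ := H x
    have hu : IsUnit (algebraMap A A' h) := IsLocalization.Away.algebraMap_isUnit h
    have hu' : IsUnit (algebraMap S S' (f h)) := IsLocalization.Away.algebraMap_isUnit _
    refine IsIntegral.of_pow hn ?_
    obtain ⟨v, hv⟩ := hu
    have h1 : (IsLocalization.mk' S' x (⟨f h ^ k, k, rfl⟩ : Submonoid.powers (f h))) ^ n =
        f' (↑(v⁻¹ ^ (m + k * n)) * algebraMap A A' a) := by
      have h2 : IsUnit (f' (↑(v ^ (m + k * n)))) := ((v ^ (m + k * n)).isUnit).map f'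
      rw [← h2.mul_right_inj, ← map_mul, ← mul_assoc, ← Units.val_mul, ← mul_pow, mul_inv_cancel,
        one_pow, Units.val_one, one_mul, hf', ← ha, Units.val_pow_eq_pow_val, hv, map_pow, hf',
        pow_add, pow_mul, mul_assoc, ← mul_pow, map_mul, map_pow, map_pow]
      congr 2
      rw [← map_pow]
      exact IsLocalization.mk'_spec' S' x (⟨f h ^ k, k, rfl⟩ : Submonoid.powers (f h))
    rw [h1]
    exact isIntegral_algebraMap
  obtain ⟨Q, -, hQ, hQP⟩ := Ideal.exists_ideal_over_prime_of_isIntegral (P.map (algebraMap A A'))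
      (⊥ : Ideal S')
    (fun y hy ↦ by
      obtain ⟨x, ⟨_, k, rfl⟩, rfl⟩ := IsLocalization.exists_mk'_eq (.powers h) y
      rw [IsLocalization.mk'_mem_map_algebraMap_iff]
      have h0 : f' (algebraMap A A' x) = 0 := by
        rw [← IsLocalization.mk'_spec' A' x (⟨h ^ k, k, rfl⟩ : Submonoid.powers h), map_mul]
        rw [show f' (IsLocalization.mk' A' x (⟨h ^ k, k, rfl⟩ : Submonoid.powers h)) = 0 from hy,
            mul_zero]
      rw [hf', IsLocalization.map_eq_zero_iff (.powers (f h))] at h0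
      obtain ⟨⟨_, m, rfl⟩, hm⟩ := h0
      refine ⟨h ^ m, ⟨m, rfl⟩, hker ?_⟩
      rw [RingHom.mem_ker, map_mul, map_pow]
      exact hm)
  refine ⟨Q.comap (algebraMap S S'), hQ.comap _, ?_⟩
  rw [← IsLocalization.under_map_of_isPrime_disjoint (.powers h) A' hP hdisj, ← hQP, Ideal.under,
    Ideal.comap_comap,
    Ideal.comap_comap]
  congr 1
  ext a
  exact (hf' a).symm

/-- Two fields over a ring `A` with the same kernel have a common extension. -/
lemma exists_field_comp_eq_of_ker_eq {A K₁ K₂ : Type u} [CommRing A] [Field K₁] [Field K₂]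
    (f₁ : A →+* K₁) (f₂ : A →+* K₂) (h : RingHom.ker f₁ = RingHom.ker f₂) :
    ∃ (Θ : Type u) (_ : Field Θ) (g₁ : K₁ →+* Θ) (g₂ : K₂ →+* Θ), g₁.comp f₁ = g₂.comp f₂ := by
  let P := RingHom.ker f₁
  have : P.IsPrime := RingHom.ker_isPrime f₁
  have h1 : P.primeCompl ≤ (IsUnit.submonoid K₁).comap f₁ := fun x hx ↦ by
    exact IsUnit.mk0 _ hx
  have h2 : P.primeCompl ≤ (IsUnit.submonoid K₂).comap f₂ := fun x hx ↦ by
    refine IsUnit.mk0 _ fun h0 ↦ hx ?_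
    exact h.ge h0
  let := (Ideal.ResidueField.lift P f₁ le_rfl h1).toAlgebra
  let := (Ideal.ResidueField.lift P f₂ h.le h2).toAlgebra
  obtain ⟨m, hm⟩ := Ideal.exists_maximal (TensorProduct P.ResidueField K₁ K₂)
  refine ⟨_ ⧸ m, Ideal.Quotient.field m, (Ideal.Quotient.mk m).comp
    Algebra.TensorProduct.includeLeftRingHom, (Ideal.Quotient.mk m).comp
    (Algebra.TensorProduct.includeRight : K₂ →ₐ[P.ResidueField] _).toRingHom, ?_⟩
  ext a
  simp only [RingHom.comp_apply]
  congr 1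
  have e1 : f₁ a = algebraMap P.ResidueField K₁ (algebraMap A _ a) :=
    (Ideal.ResidueField.lift_algebraMap P f₁ le_rfl h1 a).symm
  have e2 : f₂ a = algebraMap P.ResidueField K₂ (algebraMap A _ a) :=
    (Ideal.ResidueField.lift_algebraMap P f₂ h.le h2 a).symm
  rw [e1, e2]
  let i₁ : K₁ →ₐ[P.ResidueField] TensorProduct P.ResidueField K₁ K₂ :=
    Algebra.TensorProduct.includeLeft
  let i₂ : K₂ →ₐ[P.ResidueField] TensorProduct P.ResidueField K₁ K₂ :=
    Algebra.TensorProduct.includeRight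
  exact (i₁.commutes _).trans (i₂.commutes _).symm

end IrreducibleOpen

/-! ### Irreducibility of the fibres of radicial covers of hypersurfaces -/

section Spread
open Polynomial

/-- If powers of generators of `C` lie in the image of `f : A → C` after inverting `h`, then so do
powers of all elements, provided that raising to `p`-powers is additive. -/
lemma exists_pow_mul_pow_eq_of_closure_eq_top {A C : Type*} [CommRing A] [CommRing C] (f : A →+* C)
    (h : A) (p : ℕ) (hadd : ∀ (n : ℕ) (x y : C), (x + y) ^ p ^ n = x ^ p ^ n + y ^ p ^ n)
    (Y : Set C) (hY : ∀ x ∈ Y, ∃ m n : ℕ, ∃ a, f h ^ m * x ^ p ^ n = f a)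
    (htop : Subring.closure Y = ⊤) (x : C) : ∃ m n : ℕ, ∃ a, f h ^ m * x ^ p ^ n = f a := by
  have hx : x ∈ Subring.closure Y := htop ▸ Subring.mem_top x
  have hmul {x y : C} (hx : ∃ m n : ℕ, ∃ a, f h ^ m * x ^ p ^ n = f a)
      (hy : ∃ m n : ℕ, ∃ a, f h ^ m * y ^ p ^ n = f a) :
      ∃ m n : ℕ, ∃ a, f h ^ m * (x * y) ^ p ^ n = f a := by
    obtain ⟨m, n, a, ha⟩ := hx
    obtain ⟨m', n', b, hb⟩ := hy
    refine ⟨m * p ^ n' + m' * p ^ n, n + n', a ^ p ^ n' * b ^ p ^ n, ?_⟩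
    rw [map_mul, map_pow, map_pow, ← ha, ← hb]
    simp only [mul_pow, ← pow_mul, pow_add]
    rw [mul_comm (p ^ n') (p ^ n)]
    ring
  induction hx using Subring.closure_induction with
  | mem x hx => exact hY x hx
  | zero => exact ⟨1, 1, h * 0 ^ p ^ 1, by simp⟩
  | one => exact ⟨0, 0, 1, by simp⟩
  | add x y _ _ hx hy =>
    obtain ⟨m, n, a, ha⟩ := hx
    obtain ⟨m', n', b, hb⟩ := hy
    refine ⟨m * p ^ n' + m' * p ^ n, n + n',
      h ^ (m' * p ^ n) * a ^ p ^ n' + h ^ (m * p ^ n') * b ^ p ^ n, ?_⟩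
    rw [map_add, map_mul, map_mul, map_pow, map_pow, map_pow, map_pow, ← ha, ← hb, hadd]
    simp only [mul_pow, ← pow_mul, pow_add]
    rw [mul_comm (p ^ n') (p ^ n)]
    ring
  | neg x _ hx =>
    rw [neg_eq_neg_one_mul]
    refine hmul ⟨0, 0, -1, by simp⟩ hx
  | mul x y _ _ hx hy => exact hmul hx hy

/-- The map `R[t][y] → S` given by elements `t`, `θ` of an `R`-algebra `S`. -/
noncomputable def evalHom {R S σ : Type*} [CommRing R] [CommRing S] [Algebra R S] (t : σ → S)
    (θ : S) : (MvPolynomial σ R)[X] →+* S :=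
  eval₂RingHom (MvPolynomial.aeval t : MvPolynomial σ R →ₐ[R] S).toRingHom θ

lemma evalHom_C {R S σ : Type*} [CommRing R] [CommRing S] [Algebra R S] (t : σ → S)
    (θ : S) (a : MvPolynomial σ R) : evalHom t θ (C a) = MvPolynomial.aeval t a :=
  eval₂_C _ _

lemma evalHom_X {R S σ : Type*} [CommRing R] [CommRing S] [Algebra R S] (t : σ → S)
    (θ : S) : evalHom (R := R) t θ X = θ :=
  eval₂_X _ _

lemma evalHom_comp_map {R S Ω D σ : Type*} [CommRing R] [CommRing S] [CommRing Ω] [CommRing D]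
    [Algebra R S] [Algebra R Ω] [Algebra Ω D] [Algebra S D]
    (hc : (algebraMap Ω D).comp (algebraMap R Ω) = (algebraMap S D).comp (algebraMap R S))
    (t : σ → S) (θ : S) :
    (evalHom (R := Ω) (fun i ↦ algebraMap S D (t i)) (algebraMap S D θ)).comp
      (mapRingHom (MvPolynomial.map (algebraMap R Ω))) = (algebraMap S D).comp (evalHom t θ) := by
  refine Polynomial.ringHom_ext' (MvPolynomial.ringHom_ext (fun r ↦ ?_) fun i ↦ ?_) ?_
  · simpa [evalHom_C] using congr($hc r)
  · simp [evalHom_C]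
  · simp [evalHom_X]

/-- The ring `D` is generated by `Ω` and `S` over `R`, and it has the same points in fields as
`Ω ⊗[R] S`. So `D` is a quotient of this tensor product by a nil ideal. -/
structure IsFieldPushout (R S Ω D : Type u) [CommRing R] [CommRing S] [CommRing Ω] [CommRing D]
    [Algebra R S] [Algebra R Ω] [Algebra Ω D] [Algebra S D] : Prop where
  comm : (algebraMap Ω D).comp (algebraMap R Ω) = (algebraMap S D).comp (algebraMap R S)
  closure_eq_top : Subring.closure (Set.range (algebraMap Ω D) ∪ Set.range (algebraMap S D)) = ⊤
  exists_lift (Θ : Type u) [Field Θ] (α : Ω →+* Θ) (β : S →+* Θ)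
    (h : α.comp (algebraMap R Ω) = β.comp (algebraMap R S)) :
    ∃ γ : D →+* Θ, γ.comp (algebraMap Ω D) = α ∧ γ.comp (algebraMap S D) = β

/-- A family that is radicial over a family of hypersurfaces `G(t, y) = 0` after inverting `h` has
irreducible fibre over `Ω` if the specialization of `G` to `Ω` is irreducible. -/
theorem isIrreducibleAway_of_irreducible_map {R S Ω D σ : Type u} [CommRing R] [CommRing S]
    [Field Ω] [CommRing D] [Algebra R S] [Algebra R Ω] [Algebra Ω D] [Algebra S D]
    (hD : IsFieldPushout R S Ω D)
    (p : ℕ) (hp : 0 < p) (haddS : ∀ (n : ℕ) (x y : S), (x + y) ^ p ^ n = x ^ p ^ n + y ^ p ^ n)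
    (haddD : ∀ (n : ℕ) (x y : D), (x + y) ^ p ^ n = x ^ p ^ n + y ^ p ^ n)
    (t : σ → S) (θ : S) (G : (MvPolynomial σ R)[X]) (hG : evalHom t θ G = 0)
    (h : MvPolynomial σ R)
    (hker : ∀ P : (MvPolynomial σ R)[X], evalHom t θ P = 0 → ∃ m : ℕ, G ∣ C h ^ m * P)
    (Y : Set S) (htop : Algebra.adjoin R Y = ⊤)
    (hY : ∀ x ∈ Y, ∃ n : ℕ, ∃ a, evalHom (R := R) t θ (C h) * x ^ p ^ n = evalHom (R := R) t θ a)
    (hirr : Irreducible (G.map (MvPolynomial.map (algebraMap R Ω))))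
    (hh : ¬ G.map (MvPolynomial.map (algebraMap R Ω)) ∣
      C (MvPolynomial.map (algebraMap R Ω) h)) :
    IsIrreducibleAway (algebraMap S D (MvPolynomial.aeval t h)) := by
  let f := evalHom (R := R) t θ
  let μ : (MvPolynomial σ R)[X] →+* (MvPolynomial σ Ω)[X] :=
    mapRingHom (MvPolynomial.map (algebraMap R Ω))
  let F := evalHom (R := Ω) (fun i ↦ algebraMap S D (t i)) (algebraMap S D θ)
  have hcomp : F.comp μ = (algebraMap S D).comp f := evalHom_comp_map hD.comm t θ
  have hcomp' (a) : F (μ a) = algebraMap S D (f a) := congr($hcomp a)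
  have hμh : μ (C h) = C (MvPolynomial.map (algebraMap R Ω) h) := by simp [μ]
  have hpow (n : ℕ) : 0 < p ^ n := pow_pos hp n
  -- Powers of all elements of `S`, and of `D`, lie in the image of the polynomial ring.
  have hS (x : S) : ∃ m n : ℕ, ∃ a, f (C h) ^ m * x ^ p ^ n = f a := by
    refine exists_pow_mul_pow_eq_of_closure_eq_top f (C h) p haddS
      (Set.range (algebraMap R S) ∪ Y) ?_ ?_ x
    · rintro _ (⟨r, rfl⟩ | hx)
      · exact ⟨0, 0, C (MvPolynomial.C r), by simp [f, evalHom_C]⟩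
      · obtain ⟨n, a, ha⟩ := hY _ hx
        exact ⟨1, n, a, by rw [pow_one, ha]⟩
    · rw [← Algebra.adjoin_eq_ring_closure, htop]
      rfl
  have hD' (x : D) : ∃ m n : ℕ, ∃ a, F (μ (C h)) ^ m * x ^ p ^ n = F a := by
    refine exists_pow_mul_pow_eq_of_closure_eq_top F (μ (C h)) p haddD _ ?_ hD.closure_eq_top x
    rintro _ (⟨r, rfl⟩ | ⟨s, rfl⟩)
    · exact ⟨0, 0, C (MvPolynomial.C r), by simp [F, evalHom_C]⟩
    · obtain ⟨m, n, a, ha⟩ := hS s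
      exact ⟨m, n, μ a, by rw [hcomp', hcomp', ← ha, map_mul, map_pow, map_pow]⟩
  let P₀ : Ideal (MvPolynomial σ Ω)[X] := Ideal.span {μ G}
  have hG0 : μ G ≠ 0 := hirr.ne_zero
  have hP₀ : P₀.IsPrime := (Ideal.span_singleton_prime hG0).mpr hirr.prime
  have hhP₀ : μ (C h) ∉ P₀ := by
    rw [Ideal.mem_span_singleton, hμh]
    exact hh
  let P := P₀.comap μ
  have hGP : G ∈ P := Ideal.mem_span_singleton_self (μ G)
  have hkerf : RingHom.ker f ≤ P := fun x hx ↦ by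
    obtain ⟨m, hm⟩ := hker x hx
    exact (Ideal.IsPrime.mem_or_mem inferInstance (P.mem_of_dvd hm hGP)).resolve_left
      fun h' ↦ hhP₀ (show C h ∈ P from Ideal.IsPrime.mem_of_pow_mem inferInstance m h')
  obtain ⟨Q, hQ, hQP⟩ := exists_isPrime_comap_eq_of_forall_exists_pow f (C h) P hkerf hhP₀
    fun x ↦ by
      obtain ⟨m, n, a, ha⟩ := hS x
      exact ⟨m, p ^ n, hpow n, a, ha⟩
  -- A point of `Spec D` over the generic point of the specialized hypersurface.
  have hkerF : RingHom.ker F ≤ P₀ := by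
    obtain ⟨Θ, _, g₁, g₂, hg⟩ := exists_field_comp_eq_of_ker_eq
      ((algebraMap _ P₀.ResidueField).comp μ) ((algebraMap S Q.ResidueField).comp f) (by
        rw [← RingHom.comap_ker, ← RingHom.comap_ker, Ideal.ker_algebraMap_residueField,
          Ideal.ker_algebraMap_residueField, hQP])
    have hg' (a) : g₁ (algebraMap _ _ (μ a)) = g₂ (algebraMap _ _ (f a)) := congr($hg a)
    obtain ⟨γ, hγ₁, hγ₂⟩ := hD.exists_lift Θ
      ((g₁.comp (algebraMap _ P₀.ResidueField)).comp (C.comp MvPolynomial.C))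
      (g₂.comp (algebraMap S Q.ResidueField)) (by
        ext r
        have := hg' (C (MvPolynomial.C r))
        simpa [μ, f, evalHom_C] using this)
    have hγ : γ.comp F = g₁.comp (algebraMap _ P₀.ResidueField) := by
      refine Polynomial.ringHom_ext' (MvPolynomial.ringHom_ext (fun r ↦ ?_) fun i ↦ ?_) ?_
      · simpa [F, evalHom_C] using congr($hγ₁ r)
      · have h1 := congr($hγ₂ (t i))
        have h2 := hg' (C (MvPolynomial.X i))
        simp only [μ, f, evalHom_C, coe_mapRingHom, map_C, MvPolynomial.map_X,
          MvPolynomial.aeval_X] at h2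
        simp only [F, RingHom.comp_apply, evalHom_C, MvPolynomial.aeval_X] at h1 ⊢
        rw [h1, h2]
      · have h1 := congr($hγ₂ θ)
        have h2 := hg' X
        simp only [μ, f, evalHom_X, coe_mapRingHom, map_X] at h2
        simp only [F, RingHom.comp_apply, evalHom_X] at h1 ⊢
        rw [h1, h2]
    intro x hx
    have h1 := congr($hγ x)
    rw [RingHom.comp_apply, RingHom.comp_apply, (RingHom.mem_ker).mp hx, map_zero] at h1
    rw [← Ideal.algebraMap_residueField_eq_zero]
    exact (map_eq_zero g₁).mp h1.symm
  have := isIrreducibleAway_of_forall_exists_pow F (μ (C h)) P₀ (fun x hx ↦ by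
    obtain ⟨y, rfl⟩ := Ideal.mem_span_singleton'.mp hx
    rw [map_mul, hcomp', show f G = 0 from hG, map_zero, mul_zero]) hkerF hhP₀ fun x ↦ by
      obtain ⟨m, n, a, ha⟩ := hD' x
      exact ⟨m, p ^ n, hpow n, a, ha⟩
  rwa [hcomp', show f (C h) = _ from evalHom_C t θ h] at this


lemma evalHom_map {R L F σ : Type*} [CommRing R] [CommRing L] [CommRing F] [Algebra R L]
    [Algebra L F] [Algebra R F] [IsScalarTower R L F] (t : σ → F) (θ : F)
    (P : (MvPolynomial σ R)[X]) :
    evalHom (R := L) t θ (P.map (MvPolynomial.map (algebraMap R L))) = evalHom t θ P := by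
  have : (evalHom (R := L) t θ).comp (mapRingHom (MvPolynomial.map (algebraMap R L))) =
      evalHom t θ := by
    refine Polynomial.ringHom_ext' (MvPolynomial.ringHom_ext (fun r ↦ ?_) fun i ↦ ?_) ?_
    · simp [evalHom_C, ← IsScalarTower.algebraMap_apply]
    · simp [evalHom_C]
    · simp [evalHom_X]
  exact congr($this P)

lemma isUnit_scaleRoots {A : Type*} [CommRing A] [IsDomain A] {q : A[X]} (hq : IsUnit q) (r : A) :
    IsUnit (q.scaleRoots r) := by
  obtain ⟨a, ha, rfl⟩ := Polynomial.isUnit_iff.mp hq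
  rw [scaleRoots_C]
  exact ha.map C

lemma irreducible_scaleRoots {A : Type*} [CommRing A] [IsDomain A] {q : A[X]} (hq : Irreducible q)
    {r : A} (hr : IsUnit r) : Irreducible (q.scaleRoots r) := by
  have hinv {r s : A} (hrs : r * s = 1) (f : A[X]) : (f.scaleRoots r).scaleRoots s = f := by
    rw [← scaleRoots_mul, hrs, scaleRoots_one]
  obtain ⟨s, hs⟩ := hr.exists_right_inv
  have hs' : s * r = 1 := by rw [mul_comm, hs]
  refine ⟨fun h ↦ hq.not_isUnit (hinv hs q ▸ isUnit_scaleRoots h s), fun a b hab ↦ ?_⟩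
  have h1 : q = a.scaleRoots s * b.scaleRoots s := by
    rw [← mul_scaleRoots_of_noZeroDivisors, ← hab, hinv hs]
  rcases hq.isUnit_or_isUnit h1 with h | h
  · exact .inl (hinv hs' a ▸ isUnit_scaleRoots h r)
  · exact .inr (hinv hs' b ▸ isUnit_scaleRoots h r)

/-- The Bertini–Noether theorem for polynomials in `R[t][y]`. -/
lemma exists_ne_zero_forall_irreducible_polynomial_map {R σ : Type*} {Ω : Type u} [CommRing R]
    [IsDomain R]
    [Finite σ] [Field Ω] [IsAlgClosed Ω] [Algebra R Ω]
    (hinj : Function.Injective (algebraMap R Ω)) (G : (MvPolynomial σ R)[X])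
    (h : Irreducible (G.map (MvPolynomial.map (algebraMap R Ω)))) :
    ∃ r : R, r ≠ 0 ∧ ∀ (k : Type u) [Field k] (ψ : R →+* k), ψ r ≠ 0 →
      Irreducible (G.map (MvPolynomial.map ψ)) := by
  have key {k : Type u} [Field k] (ψ : R →+* k) : G.map (MvPolynomial.map ψ) =
      MvPolynomial.optionEquivLeft k σ (MvPolynomial.map ψ
        ((MvPolynomial.optionEquivLeft R σ).symm G)) := by
    have : (MvPolynomial.optionEquivLeft k σ).toRingHom.comp (MvPolynomial.map ψ) =
        (mapRingHom (MvPolynomial.map ψ)).comp (MvPolynomial.optionEquivLeft R σ).toRingHom := by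
      refine MvPolynomial.ringHom_ext (fun r ↦ ?_) fun i ↦ ?_
      · simp
      · cases i <;> simp
    have := congr($this ((MvPolynomial.optionEquivLeft R σ).symm G))
    simpa using this.symm
  obtain ⟨r, hr, H⟩ := exists_ne_zero_forall_irreducible_map.{u} hinj
    ((MvPolynomial.optionEquivLeft R σ).symm G) (by
      rw [key] at h
      exact (MulEquiv.irreducible_iff (MvPolynomial.optionEquivLeft Ω σ)).mp h)
  refine ⟨r, hr, fun k _ ψ hψ ↦ ?_⟩
  rw [key]
  exact (MulEquiv.irreducible_iff (MvPolynomial.optionEquivLeft k σ)).mpr (H k ψ hψ)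

/-- Clearing denominators in an absolutely irreducible presentation of a field extension `F` of
`L = Frac R`: the defining equation becomes monic over `R[t]`, and it remains irreducible at the
points of a dense open subset of `Spec R`. -/
theorem exists_integral_presentation {R L F : Type u} {σ : Type*} [CommRing R] [IsDomain R]
    [Finite σ] [Field L] [Field F] [Algebra R L] [IsFractionRing R L] [Algebra L F] [Algebra R F]
    [IsScalarTower R L F] (p : ℕ) {t : σ → F} {θ : F} {g : (MvPolynomial σ L)[X]}
    (ht : AlgebraicIndependent L t) (hg : g.Monic) (hgθ : evalHom t θ g = 0)
    (hΩ : ∃ (Ω : Type u) (_ : Field Ω) (_ : IsAlgClosed Ω) (_ : Algebra L Ω),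
      Irreducible (g.map (MvPolynomial.map (algebraMap L Ω))))
    (hgen : ∀ x : F, ∃ n : ℕ, ∃ d : MvPolynomial σ L, d ≠ 0 ∧ ∃ Q : (MvPolynomial σ L)[X],
      MvPolynomial.aeval t d * x ^ p ^ n = evalHom t θ Q) :
    ∃ (θ₁ : F) (G : (MvPolynomial σ R)[X]), G.Monic ∧ evalHom t θ₁ G = 0 ∧
      (∀ P : (MvPolynomial σ R)[X], evalHom t θ₁ P = 0 → G ∣ P) ∧
      (∃ r : R, r ≠ 0 ∧ ∀ (k : Type u) [Field k] (ψ : R →+* k), ψ r ≠ 0 →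
        Irreducible (G.map (MvPolynomial.map ψ))) ∧
      ∀ x : F, ∃ n : ℕ, ∃ d : MvPolynomial σ R, d ≠ 0 ∧ ∃ Q : (MvPolynomial σ R)[X],
        MvPolynomial.aeval t d * x ^ p ^ n = evalHom t θ₁ Q := by
  obtain ⟨Ω, _, _, _, hirr⟩ := hΩ
  let A := MvPolynomial σ R
  let B := MvPolynomial σ L
  let M : Submonoid A := (nonZeroDivisors R).map (MvPolynomial.C (σ := σ))
  let f : A →+* B := MvPolynomial.map (algebraMap R L)
  let : Algebra A B := MvPolynomial.algebraMvPolynomial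
  have hfalg : algebraMap A B = f := MvPolynomial.algebraMap_def
  have hloc : IsLocalization M B := MvPolynomial.isLocalization ..
  have hfinj : Function.Injective f :=
    MvPolynomial.map_injective _ (IsFractionRing.injective R L)
  have hM {b : A} (hb : b ∈ M) : b ≠ 0 ∧ IsUnit (f b) := by
    obtain ⟨c, hc, rfl⟩ := hb
    refine ⟨?_, hfalg ▸ IsLocalization.map_units B (⟨_, c, hc, rfl⟩ : M)⟩
    exact (map_ne_zero_iff _ (MvPolynomial.C_injective _ _)).mpr (nonZeroDivisors.ne_zero hc)
  let c : M := IsLocalization.commonDenom M g.support g.coeff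
  have hlift : g.scaleRoots (f c) ∈ Polynomial.lifts f := by
    have := IsLocalization.scaleRoots_commonDenom_mem_lifts (M := M) g
      (hfalg ▸ ⟨1, by rw [map_one, hg.leadingCoeff]⟩)
    rwa [hfalg] at this
  obtain ⟨G, hGg, -, hG⟩ := lifts_and_natDegree_eq_and_monic hlift ((monic_scaleRoots_iff _).mpr hg)
  let θ₁ : F := MvPolynomial.aeval t (f c) * θ
  have hscale (Q : B[X]) : evalHom t θ₁ (Q.scaleRoots (f c)) =
      MvPolynomial.aeval t (f c) ^ Q.natDegree * evalHom t θ Q :=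
    scaleRoots_eval₂_mul _ _ _
  have haeval (a : A) : MvPolynomial.aeval t (f a) = MvPolynomial.aeval t a :=
    MvPolynomial.aeval_map_algebraMap L t a
  have hGθ₁ : evalHom t θ₁ G = 0 := by
    rw [← evalHom_map (L := L), hGg, hscale, hgθ, mul_zero]
  let := (MvPolynomial.aeval t : MvPolynomial σ L →ₐ[L] F).toRingHom.toAlgebra
  have hBF (P : B[X]) : evalHom t θ₁ P = aeval θ₁ P := rfl
  have hirrL : Irreducible (G.map f) := by
    rw [hGg]
    exact irreducible_scaleRoots (hg.irreducible_of_irreducible_map _ _ hirr) (hM c.2).2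
  have : FaithfulSMul B F := (faithfulSMul_iff_algebraMap_injective _ F).mpr ht
  have : IsIntegrallyClosed B := UniqueFactorizationMonoid.instIsIntegrallyClosed
  have hint : IsIntegral B θ₁ := ⟨G.map f, hG.map f, by
    have := hGθ₁
    rwa [← evalHom_map (L := L)] at this⟩
  have hmin : minpoly B θ₁ = G.map f := by
    have h1 : minpoly B θ₁ ∣ G.map f := minpoly.isIntegrallyClosed_dvd hint (by
      rw [← hBF, evalHom_map, hGθ₁])
    have h2 := (minpoly.irreducible hint).dvd_symm hirrL h1
    exact eq_of_monic_of_associated (minpoly.monic hint) (hG.map f) (associated_of_dvd_dvd h1 h2)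
  refine ⟨θ₁, G, hG, hGθ₁, fun P hP ↦ ?_, ?_, fun x ↦ ?_⟩
  · have h1 : G.map f ∣ P.map f := by
      rw [← hmin]
      refine minpoly.isIntegrallyClosed_dvd hint ?_
      rw [← hBF, evalHom_map, hP]
    rwa [Polynomial.map_dvd_map f hfinj hG] at h1
  · let : Algebra R Ω := ((algebraMap L Ω).comp (algebraMap R L)).toAlgebra
    refine exists_ne_zero_forall_irreducible_polynomial_map (Ω := Ω)
      (fun x y hxy ↦ IsFractionRing.injective R L ((algebraMap L Ω).injective hxy)) G ?_
    have : MvPolynomial.map (σ := σ) (algebraMap R Ω) =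
        (MvPolynomial.map (algebraMap L Ω)).comp f :=
      RingHom.ext fun x ↦ by rw [RingHom.comp_apply, MvPolynomial.map_map]; rfl
    rw [this, ← Polynomial.map_map, hGg, map_scaleRoots _ _ _ (by
      rw [hg.leadingCoeff, map_one]; exact one_ne_zero)]
    exact irreducible_scaleRoots hirr ((hM c.2).2.map _)
  · obtain ⟨n, d, hd, Q, hQ⟩ := hgen x
    obtain ⟨b, hb, hbQ⟩ := IsLocalization.integerNormalization_spec M (Q.scaleRoots (f c))
    obtain ⟨⟨d', b'⟩, hd'⟩ := IsLocalization.surj M d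
    rw [hfalg] at hbQ hd'
    have hbQ' : (IsLocalization.integerNormalization M (Q.scaleRoots (f c))).map f =
        C (f b) * Q.scaleRoots (f c) := by
      rw [hbQ, Algebra.smul_def, Polynomial.algebraMap_apply, hfalg]
    have hd'0 : d' ≠ 0 := by
      rintro rfl
      simp only [map_zero, mul_eq_zero, hd, false_or] at hd'
      exact (hM b'.2).2.ne_zero hd'
    refine ⟨n, b * c ^ Q.natDegree * d', mul_ne_zero (mul_ne_zero (hM hb).1
      (pow_ne_zero _ (hM c.2).1)) hd'0, C (b' : A) *
      IsLocalization.integerNormalization M (Q.scaleRoots (f c)), ?_⟩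
    have e (a : B) : evalHom t θ₁ (C a) = MvPolynomial.aeval t a := evalHom_C t θ₁ a
    have e' := congrArg (MvPolynomial.aeval t) hd'
    rw [map_mul] at e'
    rw [← evalHom_map (L := L), ← haeval, Polynomial.map_mul, hbQ', map_C, map_mul, map_mul,
      map_mul, map_mul, map_mul, map_mul, e, e, hscale, ← hQ, ← e', map_pow, map_pow]
    change _ = MvPolynomial.aeval t (f b') * _
    ring


lemma add_pow_pow_of_prime_or_eq_one {D : Type*} [CommRing D] {p : ℕ}
    (hp : p = 1 ∨ p.Prime ∧ (p : D) = 0) (n : ℕ) (x y : D) :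
    (x + y) ^ p ^ n = x ^ p ^ n + y ^ p ^ n := by
  rcases hp with rfl | ⟨hp, h0⟩
  · simp
  · rw [add_pow_prime_pow_eq hp, h0]
    ring

lemma map_evalHom {R S F σ : Type*} [CommRing R] [CommRing S] [CommRing F] [Algebra R S]
    [Algebra S F] [Algebra R F] [IsScalarTower R S F] (t : σ → S) (θ : S)
    (P : (MvPolynomial σ R)[X]) : algebraMap S F (evalHom t θ P) =
      evalHom (fun i ↦ algebraMap S F (t i)) (algebraMap S F θ) P := by
  have : (algebraMap S F).comp (evalHom (R := R) t θ) =
      evalHom (fun i ↦ algebraMap S F (t i)) (algebraMap S F θ) := by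
    refine Polynomial.ringHom_ext' (MvPolynomial.ringHom_ext (fun r ↦ ?_) fun i ↦ ?_) ?_
    · simp [evalHom_C, ← IsScalarTower.algebraMap_apply]
    · simp [evalHom_C]
    · simp [evalHom_X]
  exact congr($this P)

/-- If `S` is radicial over the hypersurface `G(t, y) = 0` over `R`, where `G` is monic with
irreducible specializations, then the fibres of a dense open subset of `Spec S` are irreducible over
a dense open subset of `Spec R`. -/
lemma exists_forall_isIrreducibleAway_of_integral_presentation {R S F σ : Type u} [CommRing R]
    [IsDomain R] [CommRing S] [Algebra R S] [Algebra.FiniteType R S] [Field F] [Algebra S F]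
    [FaithfulSMul S F] [Algebra R F] [IsScalarTower R S F] (p : ℕ)
    (hp : p = 1 ∨ p.Prime ∧ (p : R) = 0) {t : σ → S} {θ : S} {G : (MvPolynomial σ R)[X]}
    (hG : G.Monic) (hGθ : evalHom t θ G = 0)
    (hker : ∀ P : (MvPolynomial σ R)[X], evalHom t θ P = 0 → G ∣ P)
    (hirr : ∃ r : R, r ≠ 0 ∧ ∀ (k : Type u) [Field k] (ψ : R →+* k), ψ r ≠ 0 →
        Irreducible (G.map (MvPolynomial.map ψ)))
    (hgen : ∀ x : S, ∃ n : ℕ, ∃ d : MvPolynomial σ R, d ≠ 0 ∧ ∃ Q : (MvPolynomial σ R)[X],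
        MvPolynomial.aeval t d * x ^ p ^ n = evalHom t θ Q) :
    ∃ r : R, r ≠ 0 ∧ ∃ h : MvPolynomial σ R, h ≠ 0 ∧ ∀ (Ω D : Type u) [Field Ω] [CommRing D]
      [Algebra R Ω] [Algebra Ω D] [Algebra S D], IsFieldPushout R S Ω D → algebraMap R Ω r ≠ 0 →
      IsIrreducibleAway (algebraMap S D (MvPolynomial.aeval t h)) := by
  classical
  obtain ⟨Y, hY⟩ := (inferInstance : Algebra.FiniteType R S).out
  choose n d hd Q hQ using hgen
  let h : MvPolynomial σ R := ∏ y ∈ Y, d y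
  have hh : h ≠ 0 := Finset.prod_ne_zero_iff.mpr fun y _ ↦ hd y
  obtain ⟨m, hm⟩ := MvPolynomial.ne_zero_iff.mp hh
  obtain ⟨r, hr, hirr⟩ := hirr
  refine ⟨r * h.coeff m, mul_ne_zero hr hm, h, hh, fun Ω D _ _ _ _ _ hD hΩ ↦ ?_⟩
  rw [map_mul] at hΩ
  have hp0 : 0 < p := by
    rcases hp with rfl | ⟨hp, -⟩
    · exact one_pos
    · exact hp.pos
  have hpS : p = 1 ∨ p.Prime ∧ (p : S) = 0 := hp.imp_right fun h ↦
    ⟨h.1, by rw [← map_natCast (algebraMap R S), h.2, map_zero]⟩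
  have hpD : p = 1 ∨ p.Prime ∧ (p : D) = 0 := hpS.imp_right fun h ↦
    ⟨h.1, by rw [← map_natCast (algebraMap S D), h.2, map_zero]⟩
  have hirr' := hirr Ω (algebraMap R Ω) (left_ne_zero_of_mul hΩ)
  refine isIrreducibleAway_of_irreducible_map hD p hp0 (add_pow_pow_of_prime_or_eq_one hpS)
    (add_pow_pow_of_prime_or_eq_one hpD) t θ G hGθ h
    (fun P hP ↦ ⟨0, by simpa using hker P hP⟩) Y hY (fun y hy ↦ ?_) hirr' fun hdvd ↦ ?_
  · refine ⟨n y, C (∏ x ∈ Y.erase y, d x) * Q y, ?_⟩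
    rw [map_mul, ← hQ, evalHom_C, evalHom_C,
      show h = d y * _ from (Finset.mul_prod_erase Y d hy).symm, map_mul]
    ring
  · have hne : MvPolynomial.map (algebraMap R Ω) h ≠ 0 := by
      refine MvPolynomial.ne_zero_iff.mpr ⟨m, ?_⟩
      rw [MvPolynomial.coeff_map]
      exact right_ne_zero_of_mul hΩ
    have hdeg := Polynomial.natDegree_le_of_dvd hdvd (C_ne_zero.mpr hne)
    rw [natDegree_C, Nat.le_zero] at hdeg
    have h1 := (hG.map (MvPolynomial.map (algebraMap R Ω))).natDegree_eq_zero.mp hdeg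
    exact hirr'.not_isUnit (h1 ▸ isUnit_one)

lemma IsIrreducibleAway.of_isUnit_mul {D : Type*} [CommRing D] {u s : D} (hu : IsUnit u)
    (hs : IsIrreducibleAway s) : IsIrreducibleAway (u * s) := by
  have key (x : D) : IsNilpotent (u * x) ↔ IsNilpotent x :=
    hu.isNilpotent_unit_mul_of_commute_iff (Commute.all _ _)
  refine ⟨fun h ↦ hs.1 ((key s).mp h), fun a b hab ↦ ?_⟩
  rw [mul_assoc, key] at hab ⊢
  rw [mul_assoc, key]
  exact hs.2 a b hab

/-- Inverting an element of `S`. -/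
lemma IsFieldPushout.localization {R S Ω D S' D' : Type u} [CommRing R] [CommRing S] [CommRing Ω]
    [CommRing D] [CommRing S'] [CommRing D'] [Algebra R S] [Algebra R Ω] [Algebra Ω D]
    [Algebra S D] [Algebra S S'] [Algebra D D'] [Algebra R S'] [IsScalarTower R S S']
    [Algebra Ω D'] [IsScalarTower Ω D D'] [Algebra S' D'] (h : IsFieldPushout R S Ω D) (b : S)
    [IsLocalization.Away b S'] [IsLocalization.Away (algebraMap S D b) D']
    (hcomm : ∀ x : S, algebraMap S' D' (algebraMap S S' x) = algebraMap D D' (algebraMap S D x)) :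
    IsFieldPushout R S' Ω D' := by
  have hu : IsUnit (algebraMap S S' b) := IsLocalization.Away.algebraMap_isUnit b
  have hu' : IsUnit (algebraMap D D' (algebraMap S D b)) :=
    IsLocalization.Away.algebraMap_isUnit _
  refine ⟨?_, ?_, fun Θ _ α β hαβ ↦ ?_⟩
  · ext r
    have := congr(algebraMap D D' ($h.comm r))
    simp only [RingHom.comp_apply] at this ⊢
    rw [IsScalarTower.algebraMap_apply Ω D D', this, IsScalarTower.algebraMap_apply R S S', hcomm]
  · rw [eq_top_iff]
    rintro y -
    set H := Subring.closure (Set.range (algebraMap Ω D') ∪ Set.range (algebraMap S' D'))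
    have hD (x : D) : algebraMap D D' x ∈ H := by
      have hx : x ∈ Subring.closure (Set.range (algebraMap Ω D) ∪ Set.range (algebraMap S D)) :=
        h.closure_eq_top ▸ Subring.mem_top x
      refine (Subring.closure_le (t := H.comap (algebraMap D D'))).mpr ?_ hx
      rintro _ (⟨ω, rfl⟩ | ⟨s, rfl⟩)
      · exact Subring.subset_closure (.inl ⟨ω, IsScalarTower.algebraMap_apply ..⟩)
      · exact Subring.subset_closure (.inr ⟨algebraMap S S' s, hcomm s⟩)
    obtain ⟨n, x, hx⟩ := IsLocalization.Away.surj (algebraMap S D b) y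
    obtain ⟨v, hv⟩ := hu.exists_right_inv
    have hy : y = algebraMap D D' x * algebraMap S' D' v ^ n := by
      rw [← hx, mul_assoc, ← mul_pow, ← hcomm, ← map_mul, hv, map_one, one_pow, mul_one]
    rw [hy]
    exact mul_mem (hD x) (pow_mem (Subring.subset_closure (.inr ⟨v, rfl⟩)) n)
  · obtain ⟨γ, hγ₁, hγ₂⟩ := h.exists_lift Θ α (β.comp (algebraMap S S')) (by
      rw [hαβ, RingHom.comp_assoc, ← IsScalarTower.algebraMap_eq])
    have hγb : IsUnit (γ (algebraMap S D b)) := by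
      have := congr($hγ₂ b)
      simp only [RingHom.comp_apply] at this
      rw [this]
      exact hu.map β
    refine ⟨IsLocalization.Away.lift (algebraMap S D b) hγb, ?_, ?_⟩
    · ext ω
      rw [RingHom.comp_apply, IsScalarTower.algebraMap_apply Ω D D', IsLocalization.Away.lift_eq]
      exact congr($hγ₁ ω)
    · refine IsLocalization.ringHom_ext (.powers b) (RingHom.ext fun s ↦ ?_)
      rw [RingHom.comp_apply, RingHom.comp_apply, hcomm, IsLocalization.Away.lift_eq]
      exact congr($hγ₂ s)

/-- If the fraction field of `S` has an absolutely irreducible presentation over `L = Frac R`, then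
the fibres of a dense open subset of `Spec S` are geometrically irreducible over a dense open subset
of `Spec R`. -/
theorem exists_forall_isIrreducibleAway {R S L F σ : Type u} [CommRing R] [IsDomain R] [CommRing S]
    [IsDomain S] [Algebra R S] [Algebra.FiniteType R S] [Field L] [Field F] [Algebra R L]
    [IsFractionRing R L] [Algebra S F] [IsFractionRing S F] [Algebra R F] [IsScalarTower R S F]
    [Algebra L F] [IsScalarTower R L F] [Finite σ] (p : ℕ) [ExpChar L p]
    {t : σ → F} {θ : F} {g : (MvPolynomial σ L)[X]}
    (ht : AlgebraicIndependent L t) (hg : g.Monic) (hgθ : evalHom t θ g = 0)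
    (hΩ : ∃ (Ω : Type u) (_ : Field Ω) (_ : IsAlgClosed Ω) (_ : Algebra L Ω),
      Irreducible (g.map (MvPolynomial.map (algebraMap L Ω))))
    (hgen : ∀ x : F, ∃ n : ℕ, ∃ d : MvPolynomial σ L, d ≠ 0 ∧ ∃ Q : (MvPolynomial σ L)[X],
      MvPolynomial.aeval t d * x ^ p ^ n = evalHom t θ Q) :
    ∃ r : R, r ≠ 0 ∧ ∃ s : S, s ≠ 0 ∧ ∀ (Ω D : Type u) [Field Ω] [CommRing D]
      [Algebra R Ω] [Algebra Ω D] [Algebra S D], IsFieldPushout R S Ω D → algebraMap R Ω r ≠ 0 →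
      IsIrreducibleAway (algebraMap S D s) := by
  obtain ⟨θ₁, G, hG, hGθ, hker, hirr, hgen⟩ :=
    exists_integral_presentation (R := R) p ht hg hgθ hΩ hgen
  have hp : p = 1 ∨ p.Prime ∧ (p : R) = 0 := by
    cases ‹ExpChar L p› with
    | zero => exact .inl rfl
    | prime hp =>
      refine .inr ⟨hp, IsFractionRing.injective R L ?_⟩
      rw [map_natCast, map_zero, CharP.cast_eq_zero]
  obtain ⟨b, hb⟩ := IsLocalization.exist_integer_multiples_of_finite (nonZeroDivisors S)
    (fun i : Option σ ↦ i.elim θ₁ t)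
  have hb0 : (b : S) ≠ 0 := nonZeroDivisors.ne_zero b.2
  let S' := Localization.Away (b : S)
  have hle : Submonoid.powers (b : S) ≤ nonZeroDivisors S :=
      powers_le_nonZeroDivisors_of_noZeroDivisors hb0
  have hbF : IsUnit (algebraMap S F b) := IsLocalization.map_units F b
  let := (IsLocalization.Away.lift (S := S') (b : S) hbF).toAlgebra
  have : IsScalarTower S S' F :=
    .of_algebraMap_eq fun x ↦ (IsLocalization.Away.lift_eq (b : S) hbF x).symm
  have : IsFractionRing S' F :=
    IsFractionRing.isFractionRing_of_isDomain_of_isLocalization (.powers (b : S)) S' F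
  have : FaithfulSMul S' F := by
    rw [faithfulSMul_iff_algebraMap_injective]
    exact IsFractionRing.injective S' F
  have : FaithfulSMul S S' := by
    rw [faithfulSMul_iff_algebraMap_injective]
    exact IsLocalization.injective S' hle
  have : IsScalarTower R S' F := .of_algebraMap_eq fun x ↦ by
    rw [IsScalarTower.algebraMap_apply R S F, IsScalarTower.algebraMap_apply R S S',
      ← IsScalarTower.algebraMap_apply S S' F]
  have hlift (i : Option σ) : ∃ y : S', algebraMap S' F y = i.elim θ₁ t := by
    obtain ⟨x, hx⟩ := hb i
    obtain ⟨v, hv⟩ := (IsLocalization.Away.algebraMap_isUnit (S := S') (b : S)).exists_right_inv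
    refine ⟨v * algebraMap S S' x, ?_⟩
    rw [map_mul, ← IsScalarTower.algebraMap_apply S S' F, hx, Algebra.smul_def,
      IsScalarTower.algebraMap_apply S S' F, ← mul_assoc, ← map_mul, mul_comm v, hv, map_one,
      one_mul]
  choose y hy using hlift
  have ht' : (fun i ↦ algebraMap S' F (y (some i))) = t := funext fun i ↦ hy (some i)
  have hθ' : algebraMap S' F (y none) = θ₁ := hy none
  have hev (P : (MvPolynomial σ R)[X]) :
      algebraMap S' F (evalHom (fun i ↦ y (some i)) (y none) P) = evalHom t θ₁ P := by
    rw [map_evalHom, ht', hθ']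
  have hinj : Function.Injective (algebraMap S' F) := FaithfulSMul.algebraMap_injective _ _
  have haev (d : MvPolynomial σ R) : algebraMap S' F (MvPolynomial.aeval (fun i ↦ y (some i)) d) =
      MvPolynomial.aeval t d := by
    rw [← evalHom_C _ (y none), hev, evalHom_C]
  obtain ⟨r, hr, h, hh, H⟩ := exists_forall_isIrreducibleAway_of_integral_presentation (S := S')
    (F := F) p hp (t := fun i ↦ y (some i)) (θ := y none) hG
    (hinj (by rw [hev, hGθ, map_zero])) (fun P hP ↦ hker P (by rw [← hev, hP, map_zero])) hirr
    (fun x ↦ by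
      obtain ⟨n, d, hd, Q, hQ⟩ := hgen (algebraMap S' F x)
      exact ⟨n, d, hd, Q, hinj (by rw [map_mul, map_pow, haev, hev, hQ])⟩)
  obtain ⟨m, s, hs⟩ := IsLocalization.Away.surj (b : S)
    (MvPolynomial.aeval (fun i ↦ y (some i)) h : S')
  refine ⟨r, hr, s * b, mul_ne_zero ?_ hb0, fun Ω D _ _ _ _ _ hD hΩ ↦ ?_⟩
  · rintro rfl
    have h0 := congrArg (algebraMap S' F) hs
    rw [map_zero, map_zero, map_mul, haev, map_pow, ← IsScalarTower.algebraMap_apply] at h0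
    have h1 := (mul_eq_zero.mp h0).resolve_right (pow_ne_zero _ hbF.ne_zero)
    have hRt : AlgebraicIndependent R t :=
      ht.restrictScalars (IsFractionRing.injective R L)
    exact hh (hRt (by rw [h1, map_zero]))
  · let D' := Localization.Away (algebraMap S D b)
    have hu : IsUnit (((algebraMap D D').comp (algebraMap S D)) (b : S)) :=
      IsLocalization.Away.algebraMap_isUnit (algebraMap S D (b : S))
    let := (IsLocalization.Away.lift (S := S') (b : S) hu).toAlgebra
    have hf (x : S) : algebraMap S' D' (algebraMap S S' x) = algebraMap D D' (algebraMap S D x) :=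
      IsLocalization.Away.lift_eq (b : S) hu x
    have hirr := H Ω D' (hD.localization (D' := D') (b : S) hf) hΩ
    rw [map_mul]
    refine IsIrreducibleAway.of_localization (C' := D') (algebraMap S D b) ?_
    rw [← hf, ← hs, map_mul, mul_comm]
    refine hirr.of_isUnit_mul ?_
    rw [map_pow, hf]
    exact (IsLocalization.Away.algebraMap_isUnit _).pow m

end Spread

/-! ### Geometrically irreducible algebras -/

section GeometricallyIrreducibleAlgebra
open Polynomial TensorProduct

lemma natDegree_minpoly_le_of_monic {k Ω B : Type*} [Field k] [Field Ω] [CommRing B] [Algebra k Ω]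
    [Algebra k B] {b : B} {q : Polynomial Ω} (hq : q.Monic) (h : aeval ((1 : Ω) ⊗ₜ[k] b) q = 0) :
    (minpoly k b).natDegree ≤ q.natDegree := by
  by_contra! hlt
  have hli := linearIndependent_pow (K := k) b
  obtain ⟨f, hf⟩ := LinearMap.exists_extend
    ((Finsupp.lapply (R := k) (M := k) (⟨q.natDegree, hlt⟩ : Fin (minpoly k b).natDegree)).comp
      hli.repr)
  have hfi (i : Fin (minpoly k b).natDegree) :
      f (b ^ (i : ℕ)) = if (i : ℕ) = q.natDegree then 1 else 0 := by
    have h1 := LinearMap.congr_fun hf ⟨b ^ (i : ℕ), Submodule.subset_span ⟨i, rfl⟩⟩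
    simp only [LinearMap.comp_apply, Submodule.subtype_apply] at h1
    refine h1.trans ?_
    rw [hli.repr_eq_single i _ rfl, Finsupp.lapply_apply, Finsupp.single_apply]
    simp [Fin.ext_iff]
  let F : Ω ⊗[k] B →ₗ[k] Ω := (TensorProduct.rid k Ω).toLinearMap.comp (f.lTensor Ω)
  have h0 := congrArg F h
  rw [aeval_eq_sum_range, map_sum, map_zero, Finset.sum_eq_single q.natDegree] at h0
  · rw [hq.coeff_natDegree, one_smul, Algebra.TensorProduct.tmul_pow, one_pow] at h0
    have := hfi ⟨_, hlt⟩
    simp [F, this] at h0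
  · intro i hi hne
    have hi' : i < (minpoly k b).natDegree := by
      rw [Finset.mem_range] at hi; omega
    have := hfi ⟨i, hi'⟩
    simp only at this
    rw [Algebra.TensorProduct.tmul_pow, one_pow, TensorProduct.smul_tmul']
    simp [F, this, hne]
  · intro h; simp at h

/-- If a product is zero, the factors are comaximal and the spectrum is irreducible, then one of
the factors is zero. -/
lemma eq_zero_or_eq_zero_of_isIrreducibleAway {C : Type*} [CommRing C] (hC : IsIrreducibleAway (1
    : C))
    {x y : C} (hxy : x * y = 0) (hco : IsCoprime x y) : x = 0 ∨ y = 0 := by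
  have key {x y : C} (hxy : x * y = 0) (hco : IsCoprime x y) (hx : IsNilpotent x) : x = 0 := by
    obtain ⟨u, v, huv⟩ := hco
    have hy : IsUnit (v * y) := by
      rw [show v * y = 1 - u * x by rw [← huv]; ring]
      exact ((Commute.all u x).isNilpotent_mul_left hx).isUnit_one_sub
    exact (hy.mul_left_eq_zero).mp (by rw [mul_comm v, ← mul_assoc, hxy, zero_mul])
  have := hC.2 x y
  simp only [one_mul] at this
  rcases this (hxy ▸ IsNilpotent.zero) with h | h
  · exact .inl (key hxy hco h)
  · exact .inr (key (mul_comm x y ▸ hxy) hco.symm h)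

/-- A geometrically irreducible algebra contains no separable algebraic elements outside the base
field. -/
lemma mem_range_algebraMap_of_geometricallyIrreducible {k B : Type u} [Field k] [CommRing B]
    [Algebra k B] (hB : ∀ (Ω : Type u) [Field Ω] [Algebra k Ω], IsIrreducibleAway (1 : Ω ⊗[k] B))
    {b : B} {q : k[X]} (hq : q.Separable) (hqb : aeval b q = 0) :
    ∃ α : k, algebraMap k B α = b := by
  let m := minpoly k b
  have hint : IsIntegral k b := by
    rw [← isAlgebraic_iff_isIntegral]
    exact ⟨q, hq.ne_zero, hqb⟩
  have hm : m.Separable := hq.of_dvd (minpoly.dvd k b hqb)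
  have hB0 : Nontrivial B := by
    by_contra h
    rw [not_nontrivial_iff_subsingleton] at h
    have : Subsingleton (k ⊗[k] B) := inferInstance
    exact (hB k).1 ⟨1, Subsingleton.elim _ _⟩
  have hdeg := minpoly.natDegree_pos hint
  let Ω := AlgebraicClosure k
  obtain ⟨α, hα⟩ := IsAlgClosed.exists_root (m.map (algebraMap k Ω)) (by
    rw [degree_map]
    exact (minpoly.degree_pos hint).ne')
  obtain ⟨n, hn⟩ := dvd_iff_isRoot.mpr hα
  have hmΩ : (m.map (algebraMap k Ω)).Monic := (minpoly.monic hint).map _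
  have hnm : n.Monic := (monic_X_sub_C α).of_mul_monic_left (hn ▸ hmΩ)
  have hmn : m.natDegree = 1 + n.natDegree := by
    rw [← natDegree_map (algebraMap k Ω), hn, (monic_X_sub_C α).natDegree_mul hnm,
      natDegree_X_sub_C]
  let β : Ω ⊗[k] B := 1 ⊗ₜ b
  have h0 : aeval β (m.map (algebraMap k Ω)) = 0 := by
    rw [aeval_map_algebraMap]
    have := Polynomial.aeval_algHom_apply
      (Algebra.TensorProduct.includeRight : B →ₐ[k] Ω ⊗[k] B) b m
    rw [minpoly.aeval, map_zero] at this
    exact this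
  rw [hn, map_mul] at h0
  have hco : IsCoprime (X - C α) n := by
    have := hm.map (f := algebraMap k Ω)
    rw [hn] at this
    exact this.isCoprime
  rcases eq_zero_or_eq_zero_of_isIrreducibleAway (hB Ω) h0 (hco.map (aeval β).toRingHom) with h | h
  · have h1 := natDegree_minpoly_le_of_monic (monic_X_sub_C α) h
    rw [natDegree_X_sub_C] at h1
    have h2 : m.natDegree = 1 := le_antisymm h1 hdeg
    have h3 := minpoly.natDegree_eq_one_iff.mp h2
    exact h3
  · have h1 := natDegree_minpoly_le_of_monic hnm h
    change m.natDegree ≤ _ at h1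
    omega

end GeometricallyIrreducibleAlgebra

/-! ### Base change to fibres, up to nilpotents -/

section Pushout
open TensorProduct

lemma IsFieldPushout.of_tower {R R₁ S Ω D : Type u} [CommRing R] [CommRing R₁] [CommRing S]
    [CommRing Ω] [CommRing D] [Algebra R S] [Algebra R Ω] [Algebra Ω D] [Algebra S D]
    [Algebra R R₁] [Algebra R₁ S] [Algebra R₁ Ω] [IsScalarTower R R₁ S] [IsScalarTower R R₁ Ω]
    (h : IsFieldPushout R S Ω D)
    (hcomm : (algebraMap Ω D).comp (algebraMap R₁ Ω) = (algebraMap S D).comp (algebraMap R₁ S)) :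
    IsFieldPushout R₁ S Ω D where
  comm := hcomm
  closure_eq_top := h.closure_eq_top
  exists_lift Θ _ α β hαβ := h.exists_lift Θ α β (by
    rw [IsScalarTower.algebraMap_eq R R₁ Ω, IsScalarTower.algebraMap_eq R R₁ S,
      ← RingHom.comp_assoc, hαβ, RingHom.comp_assoc])

lemma IsFieldPushout.trans {R S k Ω D E : Type u} [CommRing R] [CommRing S]
    [CommRing k] [CommRing Ω] [CommRing D] [CommRing E] [Algebra R S] [Algebra R k] [Algebra k Ω]
    [Algebra R Ω] [IsScalarTower R k Ω] [Algebra k D] [Algebra S D] [Algebra Ω E] [Algebra D E]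
    [Algebra S E] [IsScalarTower S D E] (h : IsFieldPushout R S k D) (h' : IsFieldPushout k D Ω E) :
    IsFieldPushout R S Ω E where
  comm := by
    rw [IsScalarTower.algebraMap_eq R k Ω, IsScalarTower.algebraMap_eq S D E, ← RingHom.comp_assoc,
      h'.comm, RingHom.comp_assoc, h.comm, RingHom.comp_assoc]
  closure_eq_top := by
    rw [← top_le_iff, ← h'.closure_eq_top, Subring.closure_le]
    rintro _ (⟨ω, rfl⟩ | ⟨d, rfl⟩)
    · exact Subring.subset_closure (.inl ⟨ω, rfl⟩)
    · have hd : d ∈ Subring.closure (Set.range (algebraMap k D) ∪ Set.range (algebraMap S D)) :=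
        h.closure_eq_top ▸ Subring.mem_top d
      refine (Subring.closure_le (t := Subring.comap (algebraMap D E) (Subring.closure
        (Set.range (algebraMap Ω E) ∪ Set.range (algebraMap S E))))).mpr ?_ hd
      rintro _ (⟨x, rfl⟩ | ⟨s, rfl⟩)
      · exact Subring.subset_closure (.inl ⟨algebraMap k Ω x, congr($h'.comm x)⟩)
      · exact Subring.subset_closure (.inr ⟨s, IsScalarTower.algebraMap_apply ..⟩)
  exists_lift Θ _ α β hαβ := by
    obtain ⟨γ, hγ₁, hγ₂⟩ := h.exists_lift Θ (α.comp (algebraMap k Ω)) β (by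
      rw [RingHom.comp_assoc, ← IsScalarTower.algebraMap_eq, hαβ])
    obtain ⟨δ, hδ₁, hδ₂⟩ := h'.exists_lift Θ α γ hγ₁.symm
    exact ⟨δ, hδ₁, by rw [IsScalarTower.algebraMap_eq S D E, ← RingHom.comp_assoc, hδ₂, hγ₂]⟩

lemma isFieldPushout_tensorProduct (R S Ω : Type u) [CommRing R] [CommRing S] [CommRing Ω]
    [Algebra R S] [Algebra R Ω] :
    letI : Algebra S (Ω ⊗[R] S) := Algebra.TensorProduct.rightAlgebra
    IsFieldPushout R S Ω (Ω ⊗[R] S) := by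
  let : Algebra S (Ω ⊗[R] S) := Algebra.TensorProduct.rightAlgebra
  refine ⟨?_, ?_, fun Θ _ α β h ↦ ?_⟩
  · ext r
    exact ((Algebra.TensorProduct.includeLeft : Ω →ₐ[R] Ω ⊗[R] S).commutes r).trans
      ((Algebra.TensorProduct.includeRight : S →ₐ[R] Ω ⊗[R] S).commutes r).symm
  · rw [eq_top_iff]
    rintro x -
    induction x using TensorProduct.induction_on with
    | zero => exact zero_mem _
    | add x y hx hy => exact add_mem hx hy
    | tmul ω s =>
      rw [← mul_one ω, ← one_mul s, ← Algebra.TensorProduct.tmul_mul_tmul]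
      exact mul_mem (Subring.subset_closure (.inl ⟨ω, rfl⟩))
        (Subring.subset_closure (.inr ⟨s, rfl⟩))
  · let : Algebra R Θ := (α.comp (algebraMap R Ω)).toAlgebra
    let α' : Ω →ₐ[R] Θ := { α with commutes' := fun _ ↦ rfl }
    let β' : S →ₐ[R] Θ := { β with commutes' := fun r ↦ congr($h.symm r) }
    have hc (x y) : Commute (α' x) (β' y) := Commute.all _ _
    refine ⟨(Algebra.TensorProduct.lift α' β' hc).toRingHom, ?_, ?_⟩
    · ext ω
      exact (Algebra.TensorProduct.lift_tmul α' β' hc ω 1).trans (by rw [map_one, mul_one]; rfl)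
    · ext s
      exact (Algebra.TensorProduct.lift_tmul α' β' hc 1 s).trans (by rw [map_one, one_mul]; rfl)

end Pushout

/-! ### Geometric irreducibility of fibres: the affine case -/

section Affine
open Polynomial

/-- A finite separable extension `L` of `Frac R` is generated by the root of a monic polynomial over
`R` that is separable over a dense open subset of `Spec R`. -/
lemma exists_monic_generator (R k L : Type u) [CommRing R] [IsDomain R] [Field k] [Field L]
    [Algebra R k] [IsFractionRing R k] [Algebra k L] [Algebra R L] [IsScalarTower R k L]
    [Module.Finite k L] [Algebra.IsSeparable k L] :
    ∃ (m : R[X]) (x : L), m.Monic ∧ aeval x m = 0 ∧ (∀ P : R[X], aeval x P = 0 → m ∣ P) ∧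
      (∃ c : R, c ≠ 0 ∧ ∃ u v, u * m + v * derivative m = C c) ∧
      ∀ y : L, ∃ d : R, d ≠ 0 ∧ ∃ Q : R[X], algebraMap R L d * y = aeval x Q := by
  obtain ⟨x₀, hx₀⟩ := Field.exists_primitive_element k L
  have hint₀ : IsIntegral k x₀ := Algebra.IsIntegral.isIntegral x₀
  have hm₀ := minpoly.monic hint₀
  let M := nonZeroDivisors R
  let c : M := IsLocalization.commonDenom M (minpoly k x₀).support (minpoly k x₀).coeff
  have hc : algebraMap R k c ≠ 0 := (IsLocalization.map_units k c).ne_zero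
  have hlift := IsLocalization.scaleRoots_commonDenom_mem_lifts (M := M) (minpoly k x₀)
    ⟨1, by rw [map_one, hm₀.leadingCoeff]⟩
  obtain ⟨m, hm, -, hmm⟩ := lifts_and_natDegree_eq_and_monic hlift ((monic_scaleRoots_iff _).mpr
      hm₀)
  let x : L := algebraMap k L (algebraMap R k c) * x₀
  have hx0 : aeval x (m.map (algebraMap R k)) = 0 := by
    rw [hm, aeval_def, scaleRoots_eval₂_mul, ← aeval_def, minpoly.aeval, mul_zero]
  have hmin : m.map (algebraMap R k) = minpoly k x := by
    refine minpoly.eq_of_irreducible_of_monic ?_ hx0 (hmm.map _)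
    rw [hm]
    exact irreducible_scaleRoots (minpoly.irreducible hint₀) hc.isUnit
  have htop : IntermediateField.adjoin k {x} = ⊤ := by
    rw [eq_top_iff, ← hx₀, IntermediateField.adjoin_simple_le_iff]
    have h1 : x₀ = (algebraMap R k c)⁻¹ • x := by
      rw [Algebra.smul_def, map_inv₀, inv_mul_cancel_left₀]
      exact (_root_.map_ne_zero _).mpr hc
    rw [h1]
    exact IntermediateField.smul_mem _ (IntermediateField.mem_adjoin_simple_self k x)
  have hinj := IsFractionRing.injective R k
  refine ⟨m, x, hmm, by rwa [aeval_map_algebraMap] at hx0, fun P hP ↦ ?_, ?_, fun y ↦ ?_⟩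
  · rw [← Polynomial.map_dvd_map (algebraMap R k) hinj hmm, hmin]
    exact minpoly.dvd k x (by rwa [aeval_map_algebraMap])
  · have hsep : (m.map (algebraMap R k)).Separable := hmin ▸ Algebra.IsSeparable.isSeparable k x
    obtain ⟨u, v, huv⟩ := hsep
    obtain ⟨d, hd, hu⟩ := IsLocalization.integerNormalization_spec M u
    obtain ⟨d', hd', hv⟩ := IsLocalization.integerNormalization_spec M v
    refine ⟨d * d', mul_ne_zero (nonZeroDivisors.ne_zero hd) (nonZeroDivisors.ne_zero hd'),
      C d' * IsLocalization.integerNormalization M u, C d * IsLocalization.integerNormalization M v,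
      Polynomial.map_injective _ hinj ?_⟩
    rw [derivative_map] at huv
    simp only [Polynomial.map_add, Polynomial.map_mul, hu, hv, map_C, Algebra.smul_def,
      Polynomial.algebraMap_apply, map_mul]
    linear_combination (C (algebraMap R k d) * C (algebraMap R k d')) * huv
  · have hmem : y ∈ Algebra.adjoin k {x} := by
      rw [← IntermediateField.adjoin_simple_toSubalgebra_of_isAlgebraic
        (Algebra.IsAlgebraic.isAlgebraic x), htop]
      trivial
    rw [Algebra.adjoin_singleton_eq_range_aeval] at hmem
    obtain ⟨Q₀, rfl⟩ := hmem
    obtain ⟨d, hd, hdQ⟩ := IsLocalization.integerNormalization_spec M Q₀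
    refine ⟨d, nonZeroDivisors.ne_zero hd, IsLocalization.integerNormalization M Q₀, ?_⟩
    rw [← aeval_map_algebraMap k, hdQ, ← algebraMap_smul k d, map_smul, Algebra.smul_def,
      ← IsScalarTower.algebraMap_apply]
    rfl

/-- Let `R ⊆ S` be domains, with `S` of finite type over `R` and integrally closed at `e`. The
finite separable extension `L` over which the function field of `S` is geometrically irreducible is
generated by an element `a / g` of `S_e`, the root of a monic polynomial `m` over `R`, and the part
of a fibre of `S` on which `a / g` equals a given root of `m` is irreducible. -/
lemma exists_monic_forall_isIrreducibleAway (R S : Type u) [CommRing R] [IsDomain R] [CommRing S]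
    [IsDomain S] [Algebra R S] [FaithfulSMul R S] [Algebra.FiniteType R S] (e : Ideal S) [e.IsPrime]
    [IsIntegrallyClosed (Localization.AtPrime e)] :
    ∃ (m : R[X]) (a g : S), m.Monic ∧ g ∉ e ∧
      (∃ c : R, c ≠ 0 ∧ ∃ u v, u * m + v * derivative m = C c) ∧
      ((m.map (algebraMap R S)).scaleRoots g).eval a = 0 ∧
      ∃ r : R, r ≠ 0 ∧ ∃ s : S, s ≠ 0 ∧ ∀ (Ω D : Type u) [Field Ω] [CommRing D] [Algebra R Ω]
        [Algebra Ω D] [Algebra S D], IsFieldPushout R S Ω D → ∀ α : Ω, aeval α m = 0 →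
        (∃ N : ℕ, algebraMap S D (g ^ N * a) = algebraMap Ω D α * algebraMap S D (g ^ N * g)) →
        algebraMap R Ω r ≠ 0 → IsIrreducibleAway (algebraMap S D s) := by
  let F := FractionRing S
  let k := FractionRing R
  have : FaithfulSMul R F := by
    rw [faithfulSMul_iff_algebraMap_injective, IsScalarTower.algebraMap_eq R S F]
    exact (IsFractionRing.injective S F).comp (FaithfulSMul.algebraMap_injective R S)
  let := FractionRing.liftAlgebra R F
  have : IsScalarTower R k F := FractionRing.isScalarTower_liftAlgebra R F
  have : Algebra.EssFiniteType S F := .of_isLocalization _ (nonZeroDivisors S)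
  have : Algebra.EssFiniteType R F := .comp R S F
  have : Algebra.EssFiniteType k F := .of_comp R k F
  obtain ⟨p, hp⟩ := ExpChar.exists k
  obtain ⟨L, _, _, _, _, _, _, σ, _, t, θ, G, ht, hG, hGθ, hΩ, hgen⟩ :=
    exists_absolutelyIrreducible_presentation k F p
  let : Algebra R L := ((algebraMap k L).comp (algebraMap R k)).toAlgebra
  have : IsScalarTower R k L := .of_algebraMap_eq fun _ ↦ rfl
  have : IsScalarTower R L F := .of_algebraMap_eq fun x ↦ by
    rw [IsScalarTower.algebraMap_apply R k L, ← IsScalarTower.algebraMap_apply k L F,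
      ← IsScalarTower.algebraMap_apply R k F]
  have : ExpChar L p := expChar_of_injective_algebraMap (algebraMap k L).injective p
  obtain ⟨m, x, hm, hmx, hmdvd, hsep, hxgen⟩ := exists_monic_generator R k L
  have hRL : Function.Injective (algebraMap R L) :=
    (algebraMap k L).injective.comp (IsFractionRing.injective R k)
  -- The element `x` is integral, so it lies in the integrally closed local ring at `e`.
  let Se := Localization.AtPrime e
  let xF := algebraMap L F x
  have hmxF : aeval xF m = 0 := by rw [aeval_algebraMap_apply, hmx, map_zero]
  obtain ⟨a, g, hg, hag⟩ : ∃ a g : S, g ∉ e ∧ algebraMap S F a = xF * algebraMap S F g := by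
    have hle : e.primeCompl ≤ nonZeroDivisors S := e.primeCompl_le_nonZeroDivisors
    have hu (y : e.primeCompl) : IsUnit (algebraMap S F y) :=
      IsLocalization.map_units F (⟨y, hle y.2⟩ : nonZeroDivisors S)
    let := (IsLocalization.lift (S := Se) (M := e.primeCompl) hu).toAlgebra
    have : IsScalarTower S Se F :=
      .of_algebraMap_eq fun x ↦ (IsLocalization.lift_eq (M := e.primeCompl) hu x).symm
    have : IsFractionRing Se F :=
      IsFractionRing.isFractionRing_of_isDomain_of_isLocalization e.primeCompl Se F
    have : IsScalarTower R Se F := .of_algebraMap_eq fun x ↦ by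
      rw [IsScalarTower.algebraMap_apply R S F, IsScalarTower.algebraMap_apply R S Se,
        ← IsScalarTower.algebraMap_apply S Se F]
    have hint : IsIntegral Se xF := IsIntegral.tower_top (R := R) ⟨m, hm, hmxF⟩
    obtain ⟨y, hy⟩ := IsIntegrallyClosed.isIntegral_iff.mp hint
    obtain ⟨⟨a, g⟩, hag⟩ := IsLocalization.surj e.primeCompl y
    refine ⟨a, g, g.2, ?_⟩
    have := congrArg (algebraMap Se F) hag
    rw [map_mul, hy, ← IsScalarTower.algebraMap_apply, ← IsScalarTower.algebraMap_apply] at this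
    exact this.symm
  have hg0 : g ≠ 0 := by rintro rfl; exact hg e.zero_mem
  refine ⟨m, a, g, hm, hg, hsep, ?_, ?_⟩
  · apply IsFractionRing.injective S F
    rw [map_zero, ← Polynomial.eval₂_at_apply, hag, mul_comm, scaleRoots_eval₂_mul, eval₂_map,
      ← IsScalarTower.algebraMap_eq, ← aeval_def, hmxF, mul_zero]
  -- Apply the case of absolutely irreducible function fields over `R₁ = R[x]`.
  let R₁ := AdjoinRoot m
  let f₁ : R₁ →+* L := AdjoinRoot.lift (algebraMap R L) x (by rw [← aeval_def, hmx])
  let : Algebra R₁ L := f₁.toAlgebra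
  have hf₁mk (P : R[X]) : algebraMap R₁ L (AdjoinRoot.mk m P) = aeval x P :=
    AdjoinRoot.lift_mk _ P
  have : FaithfulSMul R₁ L := by
    rw [faithfulSMul_iff_algebraMap_injective, injective_iff_map_eq_zero]
    intro y hy
    obtain ⟨P, rfl⟩ := AdjoinRoot.mk_surjective y
    rw [AdjoinRoot.mk_eq_zero]
    exact hmdvd P (by rw [← hf₁mk, hy])
  have : IsDomain R₁ := (FaithfulSMul.algebraMap_injective R₁ L).isDomain
  have : IsScalarTower R R₁ L :=
    .of_algebraMap_eq fun y ↦ (AdjoinRoot.lift_of (i := algebraMap R L) (x := y) _).symm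
  have : IsFractionRing R₁ L := by
    refine IsFractionRing.of_field R₁ L fun y ↦ ?_
    obtain ⟨d, hd, Q, hQ⟩ := hxgen y
    refine ⟨AdjoinRoot.mk m Q, algebraMap R R₁ d, ?_⟩
    rw [hf₁mk, ← hQ, ← IsScalarTower.algebraMap_apply, mul_div_cancel_left₀]
    exact (map_ne_zero_iff _ hRL).mpr hd
  let Sg := Localization.Away g
  have hgF : IsUnit (algebraMap S F g) :=
    ((map_ne_zero_iff _ (IsFractionRing.injective S F)).mpr hg0).isUnit
  let : Algebra Sg F := (IsLocalization.Away.lift (S := Sg) g hgF).toAlgebra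
  have : IsScalarTower S Sg F :=
    .of_algebraMap_eq fun x ↦ (IsLocalization.Away.lift_eq g hgF x).symm
  have : IsFractionRing Sg F :=
    IsFractionRing.isFractionRing_of_isDomain_of_isLocalization (.powers g) Sg F
  have : IsDomain Sg := (IsFractionRing.injective Sg F).isDomain
  have : IsScalarTower R Sg F := .of_algebraMap_eq fun x ↦ by
    rw [IsScalarTower.algebraMap_apply R S F, IsScalarTower.algebraMap_apply R S Sg,
      ← IsScalarTower.algebraMap_apply S Sg F]
  have hgu : IsUnit (algebraMap S Sg g) := IsLocalization.Away.algebraMap_isUnit g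
  obtain ⟨w, hw⟩ := hgu.exists_right_inv
  let xS : Sg := algebraMap S Sg a * w
  have hxS : algebraMap Sg F xS = xF := by
    rw [map_mul, ← IsScalarTower.algebraMap_apply, hag, mul_assoc,
      IsScalarTower.algebraMap_apply S Sg F, ← map_mul, hw, map_one, mul_one]
  have hmxS : eval₂ (algebraMap R Sg) xS m = 0 := by
    apply IsFractionRing.injective Sg F
    rw [Polynomial.hom_eval₂, ← IsScalarTower.algebraMap_eq, hxS, ← aeval_def, hmxF, map_zero]
  let : Algebra R₁ Sg := (AdjoinRoot.lift (algebraMap R Sg) xS hmxS).toAlgebra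
  have hR₁S : algebraMap R₁ Sg (AdjoinRoot.root m) = xS := AdjoinRoot.lift_root hmxS
  have hR₁L : algebraMap R₁ L (AdjoinRoot.root m) = x := AdjoinRoot.lift_root _
  have : IsScalarTower R R₁ Sg := .of_algebraMap_eq fun y ↦ (AdjoinRoot.lift_of hmxS).symm
  let : Algebra R₁ F := ((algebraMap L F).comp (algebraMap R₁ L)).toAlgebra
  have : IsScalarTower R₁ L F := .of_algebraMap_eq fun _ ↦ rfl
  have : IsScalarTower R₁ Sg F := by
    refine .of_algebraMap_eq' (AdjoinRoot.ringHom_ext ?_ ?_)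
    · ext y
      change algebraMap L F (algebraMap R₁ L (algebraMap R R₁ y)) =
        algebraMap Sg F (algebraMap R₁ Sg (algebraMap R R₁ y))
      rw [← IsScalarTower.algebraMap_apply R R₁ L, ← IsScalarTower.algebraMap_apply R R₁ Sg,
        ← IsScalarTower.algebraMap_apply R L F, ← IsScalarTower.algebraMap_apply R Sg F]
    · rw [RingHom.comp_apply, hR₁S, hxS, IsScalarTower.algebraMap_apply R₁ L F, hR₁L]
  have : Algebra.FiniteType R₁ Sg := .of_restrictScalars_finiteType R R₁ Sg
  obtain ⟨r₁, hr₁, s₁, hs₁, H⟩ := exists_forall_isIrreducibleAway (R := R₁) (S := Sg) (L := L)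
    (F := F) p ht hG hGθ hΩ hgen
  have hfin : Algebra.IsIntegral R R₁ := by
    have := hm.finite_adjoinRoot
    infer_instance
  obtain ⟨r, hr, hr₁r⟩ := (Algebra.IsIntegral.isIntegral (R := R) r₁).isAlgebraic.exists_nonzero_dvd
    (mem_nonZeroDivisors_of_ne_zero hr₁)
  obtain ⟨n, s, hs⟩ := IsLocalization.Away.surj g s₁
  refine ⟨r, hr, s * g, mul_ne_zero ?_ hg0, fun Ω D _ _ _ _ _ hD α hα ⟨N, hN⟩ hrΩ ↦ ?_⟩
  · rintro rfl
    rw [map_zero] at hs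
    exact mul_ne_zero hs₁ (pow_ne_zero _ hgu.ne_zero) hs
  · let D' := Localization.Away (algebraMap S D g)
    have hu : IsUnit (((algebraMap D D').comp (algebraMap S D)) g) :=
      IsLocalization.Away.algebraMap_isUnit (algebraMap S D g)
    let := (IsLocalization.Away.lift (S := Sg) g hu).toAlgebra
    have hf (x : S) : algebraMap Sg D' (algebraMap S Sg x) = algebraMap D D' (algebraMap S D x) :=
      IsLocalization.Away.lift_eq g hu x
    have hαa : algebraMap D D' (algebraMap S D a) =
        algebraMap D D' (algebraMap Ω D α * algebraMap S D g) := by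
      have hu' : IsUnit (algebraMap D D' (algebraMap S D g) ^ N) :=
        (IsLocalization.Away.algebraMap_isUnit (algebraMap S D g)).pow N
      rw [← hu'.mul_right_inj, ← map_pow, ← map_pow, ← map_mul, ← map_mul, hN, ← map_mul,
        map_mul (algebraMap S D)]
      ring_nf
    have hD' : IsFieldPushout R Sg Ω D' := hD.localization (D' := D') g hf
    have hα' : eval₂ (algebraMap R Ω) α m = 0 := hα
    let : Algebra R₁ Ω := (AdjoinRoot.lift (algebraMap R Ω) α hα').toAlgebra
    have hR₁Ω : algebraMap R₁ Ω (AdjoinRoot.root m) = α := AdjoinRoot.lift_root hα'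
    have : IsScalarTower R R₁ Ω := .of_algebraMap_eq fun y ↦ (AdjoinRoot.lift_of hα').symm
    have hD₁ : IsFieldPushout R₁ Sg Ω D' := by
      refine hD'.of_tower (AdjoinRoot.ringHom_ext ?_ ?_)
      · have := hD'.comm
        rwa [IsScalarTower.algebraMap_eq R R₁ Ω, IsScalarTower.algebraMap_eq R R₁ Sg,
          ← RingHom.comp_assoc, ← RingHom.comp_assoc] at this
      · rw [RingHom.comp_apply, RingHom.comp_apply, hR₁S, hR₁Ω, map_mul, hf, hαa, map_mul,
          mul_assoc, ← hf g, ← map_mul, hw,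
          map_one, mul_one, ← IsScalarTower.algebraMap_apply]
    have hr₁Ω : algebraMap R₁ Ω r₁ ≠ 0 := by
      intro h0
      obtain ⟨b, hb⟩ := hr₁r
      apply hrΩ
      rw [IsScalarTower.algebraMap_apply R R₁ Ω, hb, map_mul, h0, zero_mul]
    have hirr := H Ω D' hD₁ hr₁Ω
    rw [map_mul]
    refine IsIrreducibleAway.of_localization (C' := D') (algebraMap S D g) ?_
    rw [← hf, ← hs, map_mul, mul_comm]
    refine hirr.of_isUnit_mul ?_
    rw [map_pow, hf]
    exact (IsLocalization.Away.algebraMap_isUnit _).pow n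

open TensorProduct

lemma IsIrreducibleAway.localization {C C' : Type*} [CommRing C] [CommRing C'] [Algebra C C']
    (g : C) [IsLocalization.Away g C'] (hg : ¬ IsNilpotent g) (hC : IsIrreducibleAway (1 : C)) :
    IsIrreducibleAway (1 : C') := by
  have key := isNilpotent_algebraMap_iff_of_away (C' := C') g
  have hu : IsUnit (algebraMap C C' g) := IsLocalization.Away.algebraMap_isUnit g
  refine ⟨fun h ↦ hg ?_, fun a b hab ↦ ?_⟩
  · rw [← map_one (algebraMap C C'), key, mul_one] at h
    exact h
  · rw [one_mul] at hab ⊢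
    rw [one_mul]
    obtain ⟨n, x, hx⟩ := IsLocalization.Away.surj g a
    obtain ⟨m, y, hy⟩ := IsLocalization.Away.surj g b
    have hxy : IsNilpotent (g * (x * y)) := by
      rw [← key, map_mul, ← hx, ← hy, mul_mul_mul_comm]
      exact (Commute.all _ _).isNilpotent_mul_right hab
    have := hC.2 (g * x) (g * y)
    simp only [one_mul, ← key] at this
    have h0 := this (by
      rw [mul_mul_mul_comm, mul_assoc]
      exact (Commute.all _ _).isNilpotent_mul_left hxy)
    rw [← hx, ← hy] at h0
    have hn {z : C'} {n : ℕ} (h : IsNilpotent (z * algebraMap C C' g ^ n)) : IsNilpotent z := by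
      rw [mul_comm] at h
      exact ((hu.pow n).isNilpotent_unit_mul_of_commute_iff (Commute.all _ _)).mp h
    exact h0.imp hn hn

/-- Let `R ⊆ S` be domains, with `S` of finite type over `R` and integrally closed at `e`. If a
fibre of `S` over a general point of `Spec R` is irreducible and there is a geometrically
irreducible scheme `Spec B` over the fibre that meets a certain neighbourhood `D(g)` of `e`, then
the fibre is geometrically irreducible on a dense open subset: the point of the Stein factorization
hit by `Spec B` is rational, and the irreducible fibre lies over this point. -/
theorem exists_forall_isIrreducibleAway_of_geometricallyIrreducible (R S : Type u) [CommRing R]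
    [IsDomain R] [CommRing S] [IsDomain S] [Algebra R S] [FaithfulSMul R S]
    [Algebra.FiniteType R S] (e : Ideal S) [e.IsPrime]
    [IsIntegrallyClosed (Localization.AtPrime e)] :
    ∃ g : S, g ∉ e ∧ ∃ s : S, s ≠ 0 ∧ ∃ r : R, r ≠ 0 ∧
      ∀ (k D B : Type u) [Field k] [CommRing D] [CommRing B] [Algebra R k] [Algebra k D]
        [Algebra S D] [Algebra k B], IsFieldPushout R S k D → algebraMap R k r ≠ 0 →
        IsIrreducibleAway (1 : D) →
        (∀ (Ω : Type u) [Field Ω] [Algebra k Ω], IsIrreducibleAway (1 : Ω ⊗[k] B)) →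
        ∀ δ : D →ₐ[k] B, IsUnit (δ (algebraMap S D g)) →
        ∀ (Ω E : Type u) [Field Ω] [CommRing E] [Algebra k Ω] [Algebra Ω E] [Algebra D E],
        IsFieldPushout k D Ω E → IsIrreducibleAway (algebraMap D E (algebraMap S D s)) := by
  obtain ⟨m, a, g, hm, hg, ⟨c, hc, u, v, huv⟩, hroot, r, hr, s, hs, H⟩ :=
    exists_monic_forall_isIrreducibleAway R S e
  refine ⟨g, hg, s, hs, c * r, mul_ne_zero hc hr,
    fun k D B _ _ _ _ _ _ _ hD hrk hDirr hB δ hδ Ω E _ _ _ _ _ hE ↦ ?_⟩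
  rw [map_mul] at hrk
  let q : k[X] := m.map (algebraMap R k)
  have hq : q.Separable := by
    have h1 : IsUnit (C (algebraMap R k c)) := (left_ne_zero_of_mul hrk).isUnit.map C
    have h2 := congrArg (Polynomial.map (algebraMap R k)) huv
    rw [Polynomial.map_add, Polynomial.map_mul, Polynomial.map_mul, map_C, ← derivative_map] at h2
    obtain ⟨w, hw⟩ := h1.exists_left_inv
    refine ⟨w * u.map (algebraMap R k), w * v.map (algebraMap R k), ?_⟩
    rw [← hw, ← h2]
    ring
  -- The root `a / g` in any `k`-algebra over `D` in which `g` is invertible.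
  have hqroot {T : Type u} [CommRing T] [Algebra k T] (f : D →ₐ[k] T) {x : T}
      (hx : f (algebraMap S D a) = f (algebraMap S D g) * x)
      (hu : IsUnit (f (algebraMap S D g))) : aeval x q = 0 := by
    let f' : S →+* T := f.toRingHom.comp (algebraMap S D)
    have hf' : f'.comp (algebraMap R S) = (algebraMap k T).comp (algebraMap R k) := by
      have := hD.comm
      rw [RingHom.comp_assoc, ← this, ← RingHom.comp_assoc]
      congr 1
      exact f.comp_algebraMap
    have h1 := congrArg f' hroot
    have hu' : IsUnit (f' g ^ (m.map (algebraMap R S)).natDegree) := hu.pow _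
    rw [map_zero, ← Polynomial.eval₂_at_apply, show f' a = f' g * x from hx, scaleRoots_eval₂_mul,
      hu'.mul_right_eq_zero, eval₂_map, hf'] at h1
    rw [aeval_def, eval₂_map]
    exact h1
  obtain ⟨w, hw⟩ := hδ.exists_right_inv
  let b : B := δ (algebraMap S D a) * w
  have hb : δ (algebraMap S D a) = δ (algebraMap S D g) * b := by
    rw [mul_left_comm, hw, mul_one]
  obtain ⟨α, hα⟩ := mem_range_algebraMap_of_geometricallyIrreducible hB hq (hqroot δ hb hδ)
  have hBn : Nontrivial B := by
    by_contra h
    rw [not_nontrivial_iff_subsingleton] at h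
    exact (hB k).1 ⟨1, Subsingleton.elim _ _⟩
  have hinj := (algebraMap k B).injective
  have hqα : q.IsRoot α := by
    apply hinj
    rw [map_zero, ← hqroot δ hb hδ, ← hα, aeval_algebraMap_apply_eq_algebraMap_eval]
  obtain ⟨n, hn⟩ := dvd_iff_isRoot.mpr hqα
  have hco : IsCoprime (X - C α) n := (hn ▸ hq).isCoprime
  let D' := Localization.Away (algebraMap S D g)
  have hu : IsUnit (algebraMap D D' (algebraMap S D g)) := IsLocalization.Away.algebraMap_isUnit _
  have hgnil : ¬ IsNilpotent (algebraMap S D g) := fun h ↦ by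
    obtain ⟨n, hn⟩ := h.map δ
    exact (hδ.pow n).ne_zero hn
  have hD' : IsIrreducibleAway (1 : D') := hDirr.localization (algebraMap S D g) hgnil
  obtain ⟨w', hw'⟩ := hu.exists_right_inv
  let l : D' := algebraMap D D' (algebraMap S D a) * w'
  have hl : algebraMap D D' (algebraMap S D a) = algebraMap D D' (algebraMap S D g) * l := by
    rw [mul_left_comm, hw', mul_one]
  have hql : aeval l q = 0 := hqroot (IsScalarTower.toAlgHom k D D') hl hu
  rw [hn, map_mul] at hql
  have hlα : l = algebraMap k D' α := by
    rcases eq_zero_or_eq_zero_of_isIrreducibleAway hD' hql (hco.map (aeval l).toRingHom) with h | h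
    · rw [map_sub, aeval_X, aeval_C, sub_eq_zero] at h
      exact h
    · exfalso
      let δ' : D' →+* B := IsLocalization.Away.lift (algebraMap S D g) (g := δ.toRingHom) hδ
      have hδ' (x : D) : δ' (algebraMap D D' x) = δ x := IsLocalization.Away.lift_eq _ _ x
      have hδk : δ'.comp (algebraMap k D') = algebraMap k B := by
        ext x
        rw [RingHom.comp_apply, IsScalarTower.algebraMap_apply k D D', hδ', AlgHom.commutes]
      have hδl : δ' l = b := by
        have := congrArg δ' hl
        rw [map_mul, hδ', hδ', hb] at this
        exact (hδ.mul_right_inj.mp this).symm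
      have h1 := congrArg δ' h
      rw [aeval_def, Polynomial.hom_eval₂, hδk, hδl, ← hα, map_zero, eval₂_at_apply,
        map_eq_zero_iff _ hinj] at h1
      obtain ⟨x, y, hxy⟩ := hco
      have := congrArg (eval α) hxy
      simp [h1] at this
  obtain ⟨N, hN⟩ : ∃ N : ℕ, algebraMap S D (g ^ N * a) =
      algebraMap k D α * algebraMap S D (g ^ N * g) := by
    have h1 : algebraMap D D' (algebraMap S D a) =
        algebraMap D D' (algebraMap k D α * algebraMap S D g) := by
      rw [hl, hlα, map_mul, mul_comm, ← IsScalarTower.algebraMap_apply k D D']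
    obtain ⟨⟨_, N, rfl⟩, hN⟩ := (IsLocalization.eq_iff_exists (.powers (algebraMap S D g)) D').mp h1
    refine ⟨N, ?_⟩
    simp only at hN
    rw [map_mul, map_pow, hN, map_mul, map_pow]
    ring
  let : Algebra R Ω := ((algebraMap k Ω).comp (algebraMap R k)).toAlgebra
  have : IsScalarTower R k Ω := .of_algebraMap_eq fun _ ↦ rfl
  let : Algebra S E := ((algebraMap D E).comp (algebraMap S D)).toAlgebra
  have : IsScalarTower S D E := .of_algebraMap_eq fun _ ↦ rfl
  refine H Ω E (hD.trans hE) (algebraMap k Ω α) ?_ ⟨N, ?_⟩ ?_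
  · rw [aeval_algebraMap_apply, ← aeval_map_algebraMap k, show aeval α q = 0 from ?_, map_zero]
    rw [coe_aeval_eq_eval]
    exact hqα
  · have := congrArg (algebraMap D E) hN
    rw [map_mul (algebraMap D E)] at this
    rw [IsScalarTower.algebraMap_apply S D E, this, IsScalarTower.algebraMap_apply S D E]
    congr 1
    exact congr($hE.comm α).symm
  · rw [IsScalarTower.algebraMap_apply R k Ω]
    exact (_root_.map_ne_zero _).mpr (right_ne_zero_of_mul hrk)

end Affine

/-! ### Smooth algebras over a field are normal -/

section SmoothNormal
open TensorProduct

/-- A local ring that is integrally closed in a reduced Artinian localization is an integrally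
closed domain: idempotents of the localization are integral, hence trivial. -/
lemma isIntegrallyClosed_of_isArtinianRing {O B : Type*} [CommRing O] [IsLocalRing O] [CommRing B]
    [Algebra O B] (hinj : Function.Injective (algebraMap O B)) (M : Submonoid O) [IsLocalization M
        B] [IsArtinianRing B]
    [IsReduced B] (h : ∀ x : B, IsIntegral O x → ∃ y, algebraMap O B y = x) :
    IsDomain O ∧ IsIntegrallyClosed O := by
  have : Nontrivial B := hinj.nontrivial
  let e := IsArtinianRing.equivPi B
  have hloc : IsLocalRing B := by
    classical
    refine .of_unique_max_ideal ?_
    obtain ⟨m, hm⟩ := Ideal.exists_maximal B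
    refine ⟨m, hm, fun m' hm' ↦ ?_⟩
    by_contra hne
    let I : MaximalSpectrum B := ⟨m, hm⟩
    let I' : MaximalSpectrum B := ⟨m', hm'⟩
    have hII' : I' ≠ I := fun h ↦ hne (congrArg MaximalSpectrum.asIdeal h)
    let ε : B := e.symm (Pi.single I 1)
    have hε : e ε = Pi.single I 1 := e.apply_symm_apply _
    have hidem : ε * ε = ε := by
      apply e.injective
      rw [map_mul, hε, ← Pi.single_mul, one_mul]
    obtain ⟨y, hy⟩ := h ε ⟨Polynomial.X ^ 2 - Polynomial.X,
      Polynomial.monic_X_pow_sub (by simp [Polynomial.degree_X]), by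
        simp [pow_two, hidem]⟩
    have hyy : y * (1 - y) = 0 := by
      apply hinj
      rw [map_mul, map_sub, hy, map_one, mul_sub, mul_one, hidem, sub_self, map_zero]
    rcases IsLocalRing.isUnit_or_isUnit_of_add_one (add_sub_cancel y 1) with hu | hu
    · have h1 : 1 - y = 0 := (hu.mul_right_eq_zero).mp hyy
      have h2 : ε = 1 := by rw [← hy, ← sub_eq_zero.mp h1, map_one]
      have h3 := congrFun hε I'
      rw [h2, map_one, Pi.single_eq_of_ne hII'] at h3
      have := Ideal.Quotient.nontrivial_iff.mpr hm'.ne_top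
      exact one_ne_zero h3
    · have h1 : y = 0 := (hu.mul_left_eq_zero).mp hyy
      have h2 : ε = 0 := by rw [← hy, h1, map_zero]
      have h3 := congrFun hε I
      rw [h2, map_zero, Pi.single_eq_same] at h3
      have := Ideal.Quotient.nontrivial_iff.mpr hm.ne_top
      exact one_ne_zero h3.symm
  let := (IsArtinianRing.isField_of_isReduced_of_isLocalRing B).toField
  have hdom : IsDomain O := hinj.isDomain
  have : FaithfulSMul O B := (faithfulSMul_iff_algebraMap_injective O B).mpr hinj
  have : IsFractionRing O B := by
    refine IsFractionRing.of_field O B fun z ↦ ?_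
    obtain ⟨⟨x, s⟩, hx⟩ := IsLocalization.surj M z
    exact ⟨x, s, by rw [eq_div_iff (IsLocalization.map_units B s).ne_zero, hx]⟩
  exact ⟨hdom, (isIntegrallyClosed_iff B).mpr fun {x} hx ↦ h x hx⟩

/-- The local rings of a smooth algebra over a field are integrally closed domains. -/
theorem isIntegrallyClosed_localization_of_smooth (K S : Type u) [Field K] [CommRing S]
    [Algebra K S] [Algebra.Smooth K S] (e : Ideal S) [e.IsPrime] :
    IsDomain (Localization.AtPrime e) ∧ IsIntegrallyClosed (Localization.AtPrime e) := by
  obtain ⟨f, hf, n, _, _, _⟩ :=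
    Algebra.IsSmoothAt.exists_isStandardEtale_mvPolynomial (R := K) (p := e)
  let A := MvPolynomial (Fin n) K
  let Q := Localization.Away f
  have hdisj : Disjoint (Submonoid.powers f : Set S) e := by
    rw [Ideal.disjoint_powers_iff_notMem _ (Ideal.IsPrime.isRadical ‹_›)]
    exact hf
  let e' : Ideal Q := e.map (algebraMap S Q)
  have he' : e'.IsPrime := IsLocalization.isPrime_of_isPrime_disjoint (.powers f) Q e ‹_› hdisj
  have hcomap : e'.comap (algebraMap S Q) = e :=
    IsLocalization.under_map_of_isPrime_disjoint (.powers f) Q ‹_› hdisj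
  let O := Localization.AtPrime e'
  have hO : IsLocalization.AtPrime O e := by
    have := IsLocalization.isLocalization_isLocalization_atPrime_isLocalization (.powers f) O e'
    simp only [hcomap] at this
    exact this
  let k := FractionRing A
  have : IsIntegrallyClosed A := UniqueFactorizationMonoid.instIsIntegrallyClosed
  have : Module.Flat Q O := IsLocalization.flat O e'.primeCompl
  have : Module.Flat A O := .trans A Q O
  have : Algebra.FormallyUnramified Q O := .of_isLocalization e'.primeCompl
  have : Algebra.FormallyUnramified A O := .comp A Q O
  have : Algebra.EssFiniteType Q O := .of_isLocalization O e'.primeCompl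
  have : Algebra.EssFiniteType A O := .comp A Q O
  have : Module.Free k (k ⊗[A] O) := Module.Free.of_divisionRing k _
  have : Algebra.EssFiniteType k (k ⊗[A] O) := .baseChange A O k
  have : Algebra.FormallyUnramified k (k ⊗[A] O) := .base_change k
  have : Module.Finite k (k ⊗[A] O) := Algebra.FormallyUnramified.finite_of_free k _
  have hart : IsArtinianRing (k ⊗[A] O) := isArtinian_of_tower k inferInstance
  have hred : IsReduced (k ⊗[A] O) := Algebra.FormallyUnramified.isReduced_of_field k _
  let B := O ⊗[A] k
  let c : k ⊗[A] O ≃ₐ[A] B := Algebra.TensorProduct.comm A k O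
  have : IsArtinianRing B := c.toRingEquiv.surjective.isArtinianRing
  have : IsReduced B := isReduced_of_injective c.symm c.symm.injective
  have : IsLocalization (Algebra.algebraMapSubmonoid O (nonZeroDivisors A)) B := inferInstance
  have hinj : Function.Injective (algebraMap O B) :=
    Algebra.TensorProduct.includeLeft_injective (S := A) (IsFractionRing.injective A k)
  have hbij : Function.Bijective (TensorProduct.toIntegralClosure A O k) :=
    TensorProduct.toIntegralClosure_bijective_of_tower (S := Q)
      TensorProduct.toIntegralClosure_bijective_of_smooth
      (TensorProduct.toIntegralClosure_bijective_of_isLocalization e'.primeCompl)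
  have key := isIntegrallyClosed_of_isArtinianRing (O := O) (B := B) hinj
    (Algebra.algebraMapSubmonoid O (nonZeroDivisors A)) (fun x hx ↦ by
      obtain ⟨z, hz⟩ := hbij.2 ⟨x, hx⟩
      replace hz : (TensorProduct.toIntegralClosure A O k z : B) = x := congrArg Subtype.val hz
      rw [← hz]
      clear hz
      induction z using TensorProduct.induction_on with
      | zero => exact ⟨0, by simp⟩
      | add a b ha hb =>
        obtain ⟨y, hy⟩ := ha
        obtain ⟨y', hy'⟩ := hb
        exact ⟨y + y', by simp [hy, hy']⟩
      | tmul o a =>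
        obtain ⟨a', ha'⟩ := IsIntegrallyClosed.isIntegral_iff.mp a.2
        refine ⟨a' • o, ?_⟩
        change (a' • o) ⊗ₜ[A] (1 : k) = o ⊗ₜ[A] (a : k)
        rw [TensorProduct.smul_tmul, ← ha', Algebra.smul_def, mul_one])
  let φ : Localization.AtPrime e ≃ₐ[S] O := IsLocalization.algEquiv e.primeCompl _ _
  have := key.1
  have := key.2
  exact ⟨φ.toRingEquiv.toMulEquiv.isDomain O, .of_equiv φ.symm.toRingEquiv⟩

end SmoothNormal

/-! ### Smoothness at the generic points of geometrically reduced fibres -/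

section GenericSmooth
open TensorProduct

/-- A finitely generated geometrically reduced field extension is separably generated, hence
formally smooth. -/
lemma formallySmooth_of_isReduced_tensorProduct_algebraicClosure (k L : Type u) [Field k] [Field L]
    [Algebra k L] [Algebra.EssFiniteType k L] [IsReduced (AlgebraicClosure k ⊗[k] L)] :
    Algebra.FormallySmooth k L := by
  obtain ⟨p, hp⟩ := CharP.exists k
  obtain hp0 | rfl := CharP.char_is_prime_or_zero k p
  swap
  · have := CharP.charP_to_charZero k
    infer_instance
  have : Fact p.Prime := ⟨hp0⟩
  let κ := AlgebraicClosure k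
  have : CharP κ p := charP_of_injective_algebraMap (algebraMap k κ).injective p
  have : CharP (κ ⊗[k] L) p :=
    charP_of_injective_algebraMap (algebraMap k (κ ⊗[k] L)).injective p
  obtain ⟨s, hs, H⟩ :=
    exists_isTranscendenceBasis_and_isSeparable_of_linearIndepOn_pow_of_essFiniteType
      (k := k) (K := L) p hp0 (fun s hs ↦ by
        have hli : LinearIndependent κ fun x : (s : Set L) ↦ (1 : κ) ⊗ₜ[k] (x : L) :=
          Module.Flat.linearIndependent_one_tmul hs
        refine Fintype.linearIndependent_iff.mpr fun a ha ↦ ?_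
        choose b hb using fun x : (s : Set L) ↦
          IsAlgClosed.exists_pow_nat_eq (algebraMap k κ (a x)) hp0.pos
        have h0 : (∑ x : (s : Set L), b x • (1 : κ) ⊗ₜ[k] (x : L)) ^ p = 0 := by
          rw [sum_pow_char]
          calc ∑ x : (s : Set L), (b x • (1 : κ) ⊗ₜ[k] (x : L)) ^ p
              = ∑ x : (s : Set L), (1 : κ) ⊗ₜ[k] (a x • (x : L) ^ p) := by
                refine Finset.sum_congr rfl fun x _ ↦ ?_
                rw [TensorProduct.smul_tmul', Algebra.TensorProduct.tmul_pow, smul_eq_mul, mul_one,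
                  hb, Algebra.algebraMap_eq_smul_one, TensorProduct.smul_tmul]
            _ = 0 := by
                rw [← TensorProduct.tmul_sum]
                exact (congrArg _ ha).trans (TensorProduct.tmul_zero _ _)
        have h1 := Fintype.linearIndependent_iff.mp hli b (pow_eq_zero_iff hp0.ne_zero |>.mp h0)
        intro x
        have := hb x
        rw [h1 x, zero_pow hp0.ne_zero] at this
        exact (map_eq_zero (algebraMap k κ)).mp this.symm)
  have : Algebra.IsSeparable (IntermediateField.adjoin k (Set.range ((↑) : s → L))) L := by
    convert! H <;> simp
  exact .of_algebraicIndependent_of_isSeparable hs.1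


/-- A flat finitely presented algebra is smooth at a generic point of a geometrically reduced
fibre. -/
theorem isSmoothAt_of_isReduced_fiber (R S : Type u) [CommRing R] [CommRing S] [Algebra R S]
    [Module.Flat R S] [Algebra.FinitePresentation R S] (p : Ideal R) (q : Ideal S)
    [p.IsPrime] [q.IsPrime] [q.LiesOver p]
    [IsReduced (AlgebraicClosure p.ResidueField ⊗[R] S)]
    (hq : ∀ q' : Ideal S, q'.IsPrime → q' ≤ q → q'.comap (algebraMap R S) = p → q' = q) :
    Algebra.IsSmoothAt R q := by
  let Rp := Localization.AtPrime p
  let Sp := Localization (Algebra.algebraMapSubmonoid S p.primeCompl)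
  let Sq := Localization.AtPrime q
  let := Localization.AtPrime.algebraOfLiesOver p q
  let f : Sp →ₐ[S] Sq := IsLocalization.liftAlgHom (M := Algebra.algebraMapSubmonoid S p.primeCompl)
        (f := Algebra.ofId _ _) (by
      rintro ⟨_, x, hx, rfl⟩
      simpa using! IsLocalization.map_units (M := q.primeCompl) Sq ⟨algebraMap _ _ x,
        by simp_all [q.over_def p]⟩)
  algebraize [f.toRingHom]
  have : IsScalarTower R Sp Sq := .to₁₃₄ _ S _ _
  have : IsScalarTower Rp Sp Sq := .of_algebraMap_eq' <| by
    apply IsLocalization.ringHom_ext p.primeCompl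
    simp only [RingHom.comp_assoc, ← IsScalarTower.algebraMap_eq]
  have : IsLocalization (Algebra.algebraMapSubmonoid Sp q.primeCompl) Sq :=
    .isLocalization_of_submonoid_le _ _ (Algebra.algebraMapSubmonoid S p.primeCompl) _
    (by rintro _ ⟨x, hx, rfl⟩; simp_all [q.over_def p])
  have : Algebra.FinitePresentation Rp Sp := by
    have : Algebra.IsPushout R Rp S Sp :=
      .symm <| Algebra.isPushout_of_isLocalization p.primeCompl _ _ _
    exact .equiv (Algebra.IsPushout.equiv R Rp S Sp)
  let κ := p.ResidueField
  let L := κ ⊗[Rp] Sq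
  let Ω := AlgebraicClosure κ
  have hred : IsReduced (Ω ⊗[κ] L) := by
    have : IsReduced (S ⊗[R] Ω) :=
      isReduced_of_injective (Algebra.TensorProduct.comm R S Ω) (AlgEquiv.injective _)
    have h1 : IsReduced (Sq ⊗[S] (S ⊗[R] Ω)) := by
      have : IsLocalization (Algebra.algebraMapSubmonoid (S ⊗[R] Ω) q.primeCompl)
          ((S ⊗[R] Ω) ⊗[S] Sq) := inferInstance
      have : IsReduced ((S ⊗[R] Ω) ⊗[S] Sq) :=
        isReduced_localizationPreserves (Algebra.algebraMapSubmonoid (S ⊗[R] Ω) q.primeCompl) _ ‹_›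
      exact isReduced_of_injective (Algebra.TensorProduct.comm S Sq (S ⊗[R] Ω))
        (AlgEquiv.injective _)
    let e1 : Sq ⊗[S] (S ⊗[R] Ω) ≃ₐ[Sq] Sq ⊗[R] Ω := Algebra.TensorProduct.cancelBaseChange R S Sq
        Sq Ω
    let e2 : Ω ⊗[κ] L ≃ₐ[Ω] Ω ⊗[Rp] Sq := Algebra.TensorProduct.cancelBaseChange Rp κ Ω Ω Sq
    let e3 : Ω ⊗[R] Sq ≃+* Ω ⊗[Rp] Sq :=
      (Algebra.TensorProduct.equivOfCompatibleSMul R Rp Rp Ω Sq).symm.toRingEquiv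
    have h2 : IsReduced (Sq ⊗[R] Ω) := isReduced_of_injective e1.symm e1.symm.injective
    have h3 : IsReduced (Ω ⊗[R] Sq) :=
      isReduced_of_injective (Algebra.TensorProduct.comm R Ω Sq) (AlgEquiv.injective _)
    have h4 : IsReduced (Ω ⊗[Rp] Sq) := isReduced_of_injective e3.symm e3.symm.injective
    exact isReduced_of_injective e2 e2.injective
  have : IsReduced L := isReduced_of_injective
    (Algebra.TensorProduct.includeRight : L →ₐ[κ] Ω ⊗[κ] L)
    (Algebra.TensorProduct.includeRight_injective (RingHom.injective _))
  have hL : IsField L := by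
    rw [← PrimeSpectrum.subsingleton_iff_isField_of_isReduced]
    let i : Sq →+* L := (Algebra.TensorProduct.includeRight : Sq →ₐ[Rp] L).toRingHom
    have hi : Function.Surjective i := by
      intro x
      induction x using TensorProduct.induction_on with
      | zero => exact ⟨0, map_zero _⟩
      | add a b ha hb =>
        obtain ⟨y, rfl⟩ := ha
        obtain ⟨z, rfl⟩ := hb
        exact ⟨y + z, map_add _ _ _⟩
      | tmul a b =>
        obtain ⟨a, rfl⟩ := IsLocalRing.residue_surjective a
        refine ⟨a • b, ?_⟩
        change (1 : κ) ⊗ₜ[Rp] (a • b) = _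
        rw [← TensorProduct.smul_tmul]
        congr 1
        exact (Algebra.algebraMap_eq_smul_one a).symm
    have key (P : PrimeSpectrum L) :
        PrimeSpectrum.comap (algebraMap S Sq) (PrimeSpectrum.comap i P) = ⟨q, ‹_›⟩ := by
      ext1
      refine hq _ inferInstance ?_ ?_
      · exact (IsLocalization.AtPrime.orderIsoOfPrime Sq q
          ⟨(PrimeSpectrum.comap i P).asIdeal, inferInstance⟩).2.2
      · have hcomp : (i.comp (algebraMap S Sq)).comp (algebraMap R S) =
            (algebraMap κ L).comp (algebraMap R κ) := by
          ext r
          change i (algebraMap S Sq (algebraMap R S r)) = algebraMap κ L (algebraMap R κ r)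
          rw [← IsScalarTower.algebraMap_apply R S Sq, IsScalarTower.algebraMap_apply R Rp Sq,
            IsScalarTower.algebraMap_apply R Rp κ]
          exact (Algebra.TensorProduct.includeRight.commutes (algebraMap R Rp r)).trans
            (IsScalarTower.algebraMap_apply Rp κ L _)
        change (P.asIdeal.comap i |>.comap (algebraMap S Sq)).comap (algebraMap R S) = p
        rw [Ideal.comap_comap, Ideal.comap_comap, ← RingHom.comp_assoc, hcomp, ← Ideal.comap_comap,
          Ideal.eq_bot_of_prime (Ideal.comap (algebraMap κ L) P.asIdeal), ←
              RingHom.ker_eq_comap_bot,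
          Ideal.ker_algebraMap_residueField]
    refine ⟨fun P P' ↦ PrimeSpectrum.comap_injective_of_surjective i hi ?_⟩
    exact PrimeSpectrum.localization_comap_injective Sq q.primeCompl ((key P).trans (key P').symm)
  have : Algebra.FormallySmooth (IsLocalRing.ResidueField Rp)
      (IsLocalRing.ResidueField Rp ⊗[Rp] Sq) := by
    let := hL.toField
    have : Algebra.EssFiniteType Sp Sq :=
      .of_isLocalization Sq (Algebra.algebraMapSubmonoid Sp q.primeCompl)
    have : Algebra.EssFiniteType Rp Sq := .comp Rp Sp Sq
    have : Algebra.EssFiniteType κ L := .baseChange Rp Sq κ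
    exact formallySmooth_of_isReduced_tensorProduct_algebraicClosure κ L
  have := Algebra.FormallySmooth.of_formallySmooth_residueField_tensor
    (R := Rp) (S := Sq) (P := Sp) (Algebra.algebraMapSubmonoid _ q.primeCompl)
  exact .comp R Rp Sq

end GenericSmooth

section GenericSmoothScheme
open TensorProduct

/-- A flat morphism locally of finite presentation is smooth at the generic points of its
geometrically reduced fibres. -/
theorem mem_smoothLocus_of_forall_specializes {C U : Scheme.{u}} (π : C ⟶ U) [Flat π]
    [LocallyOfFinitePresentation π] [GeometricallyReduced π] (c : C)
    (hc : ∀ c' : C, c' ⤳ c → π c' = π c → c' = c) : c ∈ π.smoothLocus := by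
  obtain ⟨_, ⟨U', (hU : IsAffineOpen U'), rfl⟩, hxU, -⟩ :=
    U.isBasis_affineOpens.exists_subset_of_mem_open (Set.mem_univ (π c)) isOpen_univ
  obtain ⟨_, ⟨V, (hV : IsAffineOpen V), rfl⟩, hxV, (hVU : V ≤ π ⁻¹ᵁ U')⟩ :=
    C.isBasis_affineOpens.exists_subset_of_mem_open hxU (U'.2.preimage π.continuous)
  rw [Scheme.Hom.mem_smoothLocus, formallySmooth_stalkMap_iff U' hU V hV hVU hxV]
  let := (π.appLE U' V hVU).hom.toAlgebra
  have : Algebra.FinitePresentation Γ(U, U') Γ(C, V) := π.finitePresentation_appLE hU hV hVU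
  have : Module.Flat Γ(U, U') Γ(C, V) := π.flat_appLE hU hV hVU
  let p := (hU.primeIdealOf ⟨π c, hVU hxV⟩).asIdeal
  let q := (hV.primeIdealOf ⟨c, hxV⟩).asIdeal
  have : q.LiesOver p :=
    ⟨congr($(IsAffineOpen.comap_primeIdealOf_appLE U' hU V hV hVU hxV).1).symm⟩
  have hsq : Spec.map (π.appLE U' V hVU) ≫ hU.fromSpec = hV.fromSpec ≫ π :=
    hU.SpecMap_appLE_fromSpec π hV hVU
  let Ω := AlgebraicClosure p.ResidueField
  have : IsReduced (Ω ⊗[Γ(U, U')] Γ(C, V)) := by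
    let y : Spec (.of Ω) ⟶ Spec Γ(U, U') := Spec.map (CommRingCat.ofHom (algebraMap Γ(U, U') Ω))
    let m := pullback.map y (Spec.map (π.appLE U' V hVU)) (y ≫ hU.fromSpec) π (𝟙 _) hV.fromSpec
      hU.fromSpec (by simp) hsq
    have h1 : AlgebraicGeometry.IsReduced (pullback (y ≫ hU.fromSpec) π) :=
      pullback_of_geometrically' GeometricallyReduced.geometrically_isReduced Ω _
    have h2 := isReduced_of_isOpenImmersion m
    have h3 := isReduced_of_isOpenImmersion (pullbackSpecIso Γ(U, U') Ω Γ(C, V)).inv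
    exact (affine_isReduced_iff _).mp h3
  refine isSmoothAt_of_isReduced_fiber _ _ p q fun q' hq' hle hcomap ↦ ?_
  have hc' := hc (hV.fromSpec ⟨q', hq'⟩) ?_ ?_
  · have := hV.fromSpec_primeIdealOf ⟨c, hxV⟩
    have := hV.fromSpec.isOpenEmbedding.injective (hc'.trans this.symm)
    exact congrArg PrimeSpectrum.asIdeal this
  · have h1 : (⟨q', hq'⟩ : PrimeSpectrum _) ⤳ hV.primeIdealOf ⟨c, hxV⟩ :=
      (PrimeSpectrum.le_iff_specializes _ _).mp hle
    have := h1.map hV.fromSpec.continuous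
    rwa [hV.fromSpec_primeIdealOf ⟨c, hxV⟩] at this
  · have hpt (Q : Spec Γ(C, V)) :
        π (hV.fromSpec Q) = hU.fromSpec (Spec.map (π.appLE U' V hVU) Q) := by
      rw [← Scheme.Hom.comp_apply, ← hsq, Scheme.Hom.comp_apply]
    refine (hpt _).trans ?_
    have : Spec.map (π.appLE U' V hVU) ⟨q', hq'⟩ = hU.primeIdealOf ⟨π c, hVU hxV⟩ :=
      PrimeSpectrum.ext hcomap
    rw [this]
    exact hU.fromSpec_primeIdealOf ⟨π c, hVU hxV⟩

end GenericSmoothScheme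

/-! ### Products over an algebraically closed field -/

section ProductsOverAlgClosed
open TensorProduct

/-- On a domain of finite type over an algebraically closed field, a nonzero function is nonzero at
some rational point. -/
lemma exists_algHom_apply_ne_zero (K : Type*) {A : Type*} [Field K] [IsAlgClosed K] [CommRing A]
    [IsDomain A] [Algebra K A] [Algebra.FiniteType K A] {a : A} (ha : a ≠ 0) :
    ∃ f : A →ₐ[K] K, f a ≠ 0 := by
  have : Nontrivial (Localization.Away a) :=
    (IsLocalization.injective (Localization.Away a)
      (powers_le_nonZeroDivisors_of_noZeroDivisors ha)).nontrivial
  obtain ⟨m, hm⟩ := Ideal.exists_maximal (Localization.Away a)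
  have : Algebra.FiniteType A (Localization.Away a) := IsLocalization.finiteType_of_monoid_fg
      (.powers a) _
  have : Algebra.FiniteType K (Localization.Away a) := .trans (S := A) inferInstance inferInstance
  let := Ideal.Quotient.field m
  have : Module.Finite K (Localization.Away a ⧸ m) := finite_of_finite_type_of_isJacobsonRing K _
  let f : (Localization.Away a ⧸ m) →ₐ[K] K := IsAlgClosed.lift
  refine ⟨(f.comp (Ideal.Quotient.mkₐ K m)).comp (IsScalarTower.toAlgHom K A _), ?_⟩
  exact ((IsLocalization.Away.algebraMap_isUnit (S := Localization.Away a) a).map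
    (f.comp (Ideal.Quotient.mkₐ K m))).ne_zero

/-- The tensor product of two domains over an algebraically closed field is a domain, if one of
them is of finite type. -/
theorem isDomain_tensorProduct_of_isAlgClosed (K : Type*) (A B : Type*) [Field K] [IsAlgClosed K]
    [CommRing A] [IsDomain A] [Algebra K A] [Algebra.FiniteType K A] [CommRing B] [IsDomain B]
    [Algebra K B] : IsDomain (A ⊗[K] B) := by
  let b := Module.Free.chooseBasis K B
  have key (f : A →ₐ[K] K) (x : A ⊗[K] B) (i) :
      (Algebra.TensorProduct.basis K b).repr (Algebra.TensorProduct.map f (.id K B) x) i =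
        f ((Algebra.TensorProduct.basis A b).repr x i) := by
    induction x using TensorProduct.induction_on with
    | zero => simp
    | add x y hx hy => simp [hx, hy]
    | tmul x y => simp [Algebra.TensorProduct.basis_repr_tmul]
  have : Nontrivial (A ⊗[K] B) := inferInstance
  have : NoZeroDivisors (A ⊗[K] B) := by
    refine ⟨fun {x y} hxy ↦ ?_⟩
    by_contra! h
    obtain ⟨i, hi⟩ : ∃ i, (Algebra.TensorProduct.basis A b).repr x i ≠ 0 := by
      by_contra! h'
      exact h.1 ((Algebra.TensorProduct.basis A b).repr.map_eq_zero_iff.mp (Finsupp.ext h'))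
    obtain ⟨j, hj⟩ : ∃ j, (Algebra.TensorProduct.basis A b).repr y j ≠ 0 := by
      by_contra! h'
      exact h.2 ((Algebra.TensorProduct.basis A b).repr.map_eq_zero_iff.mp (Finsupp.ext h'))
    obtain ⟨f, hf⟩ := exists_algHom_apply_ne_zero K (mul_ne_zero hi hj)
    rw [map_mul] at hf
    have h0 := congrArg (Algebra.TensorProduct.map f (.id K B)) hxy
    rw [map_mul, map_zero] at h0
    have : IsDomain (K ⊗[K] B) := (Algebra.TensorProduct.lid K B).toMulEquiv.isDomain B
    rcases mul_eq_zero.mp h0 with h0 | h0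
    · have := key f x i
      rw [h0, map_zero, Finsupp.zero_apply] at this
      exact left_ne_zero_of_mul hf this.symm
    · have := key f y j
      rw [h0, map_zero, Finsupp.zero_apply] at this
      exact right_ne_zero_of_mul hf this.symm
  exact NoZeroDivisors.to_isDomain _

end ProductsOverAlgClosed

/-! ### Local rings at smooth points -/

section NormalStalk

/-- At a smooth point over a field the local ring is an integrally closed domain. -/
theorem isIntegrallyClosed_stalk_of_mem_smoothLocus {K : Type u} [Field K] {T : Scheme.{u}}
    (f : T ⟶ Spec (.of K)) [LocallyOfFinitePresentation f] (t : T) (ht : t ∈ f.smoothLocus) :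
    IsDomain (T.presheaf.stalk t) ∧ IsIntegrallyClosed (T.presheaf.stalk t) := by
  obtain ⟨_, ⟨V, (hV : IsAffineOpen V), rfl⟩, htV, (hVs : V ≤ f.smoothLocus)⟩ :=
    T.isBasis_affineOpens.exists_subset_of_mem_open ht f.smoothLocus.2
  have hsm : Smooth (hV.fromSpec ≫ f) := by
    rw [← Scheme.Hom.smoothLocus_eq_top_iff, ← Scheme.Hom.preimage_smoothLocus_eq, eq_top_iff]
    rintro x -
    exact hVs (hV.range_fromSpec.le ⟨x, rfl⟩)
  obtain ⟨φ, hφ⟩ := Spec.map_surjective (hV.fromSpec ≫ f)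
  rw [← hφ, HasRingHomProperty.Spec_iff (P := @Smooth)] at hsm
  let : Algebra K Γ(T, V) := φ.hom.toAlgebra
  have : Algebra.Smooth K Γ(T, V) := hsm
  obtain ⟨_, _⟩ :=
    isIntegrallyClosed_localization_of_smooth K Γ(T, V) (hV.primeIdealOf ⟨t, htV⟩).asIdeal
  have := hV.isLocalization_stalk ⟨t, htV⟩
  let := TopCat.Presheaf.algebra_section_stalk T.presheaf (⟨t, htV⟩ : V)
  let e : Localization.AtPrime (hV.primeIdealOf ⟨t, htV⟩).asIdeal ≃ₐ[Γ(T, V)]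
    T.presheaf.stalk t := IsLocalization.algEquiv (hV.primeIdealOf ⟨t, htV⟩).asIdeal.primeCompl _ _
  exact ⟨e.symm.toMulEquiv.isDomain _, .of_equiv e.toRingEquiv⟩

end NormalStalk

/-! ### Geometrically irreducible schemes over a field -/

section GeometricallyIrreducible
open TensorProduct

lemma isIrreducibleAway_one_iff {C : Type*} [CommRing C] :
    IsIrreducibleAway (1 : C) ↔ IrreducibleSpace (PrimeSpectrum C) := by
  rw [isIrreducibleAway_iff, PrimeSpectrum.basicOpen_one, irreducibleSpace_def]
  rfl

lemma IsIrreducibleAway.localization_self {C C' : Type*} [CommRing C] [CommRing C'] [Algebra C C']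
    {s : C} [IsLocalization.Away s C'] (hs : IsIrreducibleAway s) : IsIrreducibleAway (1 : C') := by
  rw [isIrreducibleAway_one_iff]
  have h := (PrimeSpectrum.localization_away_isOpenEmbedding C' s).isEmbedding
  rw [h.toHomeomorph.irreducibleSpace_iff, PrimeSpectrum.localization_away_comap_range C' s]
  exact Subtype.irreducibleSpace (isIrreducibleAway_iff.mp hs)

lemma geometricallyIrreducible_SpecMap_iff {k D : Type u} [Field k] [CommRing D] [Algebra k D] :
    GeometricallyIrreducible (Spec.map (CommRingCat.ofHom (algebraMap k D))) ↔
      ∀ (Ω : Type u) [Field Ω] [Algebra k Ω], IsIrreducibleAway (1 : Ω ⊗[k] D) := by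
  rw [geometricallyIrreducible_iff, geometrically_iff_of_commRing_of_isClosedUnderIsomorphisms]
  refine forall_congr' fun Ω ↦ forall_congr' fun _ ↦ forall_congr' fun _ ↦ ?_
  rw [isIrreducibleAway_one_iff]
  exact ((pullbackSymmetry _ _ ≪≫ pullbackSpecIso k Ω D).hom.homeomorph).irreducibleSpace_iff

/-- An irreducible scheme over a field is geometrically irreducible if a nonempty open subscheme
is, as base change along field extensions is open. -/
lemma geometricallyIrreducible_of_isOpenImmersion {k : Type u} [Field k] {Y Z : Scheme.{u}}
    (m : Y ⟶ Z) (f : Z ⟶ Spec (.of k)) [IsOpenImmersion m] [Nonempty Y] [IrreducibleSpace Z]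
    [GeometricallyIrreducible (m ≫ f)] : GeometricallyIrreducible f := by
  refine ⟨geometrically_iff_of_isClosedUnderIsomorphisms.mpr fun k' _ y ↦ ?_⟩
  have : IrreducibleSpace ↥(pullback (m ≫ f) y) :=
    pullback_of_geometrically GeometricallyIrreducible.geometrically_irreducibleSpace k' y
  let n : pullback (m ≫ f) y ⟶ pullback f y :=
    pullback.map _ _ _ _ m (𝟙 _) (𝟙 _) (by simp) (by simp)
  have hd : Dense (Set.range n) := by
    have : Set.range n = pullback.fst f y ⁻¹' Set.range m := by
      refine (Scheme.Pullback.range_map _ _ _ _ _ _ _ _ _).trans ?_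
      simp
    rw [this]
    exact (m.isOpenEmbedding.isOpen_range.dense (Set.range_nonempty m)).preimage
      (pullback.fst f y).isOpenMap
  have : IsIrreducible (Set.range n) := by
    rw [← Set.image_univ]
    exact (IrreducibleSpace.isIrreducible_univ _).image _ n.continuous.continuousOn
  rw [irreducibleSpace_def]
  have h := this.closure
  rwa [hd.closure_eq] at h

lemma isPullback_comp_mono {C : Type*} [Category* C] {W X Y Z Z' : C} {fst : W ⟶ X} {snd : W ⟶ Y}
    {f : X ⟶ Z} {g : Y ⟶ Z} (h : IsPullback fst snd f g) (i : Z ⟶ Z') [Mono i] :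
    IsPullback fst snd (f ≫ i) (g ≫ i) :=
  ⟨⟨by rw [← Category.assoc, h.w, Category.assoc]⟩,
    ⟨PullbackCone.isLimitOfCompMono f g i _ h.isLimit⟩⟩

end GeometricallyIrreducible

/-! ### Neighbourhoods with integral coordinate ring -/

section Shrinking

/-- A noetherian ring whose localization at a prime is a domain is a domain after inverting one
element outside the prime. -/
lemma exists_isDomain_localizationAway {S : Type*} [CommRing S] [IsNoetherianRing S] (q : Ideal S)
    [q.IsPrime] [IsDomain (Localization.AtPrime q)] :
    ∃ f ∉ q, ∀ (S' : Type*) [CommRing S'] [Algebra S S'] [IsLocalization.Away f S'],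
      IsDomain S' := by
  let I := RingHom.ker (algebraMap S (Localization.AtPrime q))
  obtain ⟨t, ht⟩ := IsNoetherian.noetherian I
  have hex (x : S) : ∃ f : S, f ∉ q ∧ (x ∈ t → f * x = 0) := by
    by_cases hx : x ∈ t
    · have : algebraMap S (Localization.AtPrime q) x = 0 := by
        rw [← RingHom.mem_ker]
        change x ∈ I
        rw [← ht]
        exact Submodule.subset_span hx
      obtain ⟨m, hm⟩ := (IsLocalization.map_eq_zero_iff q.primeCompl _ x).mp this
      exact ⟨m, m.2, fun _ ↦ hm⟩
    · exact ⟨1, (Ideal.ne_top_iff_one q).mp (Ideal.IsPrime.ne_top ‹_›), fun h ↦ (hx h).elim⟩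
  choose f hfq hf using hex
  let g := ∏ x ∈ t, f x
  have hgq : g ∉ q := by
    intro h
    obtain ⟨x, _, hx⟩ := (Ideal.IsPrime.prod_mem_iff (hp := ‹q.IsPrime›)).mp h
    exact hfq x hx
  have hgI : ∀ x ∈ I, g * x = 0 := by
    intro x hx
    rw [← ht] at hx
    induction hx using Submodule.span_induction with
    | mem x hx =>
      obtain ⟨c, hc⟩ := Finset.dvd_prod_of_mem f (show x ∈ t from hx)
      change (∏ x ∈ t, f x) * x = 0
      rw [hc, mul_right_comm, hf x hx, zero_mul]
    | zero => simp
    | add x y _ _ hx hy => rw [mul_add, hx, hy, add_zero]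
    | smul a x _ hx => rw [smul_eq_mul, mul_left_comm, hx, mul_zero]
  refine ⟨g, hgq, fun S' _ _ _ ↦ ?_⟩
  let φ : S' →+* Localization.AtPrime q := IsLocalization.Away.lift g
    (g := algebraMap S (Localization.AtPrime q))
    (IsLocalization.map_units (M := q.primeCompl) _ ⟨g, hgq⟩)
  have hinj : Function.Injective φ := by
    rw [injective_iff_map_eq_zero]
    intro z hz
    obtain ⟨n, x, hx⟩ := IsLocalization.Away.surj g z
    have hxI : x ∈ I := by
      rw [RingHom.mem_ker, ← IsLocalization.Away.lift_eq g (S := S')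
        (IsLocalization.map_units (M := q.primeCompl) (Localization.AtPrime q) ⟨g, hgq⟩) x, ← hx]
      change φ _ = 0
      rw [map_mul, hz, zero_mul]
    have hu : IsUnit (algebraMap S S' g) := IsLocalization.Away.algebraMap_isUnit g
    have h0 : algebraMap S S' g * algebraMap S S' x = 0 := by rw [← map_mul, hgI x hxI, map_zero]
    rw [hu.mul_right_eq_zero, ← hx, (hu.pow n).mul_left_eq_zero] at h0
    exact h0
  exact hinj.isDomain

lemma mem_basicOpen_iff_notMem_primeIdealOf {T : Scheme.{u}} {V : T.Opens} (hV : IsAffineOpen V)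
    {t : T} (ht : t ∈ V) (f : Γ(T, V)) :
    t ∈ T.basicOpen f ↔ f ∉ (hV.primeIdealOf ⟨t, ht⟩).asIdeal := by
  have h : hV.primeIdealOf ⟨t, ht⟩ ∈ hV.fromSpec ⁻¹ᵁ T.basicOpen f ↔
      f ∉ (hV.primeIdealOf ⟨t, ht⟩).asIdeal := by
    rw [hV.fromSpec_preimage_basicOpen]
    rfl
  rw [← h]
  change _ ↔ hV.fromSpec (hV.primeIdealOf ⟨t, ht⟩) ∈ T.basicOpen f
  rw [hV.fromSpec_primeIdealOf]

/-- On a locally noetherian scheme, a point with integral local ring has an affine open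
neighbourhood with integral coordinate ring. -/
lemma exists_isAffineOpen_isDomain {T : Scheme.{u}} [IsLocallyNoetherian T] (t : T)
    [IsDomain (T.presheaf.stalk t)] (W : T.Opens) (htW : t ∈ W) :
    ∃ V : T.Opens, IsAffineOpen V ∧ t ∈ V ∧ V ≤ W ∧ IsDomain Γ(T, V) := by
  obtain ⟨_, ⟨V, (hV : IsAffineOpen V), rfl⟩, htV, (hVW : V ≤ W)⟩ :=
    T.isBasis_affineOpens.exists_subset_of_mem_open htW W.2
  let q := (hV.primeIdealOf ⟨t, htV⟩).asIdeal
  have : IsNoetherianRing Γ(T, V) := IsLocallyNoetherian.component_noetherian ⟨V, hV⟩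
  have := hV.isLocalization_stalk ⟨t, htV⟩
  let := TopCat.Presheaf.algebra_section_stalk T.presheaf (⟨t, htV⟩ : V)
  let e : Localization.AtPrime q ≃ₐ[Γ(T, V)] T.presheaf.stalk t :=
    IsLocalization.algEquiv q.primeCompl _ _
  have : IsDomain (Localization.AtPrime q) := e.toMulEquiv.isDomain _
  obtain ⟨f, hf, H⟩ := exists_isDomain_localizationAway q
  have := hV.isLocalization_basicOpen f
  exact ⟨T.basicOpen f, hV.basicOpen f, (mem_basicOpen_iff_notMem_primeIdealOf hV htV f).mpr hf,
    (T.basicOpen_le f).trans hVW, H _⟩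

end Shrinking

/-! ### Geometric irreducibility of fibres of a morphism of schemes -/

section FamilySpreading
open TensorProduct

lemma geometricallyIrreducible_SpecMap_localizationAway {k D : Type u} [Field k] [CommRing D]
    [Algebra k D] (s : D)
    (h : ∀ (Ω : Type u) [Field Ω] [Algebra k Ω], IsIrreducibleAway ((1 : Ω) ⊗ₜ[k] s)) :
    GeometricallyIrreducible
      (Spec.map (CommRingCat.ofHom (algebraMap k (Localization.Away s)))) := by
  refine geometricallyIrreducible_SpecMap_iff.mpr fun Ω _ _ ↦ ?_
  let f : Ω ⊗[k] D →ₐ[Ω] Ω ⊗[k] Localization.Away s :=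
    Algebra.TensorProduct.map (.id Ω Ω) (IsScalarTower.toAlgHom k D (Localization.Away s))
  let := f.toRingHom.toAlgebra
  have : IsLocalization ((Submonoid.powers s).map
      (Algebra.TensorProduct.includeRight (R := k) (A := Ω))) (Ω ⊗[k] Localization.Away s) := by
    have : IsScalarTower Ω (Ω ⊗[k] D) (Ω ⊗[k] Localization.Away s) :=
      .of_algebraMap_eq' f.comp_algebraMap.symm
    refine IsLocalization.tensorProduct_tensorProduct_right k Ω (Submonoid.powers s)
      (Localization.Away s) ?_
    ext x
    change f (1 ⊗ₜ x) = 1 ⊗ₜ _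
    simp [f]
  rw [Submonoid.map_powers] at this
  have : IsLocalization.Away ((1 : Ω) ⊗ₜ[k] s) (Ω ⊗[k] Localization.Away s) := this
  exact (h Ω).localization_self

lemma isUnit_of_range_subset_basicOpen {S B : CommRingCat.{u}} (β : S ⟶ B) (g : S)
    (h : Set.range (Spec.map β) ⊆ (PrimeSpectrum.basicOpen g : Set (PrimeSpectrum S))) :
    IsUnit (β.hom g) := by
  by_contra hu
  obtain ⟨m, hm, hgm⟩ := exists_max_ideal_of_mem_nonunits hu
  exact h ⟨(⟨m, hm.isPrime⟩ : PrimeSpectrum B), rfl⟩ hgm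

/-- Let `e` be a normal point of `T` over the generic point of an integral open subscheme
`Spec R` of `P`. After shrinking `P`, an irreducible fibre of `T ⟶ P` over a point with values in a
field is geometrically irreducible as soon as it receives a geometrically irreducible scheme that
meets a certain neighbourhood of `e`. -/
theorem exists_forall_geometricallyIrreducible {T P : Scheme.{u}} (τ : T ⟶ P)
    [LocallyOfFiniteType τ] [IsLocallyNoetherian T] {R : Type u} [CommRing R] [IsDomain R]
    (j : Spec (.of R) ⟶ P) [IsOpenImmersion j] (e : T)
    (he : τ e = j (⊥ : PrimeSpectrum R))
    (hdom : IsDomain (T.presheaf.stalk e)) (hic : IsIntegrallyClosed (T.presheaf.stalk e)) :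
    ∃ T₁ : T.Opens, e ∈ T₁ ∧ ∃ P₁ : P.Opens, j (⊥ : PrimeSpectrum R) ∈ P₁ ∧
      ∀ (k : Type u) [Field k] (p : Spec (.of k) ⟶ P), Set.range p ⊆ (P₁ : Set P) →
      ∀ {Z : Scheme.{u}} (fst : Z ⟶ T) (snd : Z ⟶ Spec (.of k)), IsPullback fst snd τ p →
      IrreducibleSpace Z →
      ∀ {G : Scheme.{u}} (i : G ⟶ Z), GeometricallyIrreducible (i ≫ snd) →
      (∃ x : G, (i ≫ fst) x ∈ T₁) → GeometricallyIrreducible snd := by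
  obtain ⟨V, hV, heV, hVle, _⟩ := exists_isAffineOpen_isDomain e (τ ⁻¹ᵁ j.opensRange)
    (show τ e ∈ Set.range j from ⟨_, he.symm⟩)
  let S : Type u := Γ(T, V)
  let v : Spec (.of S) ⟶ T := hV.fromSpec
  have hv : Set.range v = V := hV.range_fromSpec
  have hrange : Set.range (v ≫ τ) ⊆ Set.range j := by
    rintro _ ⟨x, rfl⟩
    exact hVle (hv.le ⟨x, rfl⟩)
  obtain ⟨ψ, hψ⟩ := Spec.map_surjective (IsOpenImmersion.lift j (v ≫ τ) hrange)
  have hψj : Spec.map ψ ≫ j = v ≫ τ := by rw [hψ, IsOpenImmersion.lift_fac]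
  let : Algebra R S := ψ.hom.toAlgebra
  have : Algebra.FiniteType R S := by
    have h1 : LocallyOfFiniteType (Spec.map ψ ≫ j) := by rw [hψj]; infer_instance
    have h2 := locallyOfFiniteType_of_comp (Spec.map ψ) j
    rw [HasRingHomProperty.Spec_iff (P := @LocallyOfFiniteType)] at h2
    exact h2
  let q := (hV.primeIdealOf ⟨e, heV⟩).asIdeal
  have hcomap : q.comap (algebraMap R S) = ⊥ := by
    have h1 : Spec.map ψ (hV.primeIdealOf ⟨e, heV⟩) = (⊥ : PrimeSpectrum R) := by
      apply j.isOpenEmbedding.injective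
      refine Eq.trans ?_ he
      have h2 (y : Spec (.of S)) : j (Spec.map ψ y) = τ (v y) := by
        rw [← Scheme.Hom.comp_apply, hψj, Scheme.Hom.comp_apply]
      exact (h2 _).trans (congrArg τ (hV.fromSpec_primeIdealOf ⟨e, heV⟩))
    exact congrArg PrimeSpectrum.asIdeal h1
  have : FaithfulSMul R S := by
    rw [faithfulSMul_iff_algebraMap_injective, RingHom.injective_iff_ker_eq_bot, eq_bot_iff,
      ← hcomap]
    exact Ideal.comap_mono bot_le
  have : IsIntegrallyClosed (Localization.AtPrime q) := by
    have := hV.isLocalization_stalk ⟨e, heV⟩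
    let := TopCat.Presheaf.algebra_section_stalk T.presheaf (⟨e, heV⟩ : V)
    let E : Localization.AtPrime q ≃ₐ[S] T.presheaf.stalk e :=
      IsLocalization.algEquiv q.primeCompl _ _
    exact .of_equiv E.symm.toRingEquiv
  obtain ⟨g, hg, s, hs, r, hr, H⟩ :=
    exists_forall_isIrreducibleAway_of_geometricallyIrreducible R S q
  refine ⟨T.basicOpen (U := V) g, (mem_basicOpen_iff_notMem_primeIdealOf hV heV g).mpr hg,
    j ''ᵁ (PrimeSpectrum.basicOpen r), ⟨(⊥ : PrimeSpectrum R), fun h ↦ hr h, rfl⟩, ?_⟩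
  intro k _ p hp Z fst snd h hZ G i hG ⟨x, hx⟩
  have hpj : Set.range p ⊆ Set.range j := hp.trans (Set.image_subset_range _ _)
  obtain ⟨χ, hχ⟩ := Spec.map_surjective (IsOpenImmersion.lift j p hpj)
  have hχj : Spec.map χ ≫ j = p := by rw [hχ, IsOpenImmersion.lift_fac]
  let : Algebra R k := χ.hom.toAlgebra
  have hrk : algebraMap R k r ≠ 0 := by
    refine (isUnit_of_range_subset_basicOpen χ r ?_).ne_zero
    rintro _ ⟨y, rfl⟩
    obtain ⟨z, hz, hzy⟩ := hp ⟨y, rfl⟩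
    rw [← hχj, Scheme.Hom.comp_apply] at hzy
    rwa [← j.isOpenEmbedding.injective hzy]
  let D := k ⊗[R] S
  let : Algebra S D := Algebra.TensorProduct.rightAlgebra
  let inl : CommRingCat.of k ⟶ .of D := CommRingCat.ofHom Algebra.TensorProduct.includeLeftRingHom
  let inr : CommRingCat.of S ⟶ .of D :=
    CommRingCat.ofHom Algebra.TensorProduct.includeRight.toRingHom
  have sq₀ : IsPullback (Spec.map inl) (Spec.map inr) (Spec.map χ) (Spec.map ψ) :=
    isPullback_SpecMap_of_isPushout _ _ _ _ (CommRingCat.isPushout_tensorProduct R k S)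
  have sq : IsPullback (Spec.map inr) (Spec.map inl) (v ≫ τ) p := by
    have := isPullback_comp_mono sq₀.flip j
    rwa [hψj, hχj] at this
  let m : Spec (.of D) ⟶ Z := h.lift (Spec.map inr ≫ v) (Spec.map inl) (by
    rw [Category.assoc, sq.w])
  have hm₁ : m ≫ fst = Spec.map inr ≫ v := h.lift_fst _ _ _
  have hm₂ : m ≫ snd = Spec.map inl := h.lift_snd _ _ _
  have sqm : IsPullback (Spec.map inr) m v fst := .of_bot (by rwa [hm₂]) hm₁.symm h
  have : IsOpenImmersion m := MorphismProperty.of_isPullback sqm inferInstance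
  -- an affine open subscheme of `G` that lands in `D(g)`
  obtain ⟨_, ⟨A, (hA : IsAffineOpen A), rfl⟩, hxA, (hAle : A ≤ (i ≫ fst) ⁻¹ᵁ T.basicOpen (U := V)
      g)⟩ :=
    G.isBasis_affineOpens.exists_subset_of_mem_open hx
      ((i ≫ fst) ⁻¹ᵁ T.basicOpen (U := V) g).2
  let B : Type u := Γ(G, A)
  let a : Spec (.of B) ⟶ G := hA.fromSpec
  have ha : Set.range a = A := hA.range_fromSpec
  have hag (y) : (a ≫ i ≫ fst) y ∈ T.basicOpen (U := V) g := hAle (ha.le ⟨y, rfl⟩)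
  have : Nonempty (Spec (.of B)) := by
    obtain ⟨y, -⟩ := ha.ge hxA
    exact ⟨y⟩
  have hav : Set.range (a ≫ i ≫ fst) ⊆ Set.range v := by
    rintro _ ⟨y, rfl⟩
    exact hv.ge (T.basicOpen_le _ (hag y))
  obtain ⟨β, hβ⟩ := Spec.map_surjective (IsOpenImmersion.lift v (a ≫ i ≫ fst) hav)
  have hβv : Spec.map β ≫ v = a ≫ i ≫ fst := by rw [hβ, IsOpenImmersion.lift_fac]
  obtain ⟨κ, hκ⟩ := Spec.map_surjective (a ≫ i ≫ snd)
  let : Algebra k B := κ.hom.toAlgebra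
  obtain ⟨δ, hδ⟩ := Spec.map_surjective (sq.lift (Spec.map β) (Spec.map κ) (by
    rw [← Category.assoc, hβv, hκ, Category.assoc, Category.assoc, Category.assoc, Category.assoc,
      h.w]))
  have hδl : inl ≫ δ = κ := Spec.map_injective (by rw [Spec.map_comp, hδ, sq.lift_snd])
  have hδr : inr ≫ δ = β := Spec.map_injective (by rw [Spec.map_comp, hδ, sq.lift_fst])
  let δ' : D →ₐ[k] B := ⟨δ.hom, fun c ↦ congr($hδl c)⟩
  have hδg : IsUnit (δ' (algebraMap S D g)) := by
    have h1 : δ' (algebraMap S D g) = β.hom g := congr($hδr g)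
    rw [h1]
    refine isUnit_of_range_subset_basicOpen β g ?_
    rintro _ ⟨y, rfl⟩
    have h2 := hag y
    rw [← hβv, Scheme.Hom.comp_apply] at h2
    have h3 : Spec.map β y ∈ hV.fromSpec ⁻¹ᵁ T.basicOpen (U := V) g := h2
    rwa [hV.fromSpec_preimage_basicOpen] at h3
  have hB : GeometricallyIrreducible (Spec.map (CommRingCat.ofHom (algebraMap k B))) := by
    change GeometricallyIrreducible (Spec.map κ)
    have : Surjective (Spec.map κ) := ⟨Function.surjective_to_subsingleton _⟩
    rw [hκ] at this ⊢
    infer_instance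
  have : Nonempty (Spec (.of D)) := ‹Nonempty (Spec (.of B))›.map (Spec.map δ)
  have hD : IsIrreducibleAway (1 : D) := by
    rw [isIrreducibleAway_one_iff]
    exact m.isOpenEmbedding.irreducibleSpace
  -- a dense open subscheme of `Z` is geometrically irreducible
  let d : D := algebraMap S D s
  let m' : Spec (.of (Localization.Away d)) ⟶ Z :=
    Spec.map (CommRingCat.ofHom (algebraMap D (Localization.Away d))) ≫ m
  have hm' : m' ≫ snd = Spec.map (CommRingCat.ofHom (algebraMap k (Localization.Away d))) := by
    rw [Category.assoc, hm₂, ← Spec.map_comp]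
    rfl
  have : GeometricallyIrreducible (m' ≫ snd) := by
    rw [hm']
    refine geometricallyIrreducible_SpecMap_localizationAway d fun Ω _ _ ↦ ?_
    let : Algebra D (Ω ⊗[k] D) := Algebra.TensorProduct.rightAlgebra
    exact H k D B (isFieldPushout_tensorProduct R S k) hrk hD
      (geometricallyIrreducible_SpecMap_iff.mp hB) δ' hδg Ω (Ω ⊗[k] D)
      (isFieldPushout_tensorProduct k D Ω)
  have : Nonempty (Spec (.of (Localization.Away d))) := by
    obtain ⟨y, -⟩ := (m' ≫ snd).surjective (⊥ : PrimeSpectrum k)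
    exact ⟨y⟩
  exact geometricallyIrreducible_of_isOpenImmersion m' snd

end FamilySpreading

/-! ### Images of morphisms near generic points -/

section GenericPoints
open TensorProduct

/-- In an irreducible space, a constructible set or its complement contains a nonempty open set. -/
lemma exists_isOpen_subset_or_subset_compl {Y : Type*} [TopologicalSpace Y] [IrreducibleSpace Y]
    {s : Set Y} (hs : Topology.IsConstructible s) :
    ∃ O : Set Y, IsOpen O ∧ O.Nonempty ∧ (O ⊆ s ∨ O ⊆ sᶜ) := by
  induction hs using Topology.IsConstructible.empty_union_induction with
  | open_retrocompact U hU _ =>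
    rcases U.eq_empty_or_nonempty with rfl | h
    · exact ⟨Set.univ, isOpen_univ, Set.univ_nonempty, by simp⟩
    · exact ⟨U, hU, h, .inl subset_rfl⟩
  | union s hs t ht h₁ h₂ =>
    obtain ⟨O₁, ho₁, hn₁, h₁⟩ := h₁
    obtain ⟨O₂, ho₂, hn₂, h₂⟩ := h₂
    rcases h₁ with h₁ | h₁
    · exact ⟨O₁, ho₁, hn₁, .inl (h₁.trans Set.subset_union_left)⟩
    rcases h₂ with h₂ | h₂
    · exact ⟨O₂, ho₂, hn₂, .inl (h₂.trans Set.subset_union_right)⟩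
    refine ⟨O₁ ∩ O₂, ho₁.inter ho₂, nonempty_preirreducible_inter ho₁ ho₂ hn₁ hn₂, .inr ?_⟩
    rw [Set.compl_union]
    exact Set.inter_subset_inter h₁ h₂
  | compl s hs h =>
    obtain ⟨O, ho, hn, h⟩ := h
    exact ⟨O, ho, hn, by rwa [compl_compl, or_comm]⟩

/-- The generic point of an integral open subscheme has no proper generization. -/
lemma eq_of_specializes_bot {P : Scheme.{u}} {R : Type u} [CommRing R] [IsDomain R]
    (j : Spec (.of R) ⟶ P) [IsOpenImmersion j] {y : P} (hy : y ⤳ j (⊥ : PrimeSpectrum R)) :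
    y = j (⊥ : PrimeSpectrum R) := by
  obtain ⟨z, rfl⟩ : y ∈ Set.range j :=
    hy.mem_open j.isOpenEmbedding.isOpen_range ⟨_, rfl⟩
  have h1 : (z : PrimeSpectrum R) ⤳ (⊥ : PrimeSpectrum R) :=
    j.isOpenEmbedding.isInducing.specializes_iff.mp hy
  exact congrArg j (le_bot_iff (α := PrimeSpectrum R) |>.mp
    ((PrimeSpectrum.le_iff_specializes _ _).mpr h1))

/-- If a point of `O` lies over the generic point of an integral open subscheme `Spec R`, then the
image of `O` contains a neighbourhood of it. -/
lemma exists_opens_subset_image {Y P : Scheme.{u}} (f : Y ⟶ P) [LocallyOfFiniteType f]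
    {R : Type u} [CommRing R] [IsDomain R] [IsNoetherianRing R] (j : Spec (.of R) ⟶ P)
    [IsOpenImmersion j] (O : Y.Opens) (y : Y) (hyO : y ∈ O)
    (hy : f y = j (⊥ : PrimeSpectrum R)) :
    ∃ P₂ : P.Opens, j (⊥ : PrimeSpectrum R) ∈ P₂ ∧ (P₂ : Set P) ⊆ f '' O := by
  obtain ⟨_, ⟨V, (hV : IsAffineOpen V), rfl⟩, hyV, (hVle : V ≤ O ⊓ f ⁻¹ᵁ j.opensRange)⟩ :=
    Y.isBasis_affineOpens.exists_subset_of_mem_open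
      (show y ∈ O ⊓ f ⁻¹ᵁ j.opensRange from ⟨hyO, ⟨_, hy.symm⟩⟩) (O ⊓ f ⁻¹ᵁ j.opensRange).2
  let S : Type u := Γ(Y, V)
  let v : Spec (.of S) ⟶ Y := hV.fromSpec
  have hv : Set.range v = V := hV.range_fromSpec
  have hrange : Set.range (v ≫ f) ⊆ Set.range j := by
    rintro _ ⟨x, rfl⟩
    exact (hVle (hv.le ⟨x, rfl⟩)).2
  obtain ⟨ψ, hψ⟩ := Spec.map_surjective (IsOpenImmersion.lift j (v ≫ f) hrange)
  have hψj : Spec.map ψ ≫ j = v ≫ f := by rw [hψ, IsOpenImmersion.lift_fac]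
  have hpt (x : Spec (.of S)) : j (Spec.map ψ x) = f (v x) := by
    rw [← Scheme.Hom.comp_apply, hψj, Scheme.Hom.comp_apply]
  have hfp : ψ.hom.FinitePresentation := by
    have h1 : LocallyOfFiniteType (Spec.map ψ ≫ j) := by rw [hψj]; infer_instance
    have h2 := locallyOfFiniteType_of_comp (Spec.map ψ) j
    rw [HasRingHomProperty.Spec_iff (P := @LocallyOfFiniteType)] at h2
    exact RingHom.FinitePresentation.of_finiteType.mp h2
  obtain ⟨D, hD, hDn, h⟩ := exists_isOpen_subset_or_subset_compl
    (PrimeSpectrum.isConstructible_range_comap hfp)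
  obtain ⟨x, rfl⟩ : y ∈ Set.range v := hv.ge hyV
  have hx : PrimeSpectrum.comap ψ.hom x = ⊥ := by
    apply j.isOpenEmbedding.injective
    exact (hpt x).trans hy
  have hbot : ⊥ ∈ D := by
    obtain ⟨z, hz⟩ := hDn
    exact ((PrimeSpectrum.le_iff_specializes _ _).mp bot_le).mem_open hD hz
  replace h : D ⊆ Set.range (PrimeSpectrum.comap ψ.hom) :=
    h.resolve_right fun h ↦ h hbot ⟨x, hx⟩
  refine ⟨j ''ᵁ ⟨D, hD⟩, ⟨_, hbot, rfl⟩, ?_⟩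
  rintro _ ⟨z, hz, rfl⟩
  obtain ⟨w, rfl⟩ := h hz
  exact ⟨v w, (hVle (hv.le ⟨w, rfl⟩)).1, (hpt w).symm⟩

/-- If no point of a noetherian scheme lies over the generic point of an integral open subscheme,
then its image misses a neighbourhood of the generic point. -/
lemma exists_opens_disjoint_range {Y P : Scheme.{u}} (f : Y ⟶ P) [TopologicalSpace.NoetherianSpace
    Y]
    {R : Type u} [CommRing R] [IsDomain R] (j : Spec (.of R) ⟶ P) [IsOpenImmersion j]
    (h : ∀ y, f y ≠ j (⊥ : PrimeSpectrum R)) :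
    ∃ P₁ : P.Opens, j (⊥ : PrimeSpectrum R) ∈ P₁ ∧ ∀ y, f y ∉ P₁ := by
  have hcpt : IsCompact (f ⁻¹ᵁ j.opensRange : Set Y) :=
    TopologicalSpace.NoetherianSpace.isCompact _
  have key (y : Y) (hy : y ∈ (f ⁻¹ᵁ j.opensRange : Set Y)) :
      ∃ V : Y.Opens, y ∈ V ∧ ∃ r : R, r ≠ 0 ∧
        ∀ z ∈ V, f z ∉ j ''ᵁ (PrimeSpectrum.basicOpen r) := by
    obtain ⟨_, ⟨V, (hV : IsAffineOpen V), rfl⟩, hyV, (hVle : V ≤ f ⁻¹ᵁ j.opensRange)⟩ :=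
      Y.isBasis_affineOpens.exists_subset_of_mem_open hy (f ⁻¹ᵁ j.opensRange).2
    let S : Type u := Γ(Y, V)
    let v : Spec (.of S) ⟶ Y := hV.fromSpec
    have hv : Set.range v = V := hV.range_fromSpec
    have hrange : Set.range (v ≫ f) ⊆ Set.range j := by
      rintro _ ⟨x, rfl⟩
      exact hVle (hv.le ⟨x, rfl⟩)
    obtain ⟨ψ, hψ⟩ := Spec.map_surjective (IsOpenImmersion.lift j (v ≫ f) hrange)
    have hψj : Spec.map ψ ≫ j = v ≫ f := by rw [hψ, IsOpenImmersion.lift_fac]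
    have hpt (x : Spec (.of S)) : j (Spec.map ψ x) = f (v x) := by
      rw [← Scheme.Hom.comp_apply, hψj, Scheme.Hom.comp_apply]
    let : Algebra R S := ψ.hom.toAlgebra
    let M := Algebra.algebraMapSubmonoid S (nonZeroDivisors R)
    obtain ⟨r, hr, hr0⟩ : ∃ r : R, r ≠ 0 ∧ algebraMap R S r = 0 := by
      by_contra! hne
      have hM : (0 : S) ∉ M := by
        rintro ⟨r, hr, hr0⟩
        exact hne r (nonZeroDivisors.ne_zero hr) hr0
      have hdis : Disjoint ((⊥ : Ideal S) : Set S) (M : Set S) := by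
        rw [Set.disjoint_left]
        rintro x (rfl : x = 0) hx
        exact hM hx
      obtain ⟨q, hq, -, hqM⟩ := Ideal.exists_le_prime_disjoint (⊥ : Ideal S) M hdis
      refine h (v (⟨q, hq⟩ : PrimeSpectrum S)) ?_
      refine (hpt _).symm.trans (congrArg j ?_)
      refine PrimeSpectrum.ext (eq_bot_iff.mpr fun r hr ↦ ?_)
      by_contra hr0
      exact Set.disjoint_left.mp hqM hr ⟨r, mem_nonZeroDivisors_of_ne_zero hr0, rfl⟩
    refine ⟨V, hyV, r, hr, fun z hz ↦ ?_⟩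
    rintro ⟨w, hw, hwz⟩
    obtain ⟨x, rfl⟩ : z ∈ Set.range v := hv.ge hz
    rw [← hpt] at hwz
    have := j.isOpenEmbedding.injective hwz
    rw [this] at hw
    refine hw ?_
    change algebraMap R S r ∈ (x : PrimeSpectrum S).asIdeal
    rw [hr0]
    exact zero_mem _
  choose! V hyV r hr hVr using key
  obtain ⟨t, ht, hcov⟩ := hcpt.elim_nhds_subcover (fun y ↦ (V y : Set Y))
    fun y hy ↦ (V y).2.mem_nhds (hyV y hy)
  refine ⟨j ''ᵁ (PrimeSpectrum.basicOpen (∏ y ∈ t, r y)), ⟨(⊥ : PrimeSpectrum R), ?_, rfl⟩, ?_⟩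
  · exact fun h0 ↦ Finset.prod_ne_zero_iff.mpr (fun y hy ↦ hr y (ht y hy)) h0
  · rintro y ⟨w, hw, hwy⟩
    obtain ⟨z, hz, hyz⟩ := Set.mem_iUnion₂.mp (hcov (show f y ∈ Set.range j from ⟨w, hwy⟩))
    refine hVr z (ht z hz) y hyz ⟨w, fun h0 ↦ hw ?_, hwy⟩
    obtain ⟨c, hc⟩ := Finset.dvd_prod_of_mem r hz
    change (∏ y ∈ t, r y) ∈ w.asIdeal
    rw [hc]
    exact Ideal.mul_mem_right _ _ h0

end GenericPoints

/-! ### Slices of `X × X` -/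

noncomputable section Slices
open TensorProduct

variable {K : Type u} [Field K] {X : Scheme.{u}} (fX : X ⟶ Spec (.of K))

/-- The slice `X × {x}` of `X × X` through a rational point `x`, as a morphism `X ⟶ X × X`. -/
def sliceAt (x : Spec (.of K) ⟶ X) (hx : x ≫ fX = 𝟙 _) : X ⟶ pullback fX fX :=
  pullback.lift (𝟙 X) (fX ≫ x) (by rw [Category.assoc, hx, Category.id_comp, Category.comp_id])

lemma isPullback_sliceAt (x : Spec (.of K) ⟶ X) (hx : x ≫ fX = 𝟙 _) :
    IsPullback (sliceAt fX x hx) fX (pullback.snd fX fX) x := by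
  refine .of_right (h₁₂ := pullback.fst fX fX) (v₁₃ := fX) (h₂₂ := fX) ?_ ?_ ?_
  · rw [sliceAt, pullback.lift_fst, hx]
    exact .of_horiz_isIso_mono ⟨by rw [Category.id_comp, Category.comp_id]⟩
  · rw [sliceAt, pullback.lift_snd]
  · exact .of_hasPullback fX fX

/-- The generic point of the slice `X × {x}` as a point of `X × X` with values in the function
field of `X`. -/
def sliceGenericPoint [IrreducibleSpace X] (x : Spec (.of K) ⟶ X) (hx : x ≫ fX = 𝟙 _) :
    Spec (X.residueField (genericPoint X)) ⟶ pullback fX fX :=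
  X.fromSpecResidueField (genericPoint X) ≫ sliceAt fX x hx

/-- If a rational point `x` lies in the second projection of an open subset of `X × X`, then the
generic point of the slice `X × {x}` lies in the open subset. -/
lemma range_sliceGenericPoint_subset [IrreducibleSpace X] (P₁ : (pullback fX fX).Opens)
    (x : Spec (.of K) ⟶ X) (hx : x ≫ fX = 𝟙 _)
    (h : Set.range x ⊆ pullback.snd fX fX '' (P₁ : Set ↥(pullback fX fX))) :
    Set.range (sliceGenericPoint fX x hx) ⊆ (P₁ : Set ↥(pullback fX fX)) := by
  obtain ⟨o⟩ : Nonempty (Spec (.of K)) := inferInstance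
  obtain ⟨z, hz, hzo⟩ := h ⟨o, rfl⟩
  obtain ⟨y, hy, -⟩ := Scheme.exists_preimage_of_isPullback (isPullback_sliceAt fX x hx) z o hzo
  have hη : genericPoint X ∈ sliceAt fX x hx ⁻¹ᵁ P₁ :=
    (genericPoint_spec X).mem_open_set_iff (sliceAt fX x hx ⁻¹ᵁ P₁).2 |>.mpr
      ⟨y, Set.mem_univ _, show sliceAt fX x hx y ∈ P₁ by rwa [hy]⟩
  rintro _ ⟨w, rfl⟩
  rw [sliceGenericPoint, Scheme.Hom.comp_apply]
  have : X.fromSpecResidueField (genericPoint X) w = genericPoint X := by simp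
  rw [this]
  exact hη

/-- An integral scheme locally of finite type over a field has an affine chart. -/
lemma exists_chart [IsIntegral X] [LocallyOfFiniteType fX] :
    ∃ (A : Type u) (_ : CommRing A) (_ : IsDomain A) (_ : Algebra K A)
      (_ : Algebra.FiniteType K A) (j : Spec (.of A) ⟶ X), IsOpenImmersion j ∧
      j ≫ fX = Spec.map (CommRingCat.ofHom (algebraMap K A)) := by
  obtain ⟨_, ⟨V, (hV : IsAffineOpen V), rfl⟩, hxV, -⟩ :=
    X.isBasis_affineOpens.exists_subset_of_mem_open (Set.mem_univ (genericPoint X)) isOpen_univ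
  have : Nonempty V := ⟨⟨_, hxV⟩⟩
  obtain ⟨ψ, hψ⟩ := Spec.map_surjective (hV.fromSpec ≫ fX)
  let : Algebra K Γ(X, V) := ψ.hom.toAlgebra
  have : Algebra.FiniteType K Γ(X, V) := by
    have h : LocallyOfFiniteType (Spec.map ψ) := by rw [hψ]; infer_instance
    rw [HasRingHomProperty.Spec_iff (P := @LocallyOfFiniteType)] at h
    exact h
  exact ⟨Γ(X, V), inferInstance, inferInstance, inferInstance, inferInstance, hV.fromSpec,
    inferInstance, hψ.symm⟩

/-- Over an algebraically closed field, `X × X` has an integral affine chart. -/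
lemma exists_chart_prod [IsAlgClosed K] [IsIntegral X] [LocallyOfFiniteType fX] :
    ∃ (R : Type u) (_ : CommRing R) (_ : IsDomain R) (_ : IsNoetherianRing R)
      (j : Spec (.of R) ⟶ pullback fX fX), IsOpenImmersion j := by
  obtain ⟨A, _, _, _, _, j, _, hj⟩ := exists_chart fX
  have := isDomain_tensorProduct_of_isAlgClosed K A A
  have : Algebra.FiniteType K (A ⊗[K] A) := .trans (S := A) inferInstance inferInstance
  have : IsNoetherianRing (A ⊗[K] A) := Algebra.FiniteType.isNoetherianRing K _
  let a := Spec.map (CommRingCat.ofHom (algebraMap K A))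
  let m : pullback a a ⟶ pullback fX fX := pullback.map _ _ _ _ j j (𝟙 _)
    (by rw [hj, Category.comp_id]) (by rw [hj, Category.comp_id])
  exact ⟨A ⊗[K] A, inferInstance, inferInstance, inferInstance,
    (pullbackSpecIso K A A).inv ≫ m, inferInstance⟩

end Slices

/-! ### The morphism `C ×_U C ⟶ X × X` -/

noncomputable section LefschetzFiber

variable {K : Type u} [Field K] {X C U : Scheme.{u}} (fX : X ⟶ Spec (.of K))

/-- For a family `U ←π C →φ X` over `K`, the morphism `C ×_U C ⟶ X × X`, `(c, c') ↦ (φ c, φ c')`. -/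
def evalPair {fU : U ⟶ Spec (.of K)} {π : C ⟶ U} {φ : C ⟶ X} (h : π ≫ fU = φ ≫ fX) :
    pullback π π ⟶ pullback fX fX :=
  pullback.lift (pullback.fst π π ≫ φ) (pullback.snd π π ≫ φ) (by
    rw [Category.assoc, Category.assoc, ← h, pullback.condition_assoc])

variable {fX} {fU : U ⟶ Spec (.of K)} {π : C ⟶ U} {φ : C ⟶ X} (h : π ≫ fU = φ ≫ fX)

lemma evalPair_fst : evalPair fX h ≫ pullback.fst fX fX = pullback.fst π π ≫ φ :=
  pullback.lift_fst _ _ _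

lemma evalPair_snd : evalPair fX h ≫ pullback.snd fX fX = pullback.snd π π ≫ φ :=
  pullback.lift_snd _ _ _

/-- The morphism `φ_x` is the base change of `C ×_U C ⟶ X × X` to the slice `X × {x}`. -/
lemma isPullback_evalThrough (x : Spec (.of K) ⟶ X) (hx : x ≫ fX = 𝟙 _) :
    IsPullback (pullback.fst (pullback.snd π π)
        (pullback.fst (pullback.diagonal π ≫ pullback.fst π π ≫ φ) x))
      (CurveFamilies.evalThrough (pullback.snd π π) (pullback.fst π π ≫ φ)
        (pullback.diagonal π) x) (evalPair fX h) (sliceAt fX x hx) := by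
  let b := pullback.fst (pullback.diagonal π ≫ pullback.fst π π ≫ φ) x
  let c := pullback.snd (pullback.diagonal π ≫ pullback.fst π π ≫ φ) x
  have hb : b ≫ φ = c ≫ x :=
    (congrArg (b ≫ ·) (pullback.diagonal_fst_assoc π φ)).symm.trans pullback.condition
  have h1 : IsPullback (pullback.fst (pullback.snd π π) b) (pullback.snd (pullback.snd π π) b ≫ c)
      (evalPair fX h ≫ pullback.snd fX fX) x := by
    have e : evalPair fX h ≫ pullback.snd fX fX =
        pullback.snd π π ≫ pullback.diagonal π ≫ pullback.fst π π ≫ φ := by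
      rw [evalPair_snd, pullback.diagonal_fst_assoc]
    rw [e]
    exact (IsPullback.of_hasPullback (pullback.snd π π) b).paste_vert (.of_hasPullback _ x)
  have hev : CurveFamilies.evalThrough (pullback.snd π π) (pullback.fst π π ≫ φ)
      (pullback.diagonal π) x = pullback.fst (pullback.snd π π) b ≫ pullback.fst π π ≫ φ := rfl
  have h2 : pullback.snd (pullback.snd π π) b ≫ c =
      CurveFamilies.evalThrough (pullback.snd π π) (pullback.fst π π ≫ φ)
        (pullback.diagonal π) x ≫ fX := by
    rw [hev, Category.assoc, Category.assoc, ← h, pullback.condition_assoc, h,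
      pullback.condition_assoc, reassoc_of% hb, hx, Category.comp_id]
  refine .of_bot (v₂₁ := fX) (v₂₂ := pullback.snd fX fX) (h₃₁ := x) ?_ ?_
    (isPullback_sliceAt fX x hx)
  · rwa [← h2]
  · apply pullback.hom_ext
    · rw [Category.assoc, evalPair_fst, Category.assoc, sliceAt, pullback.lift_fst,
        Category.comp_id, hev]
    · rw [Category.assoc, Category.assoc, sliceAt, pullback.lift_snd, h1.w, h2, Category.assoc]

/-- The generic fibre of `φ_x` is the fibre of `C ×_U C ⟶ X × X` over the generic point of the slice
`X × {x}`. -/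
lemma isPullback_fiber_evalThrough [IrreducibleSpace X] (x : Spec (.of K) ⟶ X)
    (hx : x ≫ fX = 𝟙 _) :
    IsPullback ((CurveFamilies.evalThrough (pullback.snd π π) (pullback.fst π π ≫ φ)
        (pullback.diagonal π) x).fiberι (genericPoint X) ≫ pullback.fst (pullback.snd π π)
          (pullback.fst (pullback.diagonal π ≫ pullback.fst π π ≫ φ) x))
      ((CurveFamilies.evalThrough (pullback.snd π π) (pullback.fst π π ≫ φ)
        (pullback.diagonal π) x).fiberToSpecResidueField (genericPoint X))
      (evalPair fX h) (sliceGenericPoint fX x hx) :=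
  (IsPullback.of_hasPullback (CurveFamilies.evalThrough (pullback.snd π π) (pullback.fst π π ≫ φ)
    (pullback.diagonal π) x) (X.fromSpecResidueField (genericPoint X))).paste_horiz
      (isPullback_evalThrough h x hx)

lemma isDominant_of_nonempty_fiber_genericPoint {Y : Scheme.{u}} [IrreducibleSpace X] (f : Y ⟶ X)
    (hf : Nonempty (f.fiber (genericPoint X))) : IsDominant f := by
  obtain ⟨z⟩ := hf
  refine ⟨?_⟩
  have hz : f (f.fiberι (genericPoint X) z) = genericPoint X :=
    (f.range_fiberι (genericPoint X)).le ⟨z, rfl⟩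
  rw [denseRange_iff_closure_range, ← Set.univ_subset_iff, ← (genericPoint_spec X).def]
  exact closure_mono (Set.singleton_subset_iff.mpr ⟨_, hz⟩)

end LefschetzFiber

/-! ### Projective space -/

noncomputable section ProjectiveSpace
open TensorProduct HomogeneousLocalization

attribute [local instance] MvPolynomial.gradedAlgebra

variable (n : ℕ) (K : Type u) [Field K]

lemma bijective_algebraMap_homogeneousSubmodule_zero :
    Function.Bijective (algebraMap K (MvPolynomial.homogeneousSubmodule (Fin (n + 1)) K 0)) := by
  refine ⟨fun a b h ↦ MvPolynomial.C_injective _ _ (congrArg Subtype.val h), fun ⟨p, hp⟩ ↦ ?_⟩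
  rw [MvPolynomial.homogeneousSubmodule_zero, Submodule.mem_one] at hp
  obtain ⟨c, hc⟩ := hp
  exact ⟨c, Subtype.ext hc⟩

instance : IsIso (Spec.map (CommRingCat.ofHom
    (algebraMap K (MvPolynomial.homogeneousSubmodule (Fin (n + 1)) K 0)))) := by
  have : IsIso (CommRingCat.ofHom
      (algebraMap K (MvPolynomial.homogeneousSubmodule (Fin (n + 1)) K 0))) :=
    (ConcreteCategory.isIso_iff_bijective _).mpr (bijective_algebraMap_homogeneousSubmodule_zero n
        K)
  infer_instance

lemma adjoin_range_X_eq_top :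
    Algebra.adjoin (MvPolynomial.homogeneousSubmodule (Fin (n + 1)) K 0)
      (Set.range (MvPolynomial.X (R := K) (σ := Fin (n + 1)))) = ⊤ := by
  rw [eq_top_iff]
  rintro p -
  induction p using MvPolynomial.induction_on with
  | C c =>
    exact Subalgebra.algebraMap_mem _
      (algebraMap K (MvPolynomial.homogeneousSubmodule (Fin (n + 1)) K 0) c)
  | add p q hp hq => exact add_mem hp hq
  | mul_X p i hp => exact mul_mem hp (Algebra.subset_adjoin ⟨i, rfl⟩)

instance : Algebra.FiniteType (MvPolynomial.homogeneousSubmodule (Fin (n + 1)) K 0)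
    (MvPolynomial (Fin (n + 1)) K) :=
  ⟨Subalgebra.fg_def.mpr ⟨_, Set.finite_range _, adjoin_range_X_eq_top n K⟩⟩

instance : IsProper (CurveFamilies.projSpaceStr n K) := by
  have : IsProper (Proj.toSpecZero (MvPolynomial.homogeneousSubmodule (Fin (n + 1)) K)) :=
    inferInstance
  exact MorphismProperty.comp_mem _ _ _ this inferInstance

lemma CurveFamilies.IsProjective.isProper {K : Type u} [Field K] {X : Scheme.{u}}
    {fX : X ⟶ Spec (.of K)} (h : CurveFamilies.IsProjective fX) : IsProper fX := by
  obtain ⟨n, i, _, rfl⟩ := h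
  infer_instance

/-- On the projective line the ratio of the two coordinates is a nonconstant function. -/
lemma exists_chart_projSpace_one (z : CurveFamilies.projSpace 1 K) :
    ∃ (B : Type u) (_ : CommRing B) (_ : IsDomain B) (_ : Algebra K B)
      (_ : Algebra.FiniteType K B) (q : Spec (.of B) ⟶ CurveFamilies.projSpace 1 K),
      ¬ Function.Surjective (algebraMap K B) ∧ IsOpenImmersion q ∧ z ∈ Set.range q ∧
      q ≫ CurveFamilies.projSpaceStr 1 K = Spec.map (CommRingCat.ofHom (algebraMap K B)) := by
  let 𝒜 := MvPolynomial.homogeneousSubmodule (Fin (1 + 1)) K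
  have hX (i : Fin (1 + 1)) : (MvPolynomial.X i : MvPolynomial (Fin (1 + 1)) K) ∈ 𝒜 1 :=
    MvPolynomial.isHomogeneous_X K i
  have htop := Proj.iSup_basicOpen_eq_top' 𝒜 (MvPolynomial.X (R := K) (σ := Fin (1 + 1)))
    (fun i ↦ ⟨1, hX i⟩) (adjoin_range_X_eq_top 1 K)
  obtain ⟨i, hi⟩ := TopologicalSpace.Opens.mem_iSup.mp (htop.ge (Set.mem_univ z))
  let B := Away 𝒜 (MvPolynomial.X i : MvPolynomial (Fin (1 + 1)) K)
  let : Algebra K B := ((fromZeroRingHom 𝒜 _).comp (algebraMap K (𝒜 0))).toAlgebra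
  have hinj : Function.Injective
    (algebraMap B (Localization.Away (MvPolynomial.X i : MvPolynomial (Fin (1 + 1)) K))) :=
        val_injective _
  have hle : Submonoid.powers (MvPolynomial.X i : MvPolynomial (Fin (1 + 1)) K) ≤
      nonZeroDivisors _ := powers_le_nonZeroDivisors_of_noZeroDivisors (MvPolynomial.X_ne_zero i)
  have : IsDomain (Localization.Away (MvPolynomial.X i : MvPolynomial (Fin (1 + 1)) K)) :=
    IsLocalization.isDomain_localization hle
  have : IsDomain B := hinj.isDomain _
  have : Algebra.FiniteType K B := RingHom.FiniteType.comp
    (f := algebraMap K (𝒜 0)) (g := fromZeroRingHom 𝒜 _)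
    (Away.finiteType (MvPolynomial.X i) 1 (hX i))
    (.of_surjective _ (bijective_algebraMap_homogeneousSubmodule_zero 1 K).2)
  have ho : IsOpenImmersion (Proj.awayι 𝒜 _ (hX i) one_pos) := inferInstance
  refine ⟨B, inferInstance, inferInstance, inferInstance, inferInstance,
    Proj.awayι 𝒜 _ (hX i) one_pos, fun hs ↦ ?_, ho, ?_, ?_⟩
  · obtain ⟨k, hk⟩ : ∃ k : Fin (1 + 1), k ≠ i := exists_ne i
    obtain ⟨c, hc⟩ := hs (Away.mk 𝒜 (hX i) 1 (MvPolynomial.X k) (by simpa using hX k))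
    have h1 : Localization.mk (MvPolynomial.C c) 1 = Localization.mk (MvPolynomial.X k)
        (⟨MvPolynomial.X i ^ 1, 1, rfl⟩ : Submonoid.powers (MvPolynomial.X i)) :=
      congrArg HomogeneousLocalization.val hc
    rw [Localization.mk_eq_mk_iff, Localization.r_iff_exists] at h1
    obtain ⟨s, hs⟩ := h1
    have h2 := mul_left_cancel₀ (nonZeroDivisors.ne_zero (hle s.2)) hs
    have h3 := congrArg (MvPolynomial.eval (fun a ↦ if a = i then 0 else (1 : K))) h2
    simp [hk] at h3
  · have := (Proj.opensRange_awayι 𝒜 _ (hX i) one_pos).ge hi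
    exact this
  · refine ((Category.assoc _ _ _).symm.trans (congrArg (· ≫ Spec.map (CommRingCat.ofHom
      (algebraMap K (𝒜 0)))) (Proj.awayι_toSpecZero 𝒜 _ (hX i) one_pos))).trans ?_
    exact (Spec.map_comp _ _).symm

end ProjectiveSpace

/-! ### The fibres of `W × ℙ¹` -/

noncomputable section ClosedPointsOfFibers
open TensorProduct

variable {K : Type u} [Field K]

/-- A point of `Spec A × Spec B` that is generic in its fibre over `Spec A` is a proper generization
of some other point of that fibre, as soon as `B` is a finitely generated domain over `K` that is
larger than `K`. -/
lemma exists_gt_comap_eq [IsAlgClosed K] {A B : Type u} [CommRing A] [CommRing B] [IsDomain B]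
    [Algebra K A] [Algebra K B] [Algebra.FiniteType K B]
    (hB : ¬ Function.Surjective (algebraMap K B)) (d : PrimeSpectrum (A ⊗[K] B))
    (hd : ∀ d' ≤ d, d'.comap (algebraMap A (A ⊗[K] B)) = d.comap (algebraMap A (A ⊗[K] B)) →
      d' = d) :
    ∃ d₂ > d, d₂.comap (algebraMap A (A ⊗[K] B)) = d.comap (algebraMap A (A ⊗[K] B)) := by
  set w := d.comap (algebraMap A (A ⊗[K] B)) with hw
  let κ := w.asIdeal.ResidueField
  let m : A ⊗[K] B →ₐ[K] κ ⊗[K] B :=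
    Algebra.TensorProduct.map (IsScalarTower.toAlgHom K A κ) (AlgHom.id K B)
  have : IsDomain (B ⊗[K] κ) := isDomain_tensorProduct_of_isAlgClosed K B κ
  have : IsDomain (κ ⊗[K] B) := (Algebra.TensorProduct.comm K κ B).toMulEquiv.isDomain _
  have hover {S : Type u} [CommRing S] (θ : κ →+* S) (h : A ⊗[K] B →+* S) (q : PrimeSpectrum S)
      (hh : ∀ x, h (algebraMap A _ x) = θ (algebraMap A κ x)) :
      (q.comap h).comap (algebraMap A (A ⊗[K] B)) = w := by
    ext x
    change h (algebraMap A _ x) ∈ q.asIdeal ↔ x ∈ w.asIdeal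
    rw [hh, ← w.asIdeal.algebraMap_residueField_eq_zero]
    refine ⟨fun hx ↦ by_contra fun h0 ↦ q.2.ne_top ?_, fun hx ↦ ?_⟩
    · exact Ideal.eq_top_of_isUnit_mem _ hx ((isUnit_iff_ne_zero.mpr h0).map θ)
    · rw [hx, map_zero]
      exact zero_mem _
  -- the generic point of the fibre over `w` specializes to `d`, hence is equal to `d`
  have hker : RingHom.ker m ≤ d.asIdeal := by
    let L : κ ⊗[K] B →ₐ[K] d.asIdeal.ResidueField := Algebra.TensorProduct.productMap
      (Ideal.ResidueField.mapₐ w.asIdeal d.asIdeal (IsScalarTower.toAlgHom K A (A ⊗[K] B)) rfl)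
      ((IsScalarTower.toAlgHom K (A ⊗[K] B) d.asIdeal.ResidueField).comp
        Algebra.TensorProduct.includeRight)
    have hL : L.comp m = IsScalarTower.toAlgHom K (A ⊗[K] B) d.asIdeal.ResidueField := by
      ext x
      · have : Ideal.ResidueField.mapₐ w.asIdeal d.asIdeal (IsScalarTower.toAlgHom K A (A ⊗[K] B))
            rfl (algebraMap A κ x) = algebraMap (A ⊗[K] B) _ (x ⊗ₜ 1) :=
          Ideal.ResidueField.map_algebraMap _ _ _ rfl x
        simp [L, m, this, ← Algebra.TensorProduct.one_def]
      · simp [L, m]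
    intro z hz
    rw [← Ideal.algebraMap_residueField_eq_zero]
    have := DFunLike.congr_fun hL z
    rw [AlgHom.comp_apply, show m z = 0 from hz, map_zero] at this
    exact this.symm
  have hg : (⊥ : PrimeSpectrum (κ ⊗[K] B)).comap m.toRingHom = d := hd _ hker
    (hover Algebra.TensorProduct.includeLeftRingHom _ _ fun x ↦ by simp [m])
  -- a `K`-rational point of `B` defines a point `d₂` of the fibre over `w`
  obtain ⟨f, -⟩ := exists_algHom_apply_ne_zero K (one_ne_zero (α := B))
  let m₂ : A ⊗[K] B →ₐ[K] κ := Algebra.TensorProduct.productMap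
    (IsScalarTower.toAlgHom K A κ) ((Algebra.ofId K κ).comp f)
  let d₂ := (⊥ : PrimeSpectrum κ).comap m₂.toRingHom
  have hle : d ≤ d₂ := by
    let n : κ ⊗[K] B →ₐ[K] κ :=
      Algebra.TensorProduct.productMap (AlgHom.id K κ) ((Algebra.ofId K κ).comp f)
    have hn : n.comp m = m₂ := by ext x <;> simp [n, m, m₂]
    intro z hz
    rw [← hg] at hz
    change m₂ z = 0
    rw [← hn, AlgHom.comp_apply, show m z = 0 from hz, map_zero]
  refine ⟨d₂, lt_of_le_of_ne hle fun he ↦ ?_, hover (.id κ) _ _ fun x ↦ by simp [m₂]⟩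
  rw [Function.Surjective] at hB
  push Not at hB
  obtain ⟨t, ht⟩ := hB
  have h2 : (1 ⊗ₜ (t - algebraMap K B (f t)) : A ⊗[K] B) ∈ d₂.asIdeal := by
    change m₂ _ = 0
    simp [m₂]
  rw [← he, ← hg] at h2
  have h3 : (1 ⊗ₜ (t - algebraMap K B (f t)) : κ ⊗[K] B) = 0 := by
    have : m _ = 0 := h2
    simpa [m] using this
  have h4 := Algebra.TensorProduct.includeRight_injective (R := K) (A := κ) (B := B)
    (algebraMap K κ).injective (h3.trans (map_zero _).symm)
  exact ht (f t) (sub_eq_zero.mp h4).symm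

/-- The same for `W × ℙ¹` over a `K`-scheme `W`: a point that is generic in its fibre over `W`
is a proper generization of some other point of that fibre. -/
lemma exists_specializes_ne_fst_eq [IsAlgClosed K] {W : Scheme.{u}} (g : W ⟶ Spec (.of K))
    (d : ↥(pullback g (CurveFamilies.projSpaceStr 1 K)))
    (hd : ∀ d', d' ⤳ d → pullback.fst g (CurveFamilies.projSpaceStr 1 K) d' =
      pullback.fst g (CurveFamilies.projSpaceStr 1 K) d → d' = d) :
    ∃ d₂, d ⤳ d₂ ∧ d₂ ≠ d ∧ pullback.fst g (CurveFamilies.projSpaceStr 1 K) d₂ =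
      pullback.fst g (CurveFamilies.projSpaceStr 1 K) d := by
  obtain ⟨B, _, _, _, _, q, hB, _, hq, hqs⟩ := exists_chart_projSpace_one K
    (pullback.snd g (CurveFamilies.projSpaceStr 1 K) d)
  obtain ⟨_, ⟨V, (hV : IsAffineOpen V), rfl⟩, hxV, -⟩ :=
    W.isBasis_affineOpens.exists_subset_of_mem_open
      (Set.mem_univ (pullback.fst g (CurveFamilies.projSpaceStr 1 K) d)) isOpen_univ
  obtain ⟨ψ, hψ⟩ := Spec.map_surjective (hV.fromSpec ≫ g)
  let A : Type u := Γ(W, V)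
  let : Algebra K A := ψ.hom.toAlgebra
  let m : pullback (Spec.map (CommRingCat.ofHom (algebraMap K A)))
      (Spec.map (CommRingCat.ofHom (algebraMap K B))) ⟶
      pullback g (CurveFamilies.projSpaceStr 1 K) :=
    pullback.map _ _ _ _ hV.fromSpec q (𝟙 _) ((Category.comp_id _).trans hψ)
      ((Category.comp_id _).trans hqs.symm)
  let o : Spec (.of (A ⊗[K] B)) ⟶ pullback g (CurveFamilies.projSpaceStr 1 K) :=
    (pullbackSpecIso K A B).inv ≫ m
  have : IsOpenImmersion m := inferInstance
  have : IsOpenImmersion o := inferInstance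
  have hof : o ≫ pullback.fst g (CurveFamilies.projSpaceStr 1 K) =
      Spec.map (CommRingCat.ofHom (algebraMap A (A ⊗[K] B))) ≫ hV.fromSpec := by
    refine (Category.assoc _ _ _).trans ?_
    refine (congrArg ((pullbackSpecIso K A B).inv ≫ ·) (pullback.lift_fst _ _ _)).trans ?_
    exact (Category.assoc _ _ _).symm.trans (congrArg (· ≫ _) (pullbackSpecIso_inv_fst K A B))
  obtain ⟨p, hp⟩ : d ∈ Set.range o := by
    have hm : d ∈ Set.range m := by
      refine (Scheme.Pullback.range_map _ _ _ _ _ _ _ _ _).ge ⟨?_, hq⟩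
      exact hV.range_fromSpec.ge hxV
    obtain ⟨y, hy⟩ := hm
    refine ⟨(pullbackSpecIso K A B).hom y, ?_⟩
    rw [← hy]
    exact congrArg (fun f ↦ f y) ((pullbackSpecIso K A B).hom_inv_id_assoc m)
  have hfst (q q' : PrimeSpectrum (A ⊗[K] B))
      (h : q.comap (algebraMap A (A ⊗[K] B)) = q'.comap (algebraMap A (A ⊗[K] B))) :
      pullback.fst g (CurveFamilies.projSpaceStr 1 K) (o q) =
        pullback.fst g (CurveFamilies.projSpaceStr 1 K) (o q') :=
    (congrArg (fun f : Spec (.of (A ⊗[K] B)) ⟶ W ↦ f q) hof).trans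
      ((congrArg hV.fromSpec h).trans
        (congrArg (fun f : Spec (.of (A ⊗[K] B)) ⟶ W ↦ f q') hof).symm)
  have hinj := o.isOpenEmbedding.injective
  obtain ⟨p₂, hlt, he⟩ := exists_gt_comap_eq (K := K) hB p fun p' hle he ↦ by
    refine hinj ((hd (o p') ?_ ?_).trans hp.symm)
    · rw [← hp]
      exact ((PrimeSpectrum.le_iff_specializes p' p).mp hle).map o.continuous
    · rw [← hp]
      exact hfst _ _ he
  refine ⟨o p₂, ?_, fun h ↦ hlt.ne' (hinj (h.trans hp.symm)), ?_⟩
  · rw [← hp]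
    exact ((PrimeSpectrum.le_iff_specializes p p₂).mp hlt.le).map o.continuous
  · rw [← hp]
    exact hfst _ _ he

end ClosedPointsOfFibers

/-! ### Specializations in the fibres of a family of curves -/

section ChainsInFibers

/-- A chain of two proper specializations forces the dimension to be at least two. -/
lemma two_le_topologicalKrullDim {Z : Type*} [TopologicalSpace Z] [T0Space Z] {x y z : Z}
    (hxy : x ⤳ y) (hne : x ≠ y) (hyz : y ⤳ z) (hne' : y ≠ z) : 2 ≤ topologicalKrullDim Z := by
  let cl (a : Z) : TopologicalSpace.IrreducibleCloseds Z :=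
    ⟨closure {a}, isIrreducible_singleton.closure, isClosed_closure⟩
  have key {a b : Z} (hab : a ⤳ b) (h : a ≠ b) : cl b < cl a := by
    refine lt_of_le_of_ne ?_ fun he ↦ ?_
    · exact specializes_iff_closure_subset.mp hab
    · exact h (hab.antisymm (specializes_iff_closure_subset.mpr (congrArg
        TopologicalSpace.IrreducibleCloseds.carrier he).ge)).eq
  let p : LTSeries (TopologicalSpace.IrreducibleCloseds Z) :=
    (RelSeries.singleton _ (cl z)).snoc (cl y) (key hyz hne')
  exact Order.LTSeries.length_le_krullDim (p.snoc (cl x) ((RelSeries.last_snoc _ _ _).trans_lt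
    (key hxy hne)))

/-- If the fibres of `π` are of pure dimension one, then a point that has a proper specialization in
its fibre has no proper generization there. -/
lemma eq_of_specializes_of_pure_dim_one {C U : Scheme.{u}} (π : C ⟶ U)
    (hdim : ∀ (u : U), ∀ Z ∈ irreducibleComponents (π.fiber u), topologicalKrullDim Z = 1)
    {c' c c₂ : C} (h : c' ⤳ c) (hc' : π c' = π c) (h₂ : c ⤳ c₂) (hc₂ : π c₂ = π c)
    (hne : c₂ ≠ c) : c' = c := by
  by_contra hcc
  have hlift (y : C) (hy : π y = π c) : ∃ z, π.fiberι (π c) z = y := (π.range_fiberι (π c)).ge hy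
  obtain ⟨x', rfl⟩ := hlift c' hc'
  obtain ⟨x, hx⟩ := hlift c rfl
  obtain ⟨x₂, rfl⟩ := hlift c₂ hc₂
  have hind := (π.fiberι (π c)).isEmbedding.isInducing
  have h1 : x' ⤳ x := hind.specializes_iff.mp (by rwa [hx])
  have h2 : x ⤳ x₂ := hind.specializes_iff.mp (by rwa [hx])
  obtain ⟨Z, hZ, hle⟩ := exists_mem_irreducibleComponents_subset_of_isIrreducible
    (closure {x'}) isIrreducible_singleton.closure
  have m' : x' ∈ Z := hle (subset_closure rfl)
  have m : x ∈ Z := hle (specializes_iff_mem_closure.mp h1)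
  have m₂ : x₂ ∈ Z := hle (specializes_iff_mem_closure.mp (h1.trans h2))
  have := two_le_topologicalKrullDim (Z := Z) (x := ⟨x', m'⟩) (y := ⟨x, m⟩) (z := ⟨x₂, m₂⟩)
    (Topology.IsInducing.subtypeVal.specializes_iff.mp h1)
    (fun e ↦ hcc ((congrArg (π.fiberι (π c)) (congrArg Subtype.val e)).trans hx))
    (Topology.IsInducing.subtypeVal.specializes_iff.mp h2)
    (fun e ↦ hne ((congrArg (π.fiberι (π c)) (congrArg Subtype.val e)).symm.trans hx))
  rw [hdim _ Z hZ] at this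
  exact absurd this (by decide)

/-- The generic point of a curve in a family `W × ℙ¹ ⊆ C` is generic in its fibre of `C`, if the
fibres of `C` are of pure dimension one. -/
lemma forall_specializes_eq_of_projSpace_one {K : Type u} [Field K] [IsAlgClosed K]
    {C U W : Scheme.{u}} (π : C ⟶ U)
    (hdim : ∀ (u : U), ∀ Z ∈ irreducibleComponents (π.fiber u), topologicalKrullDim Z = 1)
    (g : W ⟶ Spec (.of K)) (i : W ⟶ U) (k : pullback g (CurveFamilies.projSpaceStr 1 K) ⟶ C)
    (hk : k ≫ π = pullback.fst g (CurveFamilies.projSpaceStr 1 K) ≫ i)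
    (hinj : Function.Injective k) (d : ↥(pullback g (CurveFamilies.projSpaceStr 1 K)))
    (hd : ∀ d', d' ⤳ d → pullback.fst g (CurveFamilies.projSpaceStr 1 K) d' =
      pullback.fst g (CurveFamilies.projSpaceStr 1 K) d → d' = d)
    (c' : C) (hs : c' ⤳ k d) (hc' : π c' = π (k d)) : c' = k d := by
  obtain ⟨d₂, hdd, hne, he⟩ := exists_specializes_ne_fst_eq g d hd
  refine eq_of_specializes_of_pure_dim_one π hdim hs hc' (hdd.map k.continuous) ?_
    fun h ↦ hne (hinj h)
  rw [← Scheme.Hom.comp_apply, ← Scheme.Hom.comp_apply, hk, Scheme.Hom.comp_apply, he,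
    Scheme.Hom.comp_apply]

end ChainsInFibers

/-! ### Pairs of smooth points -/

section SmoothPairs

/-- If `U` is smooth over `K`, then a pair of smooth points of the fibres of `C ⟶ U` is a normal
point of `C ×_U C`. -/
lemma isIntegrallyClosed_stalk_pullback {K : Type u} [Field K] {C U : Scheme.{u}}
    (fU : U ⟶ Spec (.of K)) [Smooth fU] (π : C ⟶ U) [LocallyOfFinitePresentation π]
    (t : ↥(pullback π π)) (h₁ : pullback.fst π π t ∈ π.smoothLocus)
    (h₂ : pullback.snd π π t ∈ π.smoothLocus) :
    IsDomain ((pullback π π).presheaf.stalk t) ∧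
      IsIntegrallyClosed ((pullback π π).presheaf.stalk t) := by
  let S := π.smoothLocus
  have hS : Smooth (S.ι ≫ π) := by
    rw [← Scheme.Hom.smoothLocus_eq_top_iff, ← Scheme.Hom.preimage_smoothLocus_eq]
    exact S.ι_preimage_self
  let o : pullback (S.ι ≫ π) (S.ι ≫ π) ⟶ pullback π π :=
    pullback.map _ _ _ _ S.ι S.ι (𝟙 _) (Category.comp_id _) (Category.comp_id _)
  have ho : o ≫ pullback.fst π π ≫ π ≫ fU = pullback.fst _ _ ≫ (S.ι ≫ π) ≫ fU := by
    rw [pullback.lift_fst_assoc, Category.assoc, Category.assoc]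
  obtain ⟨s, rfl⟩ : t ∈ Set.range o := by
    refine (Scheme.Pullback.range_map _ _ _ _ _ _ _ _ _).ge ⟨?_, ?_⟩
    · exact S.range_ι.ge h₁
    · exact S.range_ι.ge h₂
  refine isIntegrallyClosed_stalk_of_mem_smoothLocus (pullback.fst π π ≫ π ≫ fU) _ ?_
  change s ∈ o ⁻¹ᵁ (pullback.fst π π ≫ π ≫ fU).smoothLocus
  have : Smooth (o ≫ pullback.fst π π ≫ π ≫ fU) := by rw [ho]; infer_instance
  rw [Scheme.Hom.preimage_smoothLocus_eq, Scheme.Hom.smoothLocus_eq_top]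
  trivial

end SmoothPairs

/-! ### Irreducibility of total spaces and generic fibres -/

section IrreducibleTotalSpaces

/-- A flat family whose general fibres are geometrically irreducible has irreducible base change to
any irreducible base that meets the locus of these fibres. -/
lemma irreducibleSpace_of_isPullback {C U Y Z : Scheme.{u}} {π : C ⟶ U} [UniversallyOpen π]
    (U' : U.Opens) [GeometricallyIrreducible (π ∣_ U')] {b : Y ⟶ U} [IrreducibleSpace Y]
    (hb : ∃ y, b y ∈ U') {p : Z ⟶ C} {q : Z ⟶ Y} (sq : IsPullback p q π b) :
    IrreducibleSpace Z := by
  have : UniversallyOpen q := MorphismProperty.of_isPullback sq inferInstance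
  let Y' : Y.Opens := b ⁻¹ᵁ U'
  obtain ⟨y, hy⟩ := hb
  have : Nonempty Y' := ⟨⟨y, hy⟩⟩
  have : IrreducibleSpace Y' :=
    Topology.IsOpenEmbedding.irreducibleSpace Y'.ι.isOpenEmbedding
  have : GeometricallyIrreducible (q ∣_ Y') := by
    have h1 : IsPullback ((q ⁻¹ᵁ Y').ι ≫ p) (q ∣_ Y') π ((b ∣_ U') ≫ U'.ι) := by
      rw [morphismRestrict_ι]
      exact (isPullback_morphismRestrict q Y').flip.paste_horiz sq
    have h2 := (isPullback_morphismRestrict π U').flip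
    have h3 : IsPullback (h2.lift ((q ⁻¹ᵁ Y').ι ≫ p) ((q ∣_ Y') ≫ (b ∣_ U'))
        (by rw [h1.w, Category.assoc])) (q ∣_ Y') (π ∣_ U') (b ∣_ U') :=
      .of_right (by rwa [h2.lift_fst]) (h2.lift_snd _ _ _) h2
    exact MorphismProperty.of_isPullback h3 inferInstance
  have : UniversallyOpen (q ∣_ Y') :=
    MorphismProperty.of_isPullback (isPullback_morphismRestrict q Y').flip inferInstance
  have h1 : IrreducibleSpace (q ⁻¹ᵁ Y') :=
    GeometricallyIrreducible.irreducibleSpace (q ∣_ Y') (q ∣_ Y').isOpenMap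
  have hd : Dense ((q ⁻¹ᵁ Y' : Z.Opens) : Set Z) :=
    (Y'.2.dense ⟨y, hy⟩).preimage q.isOpenMap
  have h2 : IsIrreducible ((q ⁻¹ᵁ Y' : Z.Opens) : Set Z) := by
    rw [← (q ⁻¹ᵁ Y').range_ι, ← Set.image_univ]
    exact (IrreducibleSpace.isIrreducible_univ _).image _ (q ⁻¹ᵁ Y').ι.continuous.continuousOn
  exact (irreducibleSpace_def Z).mpr (hd.closure_eq ▸ h2.closure :)

/-- If the generic fibre of a morphism between irreducible schemes is nonempty, then it is
irreducible and its generic point is that of the source. -/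
lemma irreducibleSpace_fiber_genericPoint {Q X : Scheme.{u}} [IrreducibleSpace Q]
    [IrreducibleSpace X] (f : Q ⟶ X) (hf : ∃ y, f y = genericPoint X) :
    IrreducibleSpace (f.fiber (genericPoint X)) ∧
      ∃ z, f.fiberι (genericPoint X) z = genericPoint Q := by
  obtain ⟨y, hy⟩ := hf
  have hg : f (genericPoint Q) = genericPoint X := by
    have h1 := (genericPoint_specializes y).map f.continuous
    rw [hy] at h1
    exact (h1.antisymm (genericPoint_specializes _)).eq
  obtain ⟨z, hz⟩ : ∃ z, f.fiberι (genericPoint X) z = genericPoint Q :=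
    (f.range_fiberι (genericPoint X)).ge hg
  refine ⟨?_, z, hz⟩
  have hz' : closure {z} = Set.univ := Set.eq_univ_of_forall fun w ↦
    specializes_iff_mem_closure.mp ((f.fiberι _).isEmbedding.isInducing.specializes_iff.mp
      (by rw [hz]; exact genericPoint_specializes _))
  exact (irreducibleSpace_def _).mpr (hz' ▸ isIrreducible_singleton.closure :)

end IrreducibleTotalSpaces

/-! ### General points -/

section GeneralPoints

variable {K : Type u} [Field K] {X : Scheme.{u}} (fX : X ⟶ Spec (.of K))

lemma exists_point_mem [IsAlgClosed K] [LocallyOfFiniteType fX] (O : X.Opens)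
    (hO : (O : Set X).Nonempty) :
    ∃ x : Spec (.of K) ⟶ X, x ≫ fX = 𝟙 _ ∧ Set.range x ⊆ (O : Set X) := by
  have : JacobsonSpace X := LocallyOfFiniteType.jacobsonSpace fX
  obtain ⟨x, hxO, (hx : IsClosed {x})⟩ := nonempty_inter_closedPoints hO O.2.isLocallyClosed
  refine ⟨pointOfClosedPoint fX x hx, pointOfClosedPoint_comp fX x hx, ?_⟩
  rintro _ ⟨a, rfl⟩
  rwa [pointOfClosedPoint_apply]

/-- Every point is a specialization of a generic point of an irreducible component. -/
lemma exists_specializes_forall_specializes_eq {E : Type*} [TopologicalSpace E] [QuasiSober E]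
    [T0Space E] (e : E) : ∃ e', e' ⤳ e ∧ ∀ e'', e'' ⤳ e' → e'' = e' := by
  obtain ⟨Z, hZ, hle⟩ := exists_mem_irreducibleComponents_subset_of_isIrreducible
    (closure {e}) isIrreducible_singleton.closure
  obtain ⟨e', he'⟩ := QuasiSober.sober hZ.1 (isClosed_of_mem_irreducibleComponents Z hZ)
  refine ⟨e', ?_, fun e'' h ↦ ?_⟩
  · exact specializes_iff_mem_closure.mpr (he'.def.ge (hle (subset_closure rfl)))
  · refine (h.antisymm (specializes_iff_mem_closure.mpr ?_)).eq
    refine he'.def.ge (hZ.2 isIrreducible_singleton.closure ?_ (subset_closure rfl))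
    rw [← he'.def]
    exact specializes_iff_closure_subset.mp h

/-- If `φ` hits the generic point of `X`, then the members over a dense open `U'` cover a nonempty
open subset of `X`: since `U` is smooth and `π` is flat, points of `C` generize to points over `U'`.
-/
lemma exists_opens_subset_image_preimage [IsAlgClosed K] [IsIntegral X] [LocallyOfFiniteType fX]
    {C U : Scheme.{u}} (fU : U ⟶ Spec (.of K)) [Smooth fU] (π : C ⟶ U) [Flat π]
    [LocallyOfFiniteType π] (φ : C ⟶ X) (hK : π ≫ fU = φ ≫ fX) (U' : U.Opens)
    (hU' : Dense (U' : Set U)) (c : C) (hc : φ c = genericPoint X) :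
    ∃ X₂ : X.Opens, (X₂ : Set X).Nonempty ∧ (X₂ : Set X) ⊆ φ '' (π ⁻¹ᵁ U' : C.Opens) := by
  have : LocallyOfFiniteType φ := by
    have : LocallyOfFiniteType (φ ≫ fX) := by rw [← hK]; infer_instance
    exact locallyOfFiniteType_of_comp φ fX
  have hst := (isIntegrallyClosed_stalk_of_mem_smoothLocus fU (π c)
    (by rw [Scheme.Hom.smoothLocus_eq_top]; trivial)).1
  have : IsLocallyNoetherian U := LocallyOfFiniteType.isLocallyNoetherian fU
  obtain ⟨V, hV, hcV, -, hdom⟩ := exists_isAffineOpen_isDomain (π c) ⊤ trivial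
  obtain ⟨u, hu, huU⟩ : ∃ u, u ⤳ π c ∧ u ∈ U' := by
    have hsp (z : PrimeSpectrum Γ(U, V)) :
        hV.fromSpec (⊥ : PrimeSpectrum Γ(U, V)) ⤳ hV.fromSpec z :=
      ((PrimeSpectrum.le_iff_specializes ⊥ z).mp bot_le).map hV.fromSpec.continuous
    have hsp' {v : U} (hv : v ∈ V) : hV.fromSpec (⊥ : PrimeSpectrum Γ(U, V)) ⤳ v := by
      obtain ⟨z, rfl⟩ := hV.range_fromSpec.ge hv
      exact hsp z
    obtain ⟨v, hvV, hvU⟩ := hU'.inter_open_nonempty V V.2 ⟨_, hcV⟩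
    exact ⟨_, hsp' hcV, (hsp' hvV).mem_open U'.2 hvU⟩
  obtain ⟨c', hc', rfl⟩ := Flat.generalizingMap π hu
  obtain ⟨A, _, _, _, _, j, _, -⟩ := exists_chart fX
  have : IsNoetherianRing A := Algebra.FiniteType.isNoetherianRing K A
  have hj := eq_of_specializes_bot j (genericPoint_specializes _)
  have hφ : φ c' = genericPoint X := by
    have := hc'.map φ.continuous
    rw [hc] at this
    exact (this.antisymm (genericPoint_specializes _)).eq
  obtain ⟨X₂, hX₂, hle⟩ := exists_opens_subset_image φ j (π ⁻¹ᵁ U') c' huU (hφ.trans hj)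
  exact ⟨X₂, ⟨_, hX₂⟩, hle⟩

end GeneralPoints

/-! ### Members of a family through a point -/

section LefschetzMembers

variable {K : Type u} [Field K] {X C U : Scheme.{u}} {fX : X ⟶ Spec (.of K)}
  {π : C ⟶ U} {φ : C ⟶ X}

lemma isPullback_domain_evalThrough (x : Spec (.of K) ⟶ X) :
    IsPullback (pullback.fst (pullback.snd π π)
        (pullback.fst (pullback.diagonal π ≫ pullback.fst π π ≫ φ) x) ≫ pullback.fst π π)
      (pullback.snd (pullback.snd π π)
        (pullback.fst (pullback.diagonal π ≫ pullback.fst π π ≫ φ) x)) π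
      (pullback.fst (pullback.diagonal π ≫ pullback.fst π π ≫ φ) x ≫ π) :=
  (IsPullback.of_hasPullback (pullback.snd π π)
    (pullback.fst (pullback.diagonal π ≫ pullback.fst π π ≫ φ) x)).flip.paste_vert
      (IsPullback.of_hasPullback π π).flip |>.flip

/-- A point of `C` over `x` defines a member of the family through `x`. -/
lemma exists_paramThrough (x : Spec (.of K) ⟶ X) (c : C) (hc : φ c ∈ Set.range x) :
    ∃ y, pullback.fst (pullback.diagonal π ≫ pullback.fst π π ≫ φ) x y = c := by
  obtain ⟨o, ho⟩ := hc
  have e : pullback.diagonal π ≫ pullback.fst π π ≫ φ = φ := pullback.diagonal_fst_assoc π φ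
  obtain ⟨y, hy, -⟩ := Scheme.Pullback.exists_preimage_pullback
    (f := pullback.diagonal π ≫ pullback.fst π π ≫ φ) (g := x) c o (by rw [e, ho])
  exact ⟨y, hy⟩

/-- If the scheme `U_x = φ⁻¹(x)` of members through `x` is irreducible and contains a point of the
locus `U'` of geometrically irreducible members, then the source `C ×_U U_x` of `φ_x` is
irreducible. -/
lemma irreducibleSpace_domain_evalThrough [UniversallyOpen π] (U' : U.Opens)
    [GeometricallyIrreducible (π ∣_ U')] (x : Spec (.of K) ⟶ X)
    (hx : IrreducibleSpace ↥(pullback φ x)) (c : C) (hc : φ c ∈ Set.range x) (hcU : π c ∈ U') :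
    IrreducibleSpace ↥(pullback (pullback.snd π π)
      (pullback.fst (pullback.diagonal π ≫ pullback.fst π π ≫ φ) x)) := by
  have : IrreducibleSpace ↥(pullback (pullback.diagonal π ≫ pullback.fst π π ≫ φ) x) := by
    rwa [pullback.diagonal_fst_assoc π φ]
  obtain ⟨y, hy⟩ := exists_paramThrough x c hc
  refine irreducibleSpace_of_isPullback U' ⟨y, ?_⟩ (isPullback_domain_evalThrough x)
  rwa [Scheme.Hom.comp_apply, hy]

/-- The Lefschetz condition at `x` passes to the members over an open `U₀`, if the source of `φ_x`
is irreducible and one of the members through `x` lies over `U₀`. -/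
lemma isDominant_and_geometricallyIrreducible_restrict [IrreducibleSpace X]
    {fU : U ⟶ Spec (.of K)} (h : π ≫ fU = φ ≫ fX) (U₀ : U.Opens) (x : Spec (.of K) ⟶ X) (hx : x ≫
        fX = 𝟙 _) (c : C) (hc : φ c ∈ Set.range x)
    (hcU : π c ∈ U₀)
    (hQ : IrreducibleSpace ↥(pullback (pullback.snd π π)
      (pullback.fst (pullback.diagonal π ≫ pullback.fst π π ≫ φ) x)))
    (hG : GeometricallyIrreducible
      ((CurveFamilies.evalThrough (pullback.snd π π) (pullback.fst π π ≫ φ) (pullback.diagonal π)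
        x).fiberToSpecResidueField (genericPoint X)))
    {ψ : (π ⁻¹ᵁ U₀).toScheme ⟶ X} (hψ : ψ = (π ⁻¹ᵁ U₀).ι ≫ φ) :
    IsDominant (CurveFamilies.evalThrough (pullback.snd (π ∣_ U₀) (π ∣_ U₀))
        (pullback.fst (π ∣_ U₀) (π ∣_ U₀) ≫ ψ) (pullback.diagonal (π ∣_ U₀)) x) ∧
      GeometricallyIrreducible ((CurveFamilies.evalThrough (pullback.snd (π ∣_ U₀) (π ∣_ U₀))
        (pullback.fst (π ∣_ U₀) (π ∣_ U₀) ≫ ψ) (pullback.diagonal (π ∣_ U₀))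
          x).fiberToSpecResidueField (genericPoint X)) := by
  let ev := CurveFamilies.evalThrough (pullback.snd π π) (pullback.fst π π ≫ φ)
    (pullback.diagonal π) x
  have h₀ : (π ∣_ U₀) ≫ U₀.ι ≫ fU = ψ ≫ fX := by
    rw [hψ, morphismRestrict_ι_assoc, h, Category.assoc]
  let ev₀ := CurveFamilies.evalThrough (pullback.snd (π ∣_ U₀) (π ∣_ U₀))
    (pullback.fst (π ∣_ U₀) (π ∣_ U₀) ≫ ψ) (pullback.diagonal (π ∣_ U₀)) x
  let o : pullback (π ∣_ U₀) (π ∣_ U₀) ⟶ pullback π π :=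
    pullback.map _ _ _ _ (π ⁻¹ᵁ U₀).ι (π ⁻¹ᵁ U₀).ι U₀.ι (morphismRestrict_ι π U₀)
      (morphismRestrict_ι π U₀)
  have ho : o ≫ evalPair fX h = evalPair fX h₀ := by
    apply pullback.hom_ext
    · rw [Category.assoc, evalPair_fst, evalPair_fst, pullback.lift_fst_assoc, Category.assoc, hψ]
    · rw [Category.assoc, evalPair_snd, evalPair_snd, pullback.lift_snd_assoc, Category.assoc, hψ]
  have sq := isPullback_fiber_evalThrough h x hx
  have sq₀ := isPullback_fiber_evalThrough h₀ x hx
  -- the generic fibre of the restricted family is an open subscheme of the generic fibre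
  rw [← ho] at sq₀
  let m : ev₀.fiber (genericPoint X) ⟶ ev.fiber (genericPoint X) :=
    sq.lift (_ ≫ o) _ ((Category.assoc _ _ _).trans sq₀.w)
  have hm : m ≫ ev.fiberToSpecResidueField (genericPoint X) =
      ev₀.fiberToSpecResidueField (genericPoint X) := sq.lift_snd _ _ _
  have sqm := IsPullback.of_right (h₁₁ := m) (by rw [hm]; exact sq₀.flip) (sq.lift_fst _ _ _)
    sq.flip
  have : IsOpenImmersion m := MorphismProperty.of_isPullback sqm.flip (inferInstanceAs
    (IsOpenImmersion o))
  -- it is nonempty, since it contains the generic point of the source of `φ_x`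
  obtain ⟨o₁⟩ : Nonempty (Spec (X.residueField (genericPoint X))) := inferInstance
  obtain ⟨z₁, -⟩ := (ev.fiberToSpecResidueField (genericPoint X)).surjective o₁
  obtain ⟨-, z, hz⟩ := irreducibleSpace_fiber_genericPoint ev
    ⟨_, (ev.range_fiberι (genericPoint X)).le ⟨z₁, rfl⟩⟩
  let a := pullback.fst (pullback.snd π π)
    (pullback.fst (pullback.diagonal π ≫ pullback.fst π π ≫ φ) x)
  have hgen : genericPoint _ ∈ (a ≫ pullback.fst π π ≫ π) ⁻¹ᵁ U₀ := by
    obtain ⟨y, hy⟩ := exists_paramThrough x c hc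
    obtain ⟨q, hq, -⟩ := Scheme.exists_preimage_of_isPullback
      (isPullback_domain_evalThrough (π := π) (φ := φ) x) c y
      (by rw [Scheme.Hom.comp_apply, hy])
    refine (genericPoint_spec _).mem_open_set_iff ((a ≫ pullback.fst π π ≫ π) ⁻¹ᵁ U₀).2 |>.mpr
      ⟨q, Set.mem_univ _, ?_⟩
    exact (congrArg (fun c' ↦ π c' ∈ U₀) hq).mpr hcU
  obtain ⟨t, ht⟩ : a (ev.fiberι (genericPoint X) z) ∈ Set.range o := by
    rw [hz]
    refine (Scheme.Pullback.range_map _ _ _ _ _ _ _ _ _).ge ⟨?_, ?_⟩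
    · refine (π ⁻¹ᵁ U₀).range_ι.ge ?_
      exact hgen
    · refine (π ⁻¹ᵁ U₀).range_ι.ge ?_
      rw [pullback.condition] at hgen
      exact hgen
  obtain ⟨z₀, -, -⟩ := Scheme.exists_preimage_of_isPullback sqm z t
    (by rw [Scheme.Hom.comp_apply]; exact ht.symm)
  have : Surjective (m ≫ ev.fiberToSpecResidueField (genericPoint X)) :=
    ⟨fun w ↦ ⟨z₀, Subsingleton.elim (α := PrimeSpectrum _) _ _⟩⟩
  refine ⟨isDominant_of_nonempty_fiber_genericPoint ev₀ ⟨z₀⟩, ?_⟩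
  change GeometricallyIrreducible (ev₀.fiberToSpecResidueField (genericPoint X))
  rw [← hm]
  have : GeometricallyIrreducible (ev.fiberToSpecResidueField (genericPoint X)) := hG
  infer_instance

end LefschetzMembers

/-! ### Transfer of the Lefschetz condition -/

section LefschetzTransfer

variable {K : Type u} [Field K] {X C U : Scheme.{u}} {fX : X ⟶ Spec (.of K)}

/-- For an open `P₁ ⊆ X × X` whose second projection is nonempty, the slice `X × {x}` through a
general point `x` has its generic point in `P₁`. -/
lemma exists_opens_forall_range_sliceGenericPoint_subset [IsIntegral X] [LocallyOfFiniteType fX]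
    (P₁ : (pullback fX fX).Opens) {p : ↥(pullback fX fX)} (hp : p ∈ P₁) :
    ∃ O : X.Opens, (O : Set X).Nonempty ∧ ∀ (x : Spec (.of K) ⟶ X) (hx : x ≫ fX = 𝟙 _),
      Set.range x ⊆ (O : Set X) →
      Set.range (sliceGenericPoint fX x hx) ⊆ (P₁ : Set ↥(pullback fX fX)) :=
  ⟨⟨_, (pullback.snd fX fX).isOpenMap _ P₁.2⟩, ⟨_, p, hp, rfl⟩, fun x hx h ↦
    range_sliceGenericPoint_subset fX P₁ x hx h⟩

lemma exists_evalPair_mem_range [IrreducibleSpace X] {fU : U ⟶ Spec (.of K)} {π : C ⟶ U}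
    {φ : C ⟶ X} (h : π ≫ fU = φ ≫ fX) (x : Spec (.of K) ⟶ X) (hx : x ≫ fX = 𝟙 _)
    (hG : GeometricallyIrreducible
      ((CurveFamilies.evalThrough (pullback.snd π π) (pullback.fst π π ≫ φ) (pullback.diagonal π)
        x).fiberToSpecResidueField (genericPoint X))) :
    ∃ y, evalPair fX h y ∈ Set.range (sliceGenericPoint fX x hx) := by
  obtain ⟨w⟩ : Nonempty (Spec (X.residueField (genericPoint X))) := inferInstance
  obtain ⟨z, -⟩ := ((CurveFamilies.evalThrough (pullback.snd π π) (pullback.fst π π ≫ φ)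
    (pullback.diagonal π) x).fiberToSpecResidueField (genericPoint X)).surjective w
  exact ⟨_, _, (congrArg (fun f ↦ f z) (isPullback_fiber_evalThrough h x hx).w).symm⟩

lemma locallyOfFiniteType_evalPair {fU : U ⟶ Spec (.of K)} {π : C ⟶ U} {φ : C ⟶ X}
    (h : π ≫ fU = φ ≫ fX) [LocallyOfFiniteType fU] [LocallyOfFiniteType π] :
    LocallyOfFiniteType (evalPair fX h) := by
  have : LocallyOfFiniteType (evalPair fX h ≫ pullback.fst fX fX ≫ fX) := by
    rw [reassoc_of% (evalPair_fst h), ← h]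
    infer_instance
  exact locallyOfFiniteType_of_comp _ (pullback.fst fX fX ≫ fX)

/-- For a family with the Lefschetz condition, `C ×_U C ⟶ X × X` hits the generic point. -/
lemma exists_evalPair_eq_of_lefschetzCondition [IsAlgClosed K] [IsIntegral X]
    [LocallyOfFiniteType fX] {fU : U ⟶ Spec (.of K)} {π : C ⟶ U} {φ : C ⟶ X} (h : π ≫ fU = φ ≫ fX)
    [TopologicalSpace.NoetherianSpace ↥(pullback π π)]
    (hL : CurveFamilies.LefschetzCondition fX π φ) {R : Type u} [CommRing R] [IsDomain R]
    (j : Spec (.of R) ⟶ pullback fX fX) [IsOpenImmersion j] :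
    ∃ e, evalPair fX h e = j (⊥ : PrimeSpectrum R) := by
  by_contra! hne
  obtain ⟨P₁, hP₁, hdisj⟩ := exists_opens_disjoint_range (evalPair fX h) j hne
  obtain ⟨O, hO, hgen⟩ := exists_opens_forall_range_sliceGenericPoint_subset P₁ hP₁
  obtain ⟨V, hV, hL⟩ := hL
  obtain ⟨x, hx, hxV⟩ := exists_point_mem fX (V ⊓ O) (by
    rw [TopologicalSpace.Opens.coe_inf, Set.inter_comm]
    exact hV.inter_open_nonempty O O.2 hO)
  obtain ⟨-, hG⟩ := hL x hx fun y hy ↦ (hxV hy).1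
  obtain ⟨y, hy⟩ := exists_evalPair_mem_range h x hx hG
  exact hdisj y (hgen x hx (fun y hy ↦ (hxV hy).2) hy)

end LefschetzTransfer

theorem lemma8p6 {K : Type u} [Field K] [IsAlgClosed K]
    -- a normal projective variety `X` over `K`
    {X : Scheme.{u}} [IsIntegral X] (fX : X ⟶ Spec (.of K))
    (hXproj : CurveFamilies.IsProjective fX) (hXnormal : CurveFamilies.IsNormal X)
    -- a smooth parameter space `U`, separated and of finite type over `K`
    {U C : Scheme.{u}} (fU : U ⟶ Spec (.of K))
    [IsSeparated fU] [QuasiCompact fU] [Smooth fU]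
    -- a family of reduced, proper, generically irreducible curves mapping to `X` over `K`
    (π : C ⟶ U) (φ : C ⟶ X) (hK : π ≫ fU = φ ≫ fX)
    (hπ : CurveFamilies.IsFamilyOfReducedCurves π)
    (hirr : CurveFamilies.IsGenericallyIrreducible π)
    -- `U_x = φ⁻¹(x)` is irreducible for general `x`
    (hUx : CurveFamilies.ForGeneral fX fun x ↦ IrreducibleSpace ↥(pullback φ x))
    -- a locally closed smooth `W ⊆ U` and a subfamily `W × ℙ¹ ≅ D_W ⊆ C_W = C ×_U W`
    {W : Scheme.{u}} (i : W ⟶ U) [IsImmersion i] [Smooth (i ≫ fU)]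
    (j : pullback (i ≫ fU) (CurveFamilies.projSpaceStr 1 K) ⟶ pullback π i) [IsClosedImmersion j]
    (hj : j ≫ pullback.snd π i = pullback.fst (i ≫ fU) (CurveFamilies.projSpaceStr 1 K))
    -- which satisfies the Lefschetz condition
    (hW : CurveFamilies.LefschetzCondition fX
      (pullback.fst (i ≫ fU) (CurveFamilies.projSpaceStr 1 K)) (j ≫ pullback.fst π i ≫ φ))
    -- a dense open subset of `U`
    (U₀ : U.Opens) (hU₀ : Dense (U₀ : Set U)) :
    CurveFamilies.LefschetzCondition fX (π ∣_ U₀) ((π ⁻¹ᵁ U₀).ι ≫ φ) := by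
  have := hXproj.isProper
  have := hπ.proper
  have := hπ.flat
  have := hπ.surjective
  have := hπ.reduced
  obtain ⟨U', hU', hgi⟩ := hirr
  have : IsLocallyNoetherian U := LocallyOfFiniteType.isLocallyNoetherian fU
  have : LocallyOfFinitePresentation π := inferInstance
  have : CompactSpace U := (quasiCompact_iff_compactSpace (f := fU)).mp inferInstance
  have : IsNoetherian U := {}
  have : TopologicalSpace.NoetherianSpace U := inferInstance
  have : TopologicalSpace.NoetherianSpace W := i.isEmbedding.isInducing.noetherianSpace
  let πD := pullback.fst (i ≫ fU) (CurveFamilies.projSpaceStr 1 K)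
  have : IsLocallyNoetherian (pullback πD πD) :=
    LocallyOfFiniteType.isLocallyNoetherian (pullback.fst πD πD ≫ πD ≫ i ≫ fU)
  have : CompactSpace ↥(pullback πD πD) :=
    QuasiCompact.compactSpace_of_compactSpace (pullback.fst πD πD ≫ πD)
  have : IsNoetherian (pullback πD πD) := {}
  have : TopologicalSpace.NoetherianSpace ↥(pullback πD πD) := inferInstance
  have : IsLocallyNoetherian (pullback π π) :=
    LocallyOfFiniteType.isLocallyNoetherian (pullback.fst π π ≫ π ≫ fU)
  -- the family `D` over `W` as a subfamily of `C`
  let k := j ≫ pullback.fst π i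
  have hk : k ≫ π = πD ≫ i := by
    rw [Category.assoc, pullback.condition, reassoc_of% hj]
  have hkinj : Function.Injective k := (k : _ ⟶ C).isEmbedding.injective
  have hKD : πD ≫ (i ≫ fU) = (j ≫ pullback.fst π i ≫ φ) ≫ fX := by
    rw [← reassoc_of% hk, hK]
    simp only [k, Category.assoc]
  let ε : pullback πD πD ⟶ pullback π π := pullback.map _ _ _ _ k k i hk.symm hk.symm
  have hε₁ : ε ≫ pullback.fst π π = pullback.fst πD πD ≫ k := pullback.lift_fst _ _ _
  have hε₂ : ε ≫ pullback.snd π π = pullback.snd πD πD ≫ k := pullback.lift_snd _ _ _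
  have hε : ε ≫ evalPair fX hK = evalPair fX hKD := by
    apply pullback.hom_ext
    · rw [Category.assoc, evalPair_fst, evalPair_fst, reassoc_of% hε₁]
      simp only [k, Category.assoc]
    · rw [Category.assoc, evalPair_snd, evalPair_snd, reassoc_of% hε₂]
      simp only [k, Category.assoc]
  have := locallyOfFiniteType_evalPair hK
  have := locallyOfFiniteType_evalPair hKD
  -- a generic point `e` of `D ×_W D` over the generic point of `X × X`
  obtain ⟨R, _, _, _, jP, _⟩ := exists_chart_prod fX
  obtain ⟨e₀, he₀⟩ := exists_evalPair_eq_of_lefschetzCondition hKD hW jP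
  obtain ⟨e, hee, hegen⟩ := exists_specializes_forall_specializes_eq e₀
  have he : evalPair fX hKD e = jP (⊥ : PrimeSpectrum R) := by
    refine eq_of_specializes_bot jP ?_
    rw [← he₀]
    exact hee.map (evalPair fX hKD).continuous
  have hεe : evalPair fX hK (ε e) = jP (⊥ : PrimeSpectrum R) := by
    rw [← he, ← hε, Scheme.Hom.comp_apply]
  -- both coordinates of `e` are generic points of curves of the family `C`
  have hs₁ : pullback.fst π π (ε e) ∈ π.smoothLocus := by
    rw [← Scheme.Hom.comp_apply, hε₁, Scheme.Hom.comp_apply]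
    refine mem_smoothLocus_of_forall_specializes π _ (forall_specializes_eq_of_projSpace_one π
      hπ.pure_dim_one _ i k hk hkinj _ fun d' hd' _ ↦ ?_)
    obtain ⟨e', he', rfl⟩ := Flat.generalizingMap (pullback.fst πD πD) hd'
    rw [hegen e' he']
  have hs₂ : pullback.snd π π (ε e) ∈ π.smoothLocus := by
    rw [← Scheme.Hom.comp_apply, hε₂, Scheme.Hom.comp_apply]
    refine mem_smoothLocus_of_forall_specializes π _ (forall_specializes_eq_of_projSpace_one π
      hπ.pure_dim_one _ i k hk hkinj _ fun d' hd' _ ↦ ?_)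
    obtain ⟨e', he', rfl⟩ := Flat.generalizingMap (pullback.snd πD πD) hd'
    rw [hegen e' he']
  obtain ⟨hdom, hic⟩ := isIntegrallyClosed_stalk_pullback fU π (ε e) hs₁ hs₂
  -- the neighbourhoods of the image of `e` and of the generic point of `X × X` for the transfer of
  -- geometric irreducibility from `D ×_W D` to `C ×_U C`
  obtain ⟨T₁, heT, P₁, hP₁, key⟩ := exists_forall_geometricallyIrreducible (evalPair fX hK) jP (ε e)
    hεe hdom hic
  obtain ⟨P₂, hP₂, hP₂T⟩ := exists_opens_subset_image (evalPair fX hKD) jP (ε ⁻¹ᵁ T₁) e heT he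
  obtain ⟨O, hO, hOP⟩ := exists_opens_forall_range_sliceGenericPoint_subset (P₁ ⊓ P₂) ⟨hP₁, hP₂⟩
  -- the members over `U' ∩ U₀` cover a dense open subset of `X`
  have hU : Dense ((U' ⊓ U₀ : U.Opens) : Set U) := hU'.inter_of_isOpen_left hU₀ U'.2
  -- the first projection of `X × X` is flat, so it maps the generic point to that of `X`
  have hη : φ (pullback.fst π π (ε e)) = genericPoint X := by
    obtain ⟨p, hp, hp'⟩ := Flat.generalizingMap (pullback.fst fX fX)
      (genericPoint_specializes (pullback.fst fX fX (jP (⊥ : PrimeSpectrum R))))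
    rw [eq_of_specializes_bot jP hp, ← hεe, ← Scheme.Hom.comp_apply, evalPair_fst,
      Scheme.Hom.comp_apply] at hp'
    exact hp'
  obtain ⟨X₂, hX₂, hX₂φ⟩ := exists_opens_subset_image_preimage fX fU π φ hK (U' ⊓ U₀) hU _ hη
  obtain ⟨V, hV, hUx⟩ := hUx
  obtain ⟨V', hV', hW⟩ := hW
  refine ⟨V ⊓ V' ⊓ (O ⊓ X₂), ?_, fun x hx hxV ↦ ?_⟩
  · exact (hV.inter_of_isOpen_left hV' V.2).inter_of_isOpen_left
      ((O.2.dense hO).inter_of_isOpen_left (X₂.2.dense hX₂) O.2) (V ⊓ V').2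
  have hx₁ := hOP x hx fun y hy ↦ (hxV hy).2.1
  obtain ⟨o⟩ : Nonempty (Spec (.of K)) := inferInstance
  obtain ⟨c, ⟨hcU', hcU₀⟩, hc⟩ := hX₂φ (hxV ⟨o, rfl⟩).2.2
  have hcx : φ c ∈ Set.range x := ⟨o, hc.symm⟩
  have hQ := irreducibleSpace_domain_evalThrough U' x (hUx x hx fun y hy ↦ (hxV hy).1.1) c hcx hcU'
  refine isDominant_and_geometricallyIrreducible_restrict hK U₀ x hx c hcx hcU₀ hQ ?_ rfl
  -- the fibre of `D ×_W D` over the generic point of `X × {x}` is geometrically irreducible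
  obtain ⟨-, hG⟩ := hW x hx fun y hy ↦ (hxV hy).1.2
  have sq := isPullback_fiber_evalThrough hK x hx
  have sqD := isPullback_fiber_evalThrough hKD x hx
  let m := sq.lift (_ ≫ ε) _ ((Category.assoc _ _ _).trans (by rw [hε]; exact sqD.w))
  have hm₂ : m ≫ _ = _ := sq.lift_snd _ _ _
  have hm₁ : m ≫ _ = _ := sq.lift_fst _ _ _
  -- it meets `T₁`, because `P₂` lies in the image of the preimage of `T₁`
  obtain ⟨w⟩ : Nonempty (Spec (X.residueField (genericPoint X))) := inferInstance
  obtain ⟨y, hyT, hy⟩ := hP₂T (hx₁ ⟨w, rfl⟩).2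
  obtain ⟨g, hg, -⟩ := Scheme.exists_preimage_of_isPullback sqD y w hy
  have hZ := (irreducibleSpace_fiber_genericPoint (CurveFamilies.evalThrough (pullback.snd π π)
    (pullback.fst π π ≫ φ) (pullback.diagonal π) x)
      ⟨_, (Scheme.Hom.range_fiberι _ (genericPoint X)).le ⟨m g, rfl⟩⟩).1
  refine key (X.residueField (genericPoint X)) (sliceGenericPoint fX x hx)
    (fun y hy ↦ (hx₁ hy).1) _ _ sq hZ m (by rw [hm₂]; exact hG) ⟨g, ?_⟩
  rw [hm₁, Scheme.Hom.comp_apply, hg]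
  exact hyT
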